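/- Let $\mathbf{k}$ be a field of characteristic $0$. For a $\mathbf{k}[\partial]$-module $W$ and $w(\lambda)=\sum_n\lambda^n w_n\in W[\lambda]$ put $w(-\lambda-\partial)=\sum_n(-\lambda-\partial)^n w_n$; a $\mathbf k$-bilinear map $(a,v)\mapsto a_\lambda v\in W[\lambda]$ ($v\in W$, $a$ in a $\mathbf k[\partial]$-module) is *conformal sesquilinear* if $(\partial a)_\lambda v=-\lambda\, a_\lambda v$ and $a_\lambda(\partial v)=(\partial+\lambda)a_\lambda v$. A *Poisson conformal algebra* is a $\mathbf k[\partial]$-module $P$ with two conformal sesquilinear maps $P\times P\to P[\lambda]$ such that, for all $a,b,c\in P$, $$[a_\lambda b]=-[b_{-\lambda-\partial}a],\quad [a_\lambda[b_\mu c]]=[[a_\lambda b]_{\lambda+\mu}c]+[b_\mu[a_\lambda c]],$$ $$a_\lambda b=b_{-\lambda-\partial}a,\quad (a_\lambda b)_{\lambda+\mu}c=a_\lambda(b_\mu c),\quad [a_\lambda(b_\mu c)]=[a_\lambda b]_{\lambda+\mu}c+b_\mu[a_\lambda c].$$ A *representation* $(V,\rho,l)$ of $P$ is a $\mathbf k[\partial]$-module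 $V$ with conformal sesquilinear maps $(a,v)\mapsto\rho(a)_\lambda v$ and $(a,v)\mapsto l(a)_\lambda v$, $P\times V\to V[\lambda]$, such that for all $a,b\in P$, $v\in V$ $$\rho([a_\lambda b])_{\lambda+\mu}v=\rho(a)_\lambda(\rho(b)_\mu v)-\rho(b)_\mu(\rho(a)_\lambda v),\quad l(a_\lambda b)_{\lambda+\mu}v=l(a)_\lambda(l(b)_\mu v),$$ $$\rho(a_\mu b)_{-\lambda-\partial}v=l(b)_{-\lambda-\mu-\partial}(\rho(a)_{-\lambda-\partial}v)+l(a)_\mu(\rho(b)_{-\lambda-\partial}v),\quad \rho(a)_\lambda(l(b)_\mu v)=l([a_\lambda b])_{\lambda+\mu}v+l(b)_\mu(\rho(a)_\lambda v).$$ $\mathrm{Chom}(V,P)$ is the space of $\mathbf k$-linear maps $T_\lambda:V\to P[\lambda]$ with $T_\lambda(\partial v)=(\partial+\lambda)T_\lambda v$, and $V^{*c}$ is the space of $\mathbf k$-linear maps $f_\lambda:V\to\mathbf k[\lambda]$ with $f_\lambda(\partial v)=\lambda f_\lambda(v)$, a $\mathbf k[\partial]$-module by $(\partial f)_\lambda=-\lambda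 f_\lambda$. A $\mathbf k[\partial]$-module homomorphism $S:V\to P$ is an *$\mathcal O$-operator on $P$ associated with $(V,\rho,l)$* if for all $u,v\in V$ $$S(u)_\lambda S(v)=S(l(S(u))_\lambda v)+S(l(S(v))_{-\lambda-\partial}u),\qquad [S(u)_\lambda S(v)]=S(\rho(S(u))_\lambda v)-S(\rho(S(v))_{-\lambda-\partial}u).$$ For a Poisson conformal algebra $E$ and $r=\sum_i r_i\otimes l_i\in E\otimes E$ (tensor products over $\mathbf k$, $\tau$ the flip, $I$ the identity) set $$[[r,r]]=\sum_{i,j}\big([{r_i}_\mu r_j]\otimes l_i\otimes l_j|_{\mu=I\otimes\partial\otimes I}-r_i\otimes[{r_j}_\mu l_i]\otimes l_j|_{\mu=I\otimes I\otimes\partial}-r_i\otimes r_j\otimes[{l_j}_\mu l_i]|_{\mu=I\otimes\partial\otimes I}\big),$$ $$r\bullet r=\sum_{i,j}\big(r_i\otimes r_j\otimes {l_i}_\mu l_j|_{\mu=\partial\otimes I\otimes I}-r_i\otimes {r_j}_\mu l_i\otimes l_j|_{\mu=-(\partial\otimes I+I\otimes\partial)\otimes I}+{r_i}_\mu r_j\otimes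 l_i\otimes l_j|_{\mu=I\otimes\partial\otimes I}\big).$$ Then $r$ is a *solution of the Poisson conformal Yang-Baxter equation (PCYBE) in $E$* if $[[r,r]]$ and $r\bullet r$ both lie in the image of $\partial\otimes I\otimes I+I\otimes\partial\otimes I+I\otimes I\otimes\partial$ on $E\otimes E\otimes E$; it is *skew-symmetric* if $\tau r=-r$. **Theorem.** Let $P$ be a Poisson conformal algebra and $(V,\rho,l)$ a representation of $P$, where $P$ and $V$ are free of finite rank over $\mathbf k[\partial]$. Define $\rho^*$ and $l^*$ by $(\rho^*(a)_\lambda f)_\mu u=-f_{\mu-\lambda}(\rho(a)_\lambda u)$ and $(l^*(a)_\lambda f)_\mu u=-f_{\mu-\lambda}(l(a)_\lambda u)$ for $a\in P$, $f\in V^{*c}$, $u\in V$. Then: 1. The $\mathbf k[\partial]$-module $P\oplus V^{*c}$ with the operations $$[(a+f)_\lambda(b+g)]=[a_\lambda b]+\rho^*(a)_\lambda g-\rho^*(b)_{-\lambda-\partial}f,\qquad (a+f)_\lambda(b+g)=a_\lambda b-l^*(a)_\lambda g-l^*(b)_{-\lambda-\partial}f$$ is a Poisson conformal algebra, the semidirect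 product $P\ltimes_{\rho^*,-l^*}V^{*c}$. 2. The linear map $P\otimes V^{*c}\to\mathrm{Chom}(V,P)$ sending $a\otimes f$ to $v\mapsto f_{\lambda+\partial}(v)\,a$ (with $\partial$ acting on $a$) is bijective. 3. Let $T\in\mathrm{Chom}(V,P)$ and let $r_T\in P\otimes V^{*c}\subset(P\ltimes_{\rho^*,-l^*}V^{*c})\otimes(P\ltimes_{\rho^*,-l^*}V^{*c})$ be the element corresponding to $T$ under this bijection. Then $r=r_T-\tau r_T$ is a skew-symmetric solution of the PCYBE in $P\ltimes_{\rho^*,-l^*}V^{*c}$ if and only if $T_0=T_\lambda|_{\lambda=0}$ is an $\mathcal O$-operator on $P$ associated with $(V,\rho,l)$. -/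

import Mathlib

open scoped Polynomial TensorProduct

set_option linter.unusedSectionVars false
set_option linter.unusedSimpArgs false

noncomputable section

namespace PoissonConformal

/-! A module over `k[∂]` is a `k[X]`-module (compatible with the `k`-module structure); the variable
`X` acts as `∂`.  A polynomial `p ∈ V[λ]` with coefficients in `V` is its coefficient sequence
`p : ℕ →₀ V`, and a polynomial in `V[λ, μ]` is a finitely supported family `ℕ × ℕ →₀ V`.  On both
spaces `∂` acts on the coefficients. -/

section Polynomials

variable (k : Type*) [Field k] (V : Type*) [AddCommGroup V] [Module k V]

/-- The action of `∂` on a `k[∂]`-module, as a `k`-linear map. -/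
def del [Module k[X] V] [IsScalarTower k k[X] V] : Module.End k V :=
  Algebra.lsmul k k V (Polynomial.X : k[X])

/-- Multiplication by `λ` on `V[λ]`. -/
def lam : Module.End k (ℕ →₀ V) := Finsupp.lmapDomain V k Nat.succ

/-- Multiplication by `λ` on `V[λ, μ]`. -/
def lam₂ : Module.End k (ℕ × ℕ →₀ V) := Finsupp.lmapDomain V k fun p => (p.1 + 1, p.2)

/-- Multiplication by `μ` on `V[λ, μ]`. -/
def mu₂ : Module.End k (ℕ × ℕ →₀ V) := Finsupp.lmapDomain V k fun p => (p.1, p.2 + 1)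

/-- The inclusion of `V` into `V[λ]` as constant polynomials. -/
def const : V →ₗ[k] (ℕ →₀ V) := Finsupp.lsingle 0

/-- The inclusion of `V` into `V[λ, μ]` as constant polynomials. -/
def const₂ : V →ₗ[k] (ℕ × ℕ →₀ V) := Finsupp.lsingle (0, 0)

variable {k V}

/-- Substitution of an operator `Λ` on `W` for the variable of a polynomial in `V[λ]`, with the
coefficients sent to `W` by `h`:  `∑ λⁿ vₙ ↦ ∑ Λⁿ (h vₙ)`. -/
def subst {W : Type*} [AddCommGroup W] [Module k W] (Λ : Module.End k W) (h : V →ₗ[k] W) :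
    (ℕ →₀ V) →ₗ[k] W :=
  Finsupp.lsum k fun n => (Λ ^ n) ∘ₗ h

/-- Application of a linear map to the coefficients of a polynomial. -/
def mapCoeff {W : Type*} [AddCommGroup W] [Module k W] (h : V →ₗ[k] W) :
    (ℕ →₀ V) →ₗ[k] (ℕ →₀ W) :=
  Finsupp.mapRange.linearMap h

/-- The substitution `p(λ) ↦ p(-λ-∂)` on `V[λ]`, where `∂` acts on the value of the product. -/
def skewSubst (k V : Type*) [Field k] [AddCommGroup V] [Module k V] [Module k[X] V]
    [IsScalarTower k k[X] V] : (ℕ →₀ V) →ₗ[k] (ℕ →₀ V) :=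
  subst (-lam k V - del k (ℕ →₀ V)) (const k V)

lemma subst_apply {W : Type*} [AddCommGroup W] [Module k W] (Λ : Module.End k W)
    (h : V →ₗ[k] W) (p : ℕ →₀ V) : subst Λ h p = p.sum fun n v => (Λ ^ n) (h v) := rfl

lemma subst_add_right {W : Type*} [AddCommGroup W] [Module k W] (Λ : Module.End k W)
    (g h : V →ₗ[k] W) (p : ℕ →₀ V) : subst Λ (g + h) p = subst Λ g p + subst Λ h p := by
  simp only [subst_apply, LinearMap.add_apply, map_add, Finsupp.sum_add]

lemma subst_smul_right {W : Type*} [AddCommGroup W] [Module k W] (Λ : Module.End k W)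
    (c : k) (h : V →ₗ[k] W) (p : ℕ →₀ V) : subst Λ (c • h) p = c • subst Λ h p := by
  simp only [subst_apply, LinearMap.smul_apply, map_smul, Finsupp.smul_sum]

end Polynomials

section Algebras

variable {k : Type*} [Field k]
  {P : Type*} [AddCommGroup P] [Module k P] [Module k[X] P] [IsScalarTower k k[X] P]
  {V : Type*} [AddCommGroup V] [Module k V] [Module k[X] V] [IsScalarTower k k[X] V]

/-- Conformal sesquilinearity of a `k`-bilinear map `(a, v) ↦ a_λ v ∈ V[λ]`:
`(∂a)_λ v = -λ a_λ v` and `a_λ (∂v) = (∂ + λ) a_λ v`.  Equivalently, `a ↦ (v ↦ a_λ v)` is a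
`k[∂]`-module homomorphism from `P` to `gc(V) = Chom(V, V)`. -/
structure IsSesquilinear (m : P →ₗ[k] V →ₗ[k] (ℕ →₀ V)) : Prop where
  del_left : ∀ a v, m (del k P a) v = -lam k V (m a v)
  del_right : ∀ a v, m a (del k V v) = (del k (ℕ →₀ V) + lam k V) (m a v)

/-- Commutative associative conformal algebra with product `a_λ b = pr a b`. -/
structure IsCommAssocConformal (pr : P →ₗ[k] P →ₗ[k] (ℕ →₀ P)) : Prop where
  sesq : IsSesquilinear pr
  /-- `(a_λ b)_{λ+μ} c = a_λ (b_μ c)` -/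
  assoc : ∀ a b c,
    subst (lam₂ k P) (subst (lam₂ k P + mu₂ k P) (const₂ k P) ∘ₗ pr.flip c) (pr a b) =
      subst (mu₂ k P) (subst (lam₂ k P) (const₂ k P) ∘ₗ pr a) (pr b c)
  /-- `a_λ b = b_{-λ-∂} a` -/
  comm : ∀ a b, pr a b = skewSubst k P (pr b a)

/-- Lie conformal algebra with bracket `[a_λ b] = br a b`. -/
structure IsLieConformal (br : P →ₗ[k] P →ₗ[k] (ℕ →₀ P)) : Prop where
  sesq : IsSesquilinear br
  /-- `[a_λ b] = -[b_{-λ-∂} a]` -/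
  skew : ∀ a b, br a b = -skewSubst k P (br b a)
  /-- `[a_λ [b_μ c]] = [[a_λ b]_{λ+μ} c] + [b_μ [a_λ c]]` -/
  jacobi : ∀ a b c,
    subst (mu₂ k P) (subst (lam₂ k P) (const₂ k P) ∘ₗ br a) (br b c) =
      subst (lam₂ k P) (subst (lam₂ k P + mu₂ k P) (const₂ k P) ∘ₗ br.flip c) (br a b) +
      subst (lam₂ k P) (subst (mu₂ k P) (const₂ k P) ∘ₗ br b) (br a c)

/-- Poisson conformal algebra with bracket `br` and product `pr`. -/
structure IsPoissonConformal (br pr : P →ₗ[k] P →ₗ[k] (ℕ →₀ P)) : Prop where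
  lie : IsLieConformal br
  commAssoc : IsCommAssocConformal pr
  /-- `[a_λ (b_μ c)] = [a_λ b]_{λ+μ} c + b_μ [a_λ c]` -/
  leibniz : ∀ a b c,
    subst (mu₂ k P) (subst (lam₂ k P) (const₂ k P) ∘ₗ br a) (pr b c) =
      subst (lam₂ k P) (subst (lam₂ k P + mu₂ k P) (const₂ k P) ∘ₗ pr.flip c) (br a b) +
      subst (lam₂ k P) (subst (mu₂ k P) (const₂ k P) ∘ₗ pr b) (br a c)

/-- Representation `(V, l)` of a commutative associative conformal algebra `(P, pr)`. -/
structure IsCommAssocRep (pr : P →ₗ[k] P →ₗ[k] (ℕ →₀ P)) (l : P →ₗ[k] V →ₗ[k] (ℕ →₀ V)) :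
    Prop where
  sesq : IsSesquilinear l
  /-- `l(a_λ b)_{λ+μ} v = l(a)_λ (l(b)_μ v)` -/
  mul : ∀ a b v,
    subst (lam₂ k V) (subst (lam₂ k V + mu₂ k V) (const₂ k V) ∘ₗ l.flip v) (pr a b) =
      subst (mu₂ k V) (subst (lam₂ k V) (const₂ k V) ∘ₗ l a) (l b v)

/-- Representation `(V, ρ)` of a Lie conformal algebra `(P, br)`. -/
structure IsLieRep (br : P →ₗ[k] P →ₗ[k] (ℕ →₀ P)) (ρ : P →ₗ[k] V →ₗ[k] (ℕ →₀ V)) :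
    Prop where
  sesq : IsSesquilinear ρ
  /-- `ρ([a_λ b])_{λ+μ} v = ρ(a)_λ (ρ(b)_μ v) - ρ(b)_μ (ρ(a)_λ v)` -/
  lie : ∀ a b v,
    subst (lam₂ k V) (subst (lam₂ k V + mu₂ k V) (const₂ k V) ∘ₗ ρ.flip v) (br a b) =
      subst (mu₂ k V) (subst (lam₂ k V) (const₂ k V) ∘ₗ ρ a) (ρ b v) -
      subst (lam₂ k V) (subst (mu₂ k V) (const₂ k V) ∘ₗ ρ b) (ρ a v)

/-- Representation `(V, ρ, l)` of a Poisson conformal algebra `(P, br, pr)`. -/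
structure IsPoissonRep (br pr : P →ₗ[k] P →ₗ[k] (ℕ →₀ P)) (ρ l : P →ₗ[k] V →ₗ[k] (ℕ →₀ V)) :
    Prop where
  lie : IsLieRep br ρ
  commAssoc : IsCommAssocRep pr l
  /-- `ρ(a_μ b)_{-λ-∂} v = l(b)_{-λ-μ-∂} (ρ(a)_{-λ-∂} v) + l(a)_μ (ρ(b)_{-λ-∂} v)`, where each `∂`
  acts on the value of the operator that carries it. -/
  rho_mul : ∀ a b v,
    subst (mu₂ k V)
        (subst (-lam₂ k V - del k (ℕ × ℕ →₀ V)) (const₂ k V) ∘ₗ ρ.flip v) (pr a b) =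
      subst (lam₂ k V)
        (subst (-lam₂ k V - mu₂ k V - del k (ℕ × ℕ →₀ V)) (const₂ k V) ∘ₗ l b)
        (skewSubst k V (ρ a v)) +
      subst (lam₂ k V) (subst (mu₂ k V) (const₂ k V) ∘ₗ l a) (skewSubst k V (ρ b v))
  /-- `ρ(a)_λ (l(b)_μ v) = l([a_λ b])_{λ+μ} v + l(b)_μ (ρ(a)_λ v)` -/
  rho_l : ∀ a b v,
    subst (mu₂ k V) (subst (lam₂ k V) (const₂ k V) ∘ₗ ρ a) (l b v) =
      subst (lam₂ k V) (subst (lam₂ k V + mu₂ k V) (const₂ k V) ∘ₗ l.flip v) (br a b) +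
      subst (lam₂ k V) (subst (mu₂ k V) (const₂ k V) ∘ₗ l b) (ρ a v)

/-- `T : V → P` is an `O`-operator on `(P, br, pr)` associated with `(V, ρ, l)`:
`T(u)_λ T(v) = T(l(T u)_λ v) + T(l(T v)_{-λ-∂} u)` and
`[T(u)_λ T(v)] = T(ρ(T u)_λ v) - T(ρ(T v)_{-λ-∂} u)`. -/
structure IsOOperator (br pr : P →ₗ[k] P →ₗ[k] (ℕ →₀ P)) (ρ l : P →ₗ[k] V →ₗ[k] (ℕ →₀ V))
    (T : V →ₗ[k[X]] P) : Prop where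
  mul : ∀ u v, pr (T u) (T v) =
    mapCoeff (T.restrictScalars k) (l (T u) v) +
      mapCoeff (T.restrictScalars k) (skewSubst k V (l (T v) u))
  lie : ∀ u v, br (T u) (T v) =
    mapCoeff (T.restrictScalars k) (ρ (T u) v) -
      mapCoeff (T.restrictScalars k) (skewSubst k V (ρ (T v) u))

/-- The bracket of the semidirect product `P ⋉ V`:
`[(a + x)_λ (b + y)] = [a_λ b] + ρ(a)_λ y - ρ(b)_{-λ-∂} x`. -/
def semidirectBracket (br : P →ₗ[k] P →ₗ[k] (ℕ →₀ P)) (ρ : P →ₗ[k] V →ₗ[k] (ℕ →₀ V)) :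
    (P × V) →ₗ[k] (P × V) →ₗ[k] (ℕ →₀ P × V) :=
  LinearMap.mk₂ k
    (fun a b => mapCoeff (LinearMap.inl k P V) (br a.1 b.1) +
      mapCoeff (LinearMap.inr k P V) (ρ a.1 b.2 - skewSubst k V (ρ b.1 a.2)))
    (by intros; simp only [Prod.fst_add, Prod.snd_add, map_add, LinearMap.add_apply, map_sub]; abel)
    (by intros; simp only [Prod.smul_fst, Prod.smul_snd, map_smul, LinearMap.smul_apply, smul_add,
      smul_sub, map_sub])
    (by intros; simp only [Prod.fst_add, Prod.snd_add, map_add, LinearMap.add_apply, map_sub]; abel)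
    (by intros; simp only [Prod.smul_fst, Prod.smul_snd, map_smul, LinearMap.smul_apply, smul_add,
      smul_sub, map_sub])

/-- The product of the semidirect product `P ⋉ V`:
`(a + x)_λ (b + y) = a_λ b + l(a)_λ y + l(b)_{-λ-∂} x`. -/
def semidirectProduct (pr : P →ₗ[k] P →ₗ[k] (ℕ →₀ P)) (l : P →ₗ[k] V →ₗ[k] (ℕ →₀ V)) :
    (P × V) →ₗ[k] (P × V) →ₗ[k] (ℕ →₀ P × V) :=
  LinearMap.mk₂ k
    (fun a b => mapCoeff (LinearMap.inl k P V) (pr a.1 b.1) +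
      mapCoeff (LinearMap.inr k P V) (l a.1 b.2 + skewSubst k V (l b.1 a.2)))
    (by intros; simp only [Prod.fst_add, Prod.snd_add, map_add, LinearMap.add_apply]; abel)
    (by intros; simp only [Prod.smul_fst, Prod.smul_snd, map_smul, LinearMap.smul_apply, smul_add,
      map_add])
    (by intros; simp only [Prod.fst_add, Prod.snd_add, map_add, LinearMap.add_apply]; abel)
    (by intros; simp only [Prod.smul_fst, Prod.smul_snd, map_smul, LinearMap.smul_apply, smul_add,
      map_add])

end Algebras

section Chom

variable (k : Type*) [Field k]
  (U : Type*) [AddCommGroup U] [Module k U] [Module k[X] U] [IsScalarTower k k[X] U]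
  (V : Type*) [AddCommGroup V] [Module k V] [Module k[X] V] [IsScalarTower k k[X] V]

/-- `Chom(U, V)`: the `k`-linear maps `f : U → V[λ]` with `[∂, f_λ] = -λ f_λ`, that is
`f_λ (∂u) = (∂ + λ) f_λ u`. -/
def Chom : Submodule k (U →ₗ[k] (ℕ →₀ V)) where
  carrier := {f | ∀ u, f (del k U u) = (del k (ℕ →₀ V) + lam k V) (f u)}
  add_mem' := by intro f g hf hg u; simp only [LinearMap.add_apply, map_add, hf u, hg u]
  zero_mem' := by intro u; simp
  smul_mem' := by intro c f hf u; simp only [LinearMap.smul_apply, map_smul, hf u]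

/-- The conformal dual `U^{*c}`: the `k`-linear maps `f : U → k[λ]` with `f_λ (∂u) = λ f_λ u`. -/
def confDual : Submodule k (U →ₗ[k] k[X]) where
  carrier := {f | ∀ u, f (del k U u) = Polynomial.X * f u}
  add_mem' := by intro f g hf hg u; simp only [LinearMap.add_apply, hf u, hg u, mul_add]
  zero_mem' := by intro u; simp
  smul_mem' := by
    intro c f hf u; simp only [LinearMap.smul_apply, hf u, mul_smul_comm]

/-- The conformal dual as a type. -/
def ConfDual : Type _ := confDual k U

instance : AddCommGroup (ConfDual k U) := inferInstanceAs (AddCommGroup (confDual k U))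

instance : Module k (ConfDual k U) := inferInstanceAs (Module k (confDual k U))

variable {k U V}

/-- The map `f_λ : U → k[λ]` underlying an element of the conformal dual. -/
def ConfDual.toLin : ConfDual k U →ₗ[k] U →ₗ[k] k[X] := (confDual k U).subtype

lemma ConfDual.toLin_del (f : ConfDual k U) (u : U) :
    f.toLin (del k U u) = Polynomial.X * f.toLin u := f.2 u

lemma ConfDual.ext {f g : ConfDual k U} (h : ∀ u, f.toLin u = g.toLin u) : f = g :=
  Subtype.ext (LinearMap.ext h)

/-- Constructor for elements of the conformal dual. -/
def ConfDual.mk (f : U →ₗ[k] k[X]) (hf : ∀ u, f (del k U u) = Polynomial.X * f u) :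
    ConfDual k U := ⟨f, hf⟩

@[simp] lemma ConfDual.toLin_mk (f : U →ₗ[k] k[X]) (hf) : (ConfDual.mk f hf).toLin = f := rfl

/-- The action of `∂` on the conformal dual: `(∂f)_λ = -λ f_λ`. -/
def ConfDual.delDual : Module.End k (ConfDual k U) where
  toFun f := ConfDual.mk (-(LinearMap.mulLeft k (Polynomial.X : k[X]) ∘ₗ f.toLin)) (by
    intro u; simp [ConfDual.toLin_del])
  map_add' f g := ConfDual.ext fun u => by simp [mul_add]; abel
  map_smul' c f := ConfDual.ext fun u => by simp

/-- The `k[∂]`-module structure on the conformal dual. -/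
instance : Module k[X] (ConfDual k U) :=
  Module.compHom _ (Polynomial.aeval (ConfDual.delDual (k := k) (U := U))).toRingHom

instance : IsScalarTower k k[X] (ConfDual k U) where
  smul_assoc c q f := by
    change Polynomial.aeval (ConfDual.delDual (k := k) (U := U)) (c • q) f =
      c • Polynomial.aeval (ConfDual.delDual (k := k) (U := U)) q f
    rw [map_smul, LinearMap.smul_apply]

/-- The action of `∂` on the conformal dual is `(∂f)_λ = -λ f_λ`. -/
lemma ConfDual.toLin_del_apply (f : ConfDual k U) (u : U) :
    (del k (ConfDual k U) f).toLin u = -(Polynomial.X * f.toLin u) := by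
  change (Polynomial.aeval (ConfDual.delDual (k := k) (U := U)) Polynomial.X f).toLin u = _
  rw [Polynomial.aeval_X]; rfl

lemma coeff_zero_lam (p : ℕ →₀ V) : (lam k V p) 0 = 0 := by
  unfold lam
  rw [Finsupp.lmapDomain_apply]
  exact Finsupp.mapDomain_of_notMem_range _ _ (by rintro ⟨n, hn⟩; exact Nat.succ_ne_zero n hn)

/-- `T_0 = T_λ|_{λ=0}` for `T ∈ Chom(U, V)`, a homomorphism of `k[∂]`-modules. -/
def Chom.evalZero (T : Chom k U V) : U →ₗ[k[X]] V where
  toFun u := T.1 u 0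
  map_add' u v := by simp
  map_smul' q u := by
    have hX : ∀ w : U, T.1 ((Polynomial.X : k[X]) • w) 0 = (Polynomial.X : k[X]) • T.1 w 0 := by
      intro w
      have h := congrArg (fun p : ℕ →₀ V => p 0) (T.2 w)
      simp only [LinearMap.add_apply, Finsupp.add_apply, coeff_zero_lam, add_zero] at h
      exact h
    simp only [RingHom.id_apply]
    induction q using Polynomial.induction_on' with
    | add p q hp hq => simp only [add_smul, map_add, Finsupp.add_apply, hp, hq]
    | monomial n c =>
      rw [← Polynomial.C_mul_X_pow_eq_monomial, mul_smul, mul_smul, ← Polynomial.algebraMap_eq,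
        algebraMap_smul, algebraMap_smul, map_smul, Finsupp.smul_apply]
      congr 1
      induction n with
      | zero => simp
      | succ n ih => rw [pow_succ', mul_smul, hX, ih, mul_smul]

/-- The `k[∂]`-module homomorphism `V ⊗ U^{*c} → Chom(U, V)`,
`a ⊗ f ↦ (u ↦ f_{λ+∂}(u) a)`, where `∂` acts on `a`. -/
def tensorToChom : (V ⊗[k] ConfDual k U) →ₗ[k] Chom k U V :=
  LinearMap.codRestrict (Chom k U V)
    (TensorProduct.lift (LinearMap.mk₂ k
      (fun (a : V) (f : ConfDual k U) =>
        LinearMap.applyₗ (const k V a) ∘ₗ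
          (Polynomial.aeval (R := k) (lam k V + del k (ℕ →₀ V))).toLinearMap ∘ₗ f.toLin)
      (by intros; ext1 u; simp) (by intros; ext1 u; simp)
      (by intros; ext1 u; simp) (by intros; ext1 u; simp)))
    (by
      intro t
      induction t using TensorProduct.induction_on with
      | zero => rw [map_zero]; exact Submodule.zero_mem _
      | add s t hs ht => rw [map_add]; exact Submodule.add_mem _ hs ht
      | tmul a f =>
        intro u
        simp only [TensorProduct.lift.tmul, LinearMap.mk₂_apply, LinearMap.comp_apply,
          ConfDual.toLin_del, AlgHom.toLinearMap_apply, map_mul, Polynomial.aeval_X,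
          LinearMap.applyₗ_apply_apply, Module.End.mul_apply, LinearMap.add_apply]
        abel)

/-- The defining formula `(a ⊗ f)_λ u = f_{λ+∂}(u) a`. -/
lemma tensorToChom_tmul (a : V) (f : ConfDual k U) (u : U) :
    (tensorToChom (a ⊗ₜ[k] f)).1 u =
      Polynomial.aeval (R := k) (lam k V + del k (ℕ →₀ V)) (f.toLin u) (Finsupp.single 0 a) := rfl

end Chom

section Dual

variable {k : Type*} [Field k]
  {P : Type*} [AddCommGroup P] [Module k P] [Module k[X] P] [IsScalarTower k k[X] P]
  {V : Type*} [AddCommGroup V] [Module k V] [Module k[X] V] [IsScalarTower k k[X] V]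

/-- `-f_{μ-λ}(m(a)_λ u)` as an element of `k[μ][λ]` (the outer variable is `λ`, the inner one
`μ`), linear in `u`. -/
def dualPairing (m : P →ₗ[k] V →ₗ[k] (ℕ →₀ V)) (a : P) (f : ConfDual k V) : V →ₗ[k] k[X][X] :=
  -(subst (LinearMap.mulLeft k (Polynomial.X : k[X][X]))
      ((Polynomial.aeval (R := k)
        (Polynomial.C Polynomial.X - Polynomial.X : k[X][X])).toLinearMap ∘ₗ f.toLin) ∘ₗ m a)

lemma dualPairing_apply (m : P →ₗ[k] V →ₗ[k] (ℕ →₀ V)) (a : P) (f : ConfDual k V) (u : V) :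
    dualPairing m a f u = -((m a u).sum fun n w => Polynomial.X ^ n *
      Polynomial.aeval (R := k)
        (Polynomial.C Polynomial.X - Polynomial.X : k[X][X]) (f.toLin w)) := by
  simp only [dualPairing, subst, LinearMap.neg_apply, LinearMap.comp_apply, Finsupp.lsum_apply,
    LinearMap.pow_mulLeft]
  rfl

lemma dualPairing_add_left (m : P →ₗ[k] V →ₗ[k] (ℕ →₀ V)) (a b : P) (f : ConfDual k V) :
    dualPairing m (a + b) f = dualPairing m a f + dualPairing m b f := by
  ext1 u; simp [dualPairing]; abel

lemma dualPairing_smul_left (m : P →ₗ[k] V →ₗ[k] (ℕ →₀ V)) (c : k) (a : P) (f : ConfDual k V) :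
    dualPairing m (c • a) f = c • dualPairing m a f := by
  ext1 u; simp [dualPairing]

lemma dualPairing_add_right (m : P →ₗ[k] V →ₗ[k] (ℕ →₀ V)) (a : P) (f g : ConfDual k V) :
    dualPairing m a (f + g) = dualPairing m a f + dualPairing m a g := by
  ext1 u
  simp only [dualPairing_apply, LinearMap.add_apply, map_add, mul_add, Finsupp.sum_add, neg_add]

lemma dualPairing_smul_right (m : P →ₗ[k] V →ₗ[k] (ℕ →₀ V)) (c : k) (a : P)
    (f : ConfDual k V) : dualPairing m a (c • f) = c • dualPairing m a f := by
  ext1 u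
  simp only [dualPairing_apply, LinearMap.smul_apply, map_smul, mul_smul_comm, Finsupp.smul_sum,
    smul_neg]

lemma dualPairing_del (m : P →ₗ[k] V →ₗ[k] (ℕ →₀ V)) (hm : IsSesquilinear m) (a : P)
    (f : ConfDual k V) (u : V) :
    dualPairing m a f (del k V u) = Polynomial.C Polynomial.X * dualPairing m a f u := by
  have key : ∀ p : ℕ →₀ V,
      subst (LinearMap.mulLeft k (Polynomial.X : k[X][X])) ((Polynomial.aeval (R := k)
        (Polynomial.C Polynomial.X - Polynomial.X : k[X][X])).toLinearMap ∘ₗ f.toLin)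
          ((del k (ℕ →₀ V) + lam k V) p) =
        Polynomial.C Polynomial.X * subst (LinearMap.mulLeft k (Polynomial.X : k[X][X]))
          ((Polynomial.aeval (R := k)
            (Polynomial.C Polynomial.X - Polynomial.X : k[X][X])).toLinearMap ∘ₗ f.toLin) p := by
    intro p
    induction p using Finsupp.induction_linear with
    | zero => simp
    | add p q hp hq => simp only [map_add, hp, hq, mul_add]
    | single n v =>
      have h1 : del k (ℕ →₀ V) (Finsupp.single n v) = Finsupp.single n (del k V v) := by
        simp [del]
      have h2 : lam k V (Finsupp.single n v) = Finsupp.single (n + 1) v := by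
        simp [lam, Finsupp.mapDomain_single]
      rw [LinearMap.add_apply, map_add, h1, h2]
      simp only [subst, Finsupp.lsum_single, LinearMap.comp_apply, LinearMap.pow_mulLeft,
        LinearMap.mulLeft_apply, AlgHom.toLinearMap_apply, ConfDual.toLin_del, map_mul,
        Polynomial.aeval_X]
      ring
  simp only [dualPairing, LinearMap.neg_apply, LinearMap.comp_apply, hm.del_right]
  rw [key]
  ring

/-- The coefficient of `λⁿ` in `-f_{μ-λ}(m(a)_λ u)`, as an element of the conformal dual. -/
def dualCoeff (m : P →ₗ[k] V →ₗ[k] (ℕ →₀ V)) (hm : IsSesquilinear m) (a : P) (f : ConfDual k V)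
    (n : ℕ) : ConfDual k V :=
  ConfDual.mk ((Polynomial.lcoeff k[X] n).restrictScalars k ∘ₗ dualPairing m a f) (by
    intro u
    simp [dualPairing_del m hm])

lemma dualCoeff_finite [Module.Finite k[X] V] (m : P →ₗ[k] V →ₗ[k] (ℕ →₀ V))
    (hm : IsSesquilinear m) (a : P) (f : ConfDual k V) :
    (Function.support (dualCoeff m hm a f)).Finite := by
  obtain ⟨S, hS⟩ := (Module.Finite.fg_top : (⊤ : Submodule k[X] V).FG)
  refine (Set.finite_Iic (S.sup fun s => (dualPairing m a f s).natDegree)).subset ?_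
  intro n hn
  by_contra hlt
  simp only [Set.mem_Iic, not_le] at hlt
  apply hn
  apply ConfDual.ext
  intro u
  have hu : u ∈ Submodule.span k[X] (S : Set V) := by rw [hS]; trivial
  change (dualPairing m a f u).coeff n = 0
  induction hu using Submodule.span_induction with
  | mem s hs =>
    apply Polynomial.coeff_eq_zero_of_natDegree_lt
    exact lt_of_le_of_lt (Finset.le_sup (f := fun s => (dualPairing m a f s).natDegree) hs) hlt
  | zero => simp
  | add x y _ _ hx hy => simp [hx, hy]
  | smul q x _ hx =>
    induction q using Polynomial.induction_on' with
    | add p q hp hq => simp [add_smul, hp, hq]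
    | monomial i c =>
      rw [← Polynomial.C_mul_X_pow_eq_monomial, mul_smul, ← Polynomial.algebraMap_eq,
        algebraMap_smul, map_smul, Polynomial.coeff_smul]
      suffices h : (dualPairing m a f ((Polynomial.X : k[X]) ^ i • x)).coeff n = 0 by
        rw [h, smul_zero]
      induction i with
      | zero => simpa using hx
      | succ i ih =>
        rw [pow_succ', mul_smul]
        have h := dualPairing_del m hm a f ((Polynomial.X : k[X]) ^ i • x)
        change dualPairing m a f ((Polynomial.X : k[X]) • (Polynomial.X : k[X]) ^ i • x) = _ at h
        rw [h, Polynomial.coeff_C_mul, ih, mul_zero]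

/-- The dual action `m^* : P → gc(V^{*c})`, `(m^*(a)_λ f)_μ u = -f_{μ-λ}(m(a)_λ u)`. -/
def dualAction [Module.Finite k[X] V] (m : P →ₗ[k] V →ₗ[k] (ℕ →₀ V)) (hm : IsSesquilinear m) :
    P →ₗ[k] ConfDual k V →ₗ[k] (ℕ →₀ ConfDual k V) :=
  LinearMap.mk₂ k
    (fun a f => Finsupp.ofSupportFinite (dualCoeff m hm a f) (dualCoeff_finite m hm a f))
    (by
      intro a b f; ext1 n; apply ConfDual.ext; intro u
      change (dualPairing m _ _ u).coeff n = (dualPairing m a f u).coeff n + (dualPairing m b f u).coeff n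
      rw [dualPairing_add_left]; simp)
    (by
      intro c a f; ext1 n; apply ConfDual.ext; intro u
      change (dualPairing m _ _ u).coeff n = c • (dualPairing m a f u).coeff n
      rw [dualPairing_smul_left]; simp)
    (by
      intro a f g; ext1 n; apply ConfDual.ext; intro u
      change (dualPairing m _ _ u).coeff n = (dualPairing m a f u).coeff n + (dualPairing m a g u).coeff n
      rw [dualPairing_add_right]; simp)
    (by
      intro c a f; ext1 n; apply ConfDual.ext; intro u
      change (dualPairing m _ _ u).coeff n = c • (dualPairing m a f u).coeff n
      rw [dualPairing_smul_right]; simp)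

/-- The defining formula `(m^*(a)_λ f)_μ u = -f_{μ-λ}(m(a)_λ u)` in `k[μ][λ]`. -/
lemma dualAction_formula [Module.Finite k[X] V] (m : P →ₗ[k] V →ₗ[k] (ℕ →₀ V))
    (hm : IsSesquilinear m) (a : P) (f : ConfDual k V) (u : V) :
    ((dualAction m hm a f).sum fun n g => Polynomial.X ^ n * Polynomial.C (g.toLin u)) =
      -((m a u).sum fun n w => Polynomial.X ^ n *
        Polynomial.aeval (R := k)
          (Polynomial.C Polynomial.X - Polynomial.X : k[X][X]) (f.toLin w)) := by
  rw [← dualPairing_apply]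
  ext1 i
  have hc : ∀ n, ((dualAction m hm a f) n).toLin u = (dualPairing m a f u).coeff n := fun n => rfl
  simp only [Finsupp.sum, Polynomial.finsetSum_coeff, Polynomial.coeff_X_pow_mul',
    Polynomial.coeff_C, hc]
  by_cases hi : i ∈ (dualAction m hm a f).support
  · rw [Finset.sum_eq_single i]
    · simp
    · intro b _ hb
      split_ifs with h1 h2
      · omega
      · rfl
      · rfl
    · intro h; exact absurd hi h
  · have h0 : (dualPairing m a f u).coeff i = 0 := by
      rw [← hc, Finsupp.notMem_support_iff.mp hi]; simp
    rw [h0]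
    apply Finset.sum_eq_zero
    intro b hb
    split_ifs with h1 h2
    · have : b = i := by omega
      rw [this, h0]
    · rfl
    · rfl

end Dual

section YangBaxter

variable {k : Type*} [Field k]
  {E : Type*} [AddCommGroup E] [Module k E] [Module k[X] E] [IsScalarTower k k[X] E]

variable (k E)

/-- `∂ ⊗ I ⊗ I` -/
def del₁ : Module.End k (E ⊗[k] (E ⊗[k] E)) :=
  TensorProduct.map (del k E) LinearMap.id

/-- `I ⊗ ∂ ⊗ I` -/
def del₂ : Module.End k (E ⊗[k] (E ⊗[k] E)) :=
  TensorProduct.map LinearMap.id (TensorProduct.map (del k E) LinearMap.id)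

/-- `I ⊗ I ⊗ ∂` -/
def del₃ : Module.End k (E ⊗[k] (E ⊗[k] E)) :=
  TensorProduct.map LinearMap.id (TensorProduct.map LinearMap.id (del k E))

variable {k E}

/-- `x ↦ x ⊗ (y ⊗ z)` -/
def slot₁ (y z : E) : E →ₗ[k] E ⊗[k] (E ⊗[k] E) :=
  (TensorProduct.mk k E (E ⊗[k] E)).flip (y ⊗ₜ z)

/-- `y ↦ x ⊗ (y ⊗ z)` -/
def slot₂ (x z : E) : E →ₗ[k] E ⊗[k] (E ⊗[k] E) :=
  TensorProduct.mk k E (E ⊗[k] E) x ∘ₗ (TensorProduct.mk k E E).flip z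

/-- `z ↦ x ⊗ (y ⊗ z)` -/
def slot₃ (x y : E) : E →ₗ[k] E ⊗[k] (E ⊗[k] E) :=
  TensorProduct.mk k E (E ⊗[k] E) x ∘ₗ TensorProduct.mk k E E y

lemma slot₁_add_left (a b c : E) : slot₁ (k := k) (a + b) c = slot₁ a c + slot₁ b c := by
  ext1; simp [slot₁, TensorProduct.add_tmul, TensorProduct.tmul_add]

lemma slot₁_add_right (a b c : E) : slot₁ (k := k) a (b + c) = slot₁ a b + slot₁ a c := by
  ext1; simp [slot₁, TensorProduct.add_tmul, TensorProduct.tmul_add]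

lemma slot₁_smul_left (t : k) (a b : E) : slot₁ (k := k) (t • a) b = t • slot₁ a b := by
  ext1; simp [slot₁, ← TensorProduct.smul_tmul']

lemma slot₁_smul_right (t : k) (a b : E) : slot₁ (k := k) a (t • b) = t • slot₁ a b := by
  ext1; simp [slot₁, ← TensorProduct.smul_tmul']

lemma slot₂_add_left (a b c : E) : slot₂ (k := k) (a + b) c = slot₂ a c + slot₂ b c := by
  ext1; simp [slot₂, TensorProduct.add_tmul, TensorProduct.tmul_add]

lemma slot₂_add_right (a b c : E) : slot₂ (k := k) a (b + c) = slot₂ a b + slot₂ a c := by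
  ext1; simp [slot₂, TensorProduct.add_tmul, TensorProduct.tmul_add]

lemma slot₂_smul_left (t : k) (a b : E) : slot₂ (k := k) (t • a) b = t • slot₂ a b := by
  ext1; simp [slot₂, ← TensorProduct.smul_tmul']

lemma slot₂_smul_right (t : k) (a b : E) : slot₂ (k := k) a (t • b) = t • slot₂ a b := by
  ext1; simp [slot₂, ← TensorProduct.smul_tmul']

lemma slot₃_add_left (a b c : E) : slot₃ (k := k) (a + b) c = slot₃ a c + slot₃ b c := by
  ext1; simp [slot₃, TensorProduct.add_tmul, TensorProduct.tmul_add]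

lemma slot₃_add_right (a b c : E) : slot₃ (k := k) a (b + c) = slot₃ a b + slot₃ a c := by
  ext1; simp [slot₃, TensorProduct.add_tmul, TensorProduct.tmul_add]

lemma slot₃_smul_left (t : k) (a b : E) : slot₃ (k := k) (t • a) b = t • slot₃ a b := by
  ext1; simp [slot₃, ← TensorProduct.smul_tmul']

lemma slot₃_smul_right (t : k) (a b : E) : slot₃ (k := k) a (t • b) = t • slot₃ a b := by
  ext1; simp [slot₃, ← TensorProduct.smul_tmul']

/-- A map linear in each of four arguments, as a bilinear map on `E ⊗ E`, with value
`Q a b c d` at `(a ⊗ b, c ⊗ d)`. -/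
def liftQuad {M : Type*} [AddCommGroup M] [Module k M] (Q : E → E → E → E → M)
    (h₁ : ∀ b c d, IsLinearMap k fun a => Q a b c d)
    (h₂ : ∀ a c d, IsLinearMap k fun b => Q a b c d)
    (h₃ : ∀ a b d, IsLinearMap k fun c => Q a b c d)
    (h₄ : ∀ a b c, IsLinearMap k fun d => Q a b c d) :
    (E ⊗[k] E) →ₗ[k] (E ⊗[k] E) →ₗ[k] M :=
  TensorProduct.lift (LinearMap.mk₂ k
    (fun a b => TensorProduct.lift (LinearMap.mk₂ k (fun c d => Q a b c d)
      (fun c c' d => (h₃ a b d).map_add c c') (fun t c d => (h₃ a b d).map_smul t c)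
      (fun c d d' => (h₄ a b c).map_add d d') (fun t c d => (h₄ a b c).map_smul t d)))
    (fun a a' b => TensorProduct.ext' fun c d => by simp [(h₁ b c d).map_add])
    (fun t a b => TensorProduct.ext' fun c d => by simp [(h₁ b c d).map_smul])
    (fun a b b' => TensorProduct.ext' fun c d => by simp [(h₂ a c d).map_add])
    (fun t a b => TensorProduct.ext' fun c d => by simp [(h₂ a c d).map_smul]))

/-- The bilinear extension of
`(a ⊗ b, c ⊗ d) ↦ [a_μ c] ⊗ b ⊗ d |_{μ = I⊗∂⊗I} - a ⊗ [c_μ b] ⊗ d |_{μ = I⊗I⊗∂}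
  - a ⊗ c ⊗ [d_μ b] |_{μ = I⊗∂⊗I}`. -/
def lieYB (br : E →ₗ[k] E →ₗ[k] (ℕ →₀ E)) :
    (E ⊗[k] E) →ₗ[k] (E ⊗[k] E) →ₗ[k] E ⊗[k] (E ⊗[k] E) :=
  liftQuad
    (fun a b c d => subst (del₂ k E) (slot₁ b d) (br a c) - subst (del₃ k E) (slot₂ a d) (br c b)
      - subst (del₂ k E) (slot₃ a c) (br d b))
    (fun b c d => ⟨by
      intros
      simp only [map_add, LinearMap.add_apply, slot₂_add_left, slot₃_add_left, subst_add_right]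
      abel, by
      intros
      simp only [map_smul, LinearMap.smul_apply, slot₂_smul_left, slot₃_smul_left,
        subst_smul_right, smul_sub]⟩)
    (fun a c d => ⟨by
      intros
      simp only [map_add, slot₁_add_left, subst_add_right]
      abel, by
      intros
      simp only [map_smul, slot₁_smul_left, subst_smul_right, smul_sub]⟩)
    (fun a b d => ⟨by
      intros
      simp only [map_add, LinearMap.add_apply, slot₃_add_right, subst_add_right]
      abel, by
      intros
      simp only [map_smul, LinearMap.smul_apply, slot₃_smul_right, subst_smul_right, smul_sub]⟩)
    (fun a b c => ⟨by
      intros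
      simp only [map_add, LinearMap.add_apply, slot₁_add_right, slot₂_add_right, subst_add_right]
      abel, by
      intros
      simp only [map_smul, LinearMap.smul_apply, slot₁_smul_right, slot₂_smul_right,
        subst_smul_right, smul_sub]⟩)

/-- The bilinear extension of
`(a ⊗ b, c ⊗ d) ↦ a ⊗ c ⊗ b_μ d |_{μ = ∂⊗I⊗I} - a ⊗ c_μ b ⊗ d |_{μ = -(∂⊗I+I⊗∂)⊗I}
  + a_μ c ⊗ b ⊗ d |_{μ = I⊗∂⊗I}`. -/
def assocYB (pr : E →ₗ[k] E →ₗ[k] (ℕ →₀ E)) :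
    (E ⊗[k] E) →ₗ[k] (E ⊗[k] E) →ₗ[k] E ⊗[k] (E ⊗[k] E) :=
  liftQuad
    (fun a b c d => subst (del₁ k E) (slot₃ a c) (pr b d)
      - subst (-(del₁ k E + del₂ k E)) (slot₂ a d) (pr c b)
      + subst (del₂ k E) (slot₁ b d) (pr a c))
    (fun b c d => ⟨by
      intros
      simp only [map_add, LinearMap.add_apply, slot₂_add_left, slot₃_add_left, subst_add_right]
      abel, by
      intros
      simp only [map_smul, LinearMap.smul_apply, slot₂_smul_left, slot₃_smul_left,
        subst_smul_right, smul_sub, smul_add]⟩)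
    (fun a c d => ⟨by
      intros
      simp only [map_add, LinearMap.add_apply, slot₁_add_left, subst_add_right]
      abel, by
      intros
      simp only [map_smul, LinearMap.smul_apply, slot₁_smul_left, subst_smul_right, smul_sub,
        smul_add]⟩)
    (fun a b d => ⟨by
      intros
      simp only [map_add, LinearMap.add_apply, slot₃_add_right, subst_add_right]
      abel, by
      intros
      simp only [map_smul, LinearMap.smul_apply, slot₃_smul_right, subst_smul_right, smul_sub,
        smul_add]⟩)
    (fun a b c => ⟨by
      intros
      simp only [map_add, slot₁_add_right, slot₂_add_right, subst_add_right]
      abel, by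
      intros
      simp only [map_smul, slot₁_smul_right, slot₂_smul_right, subst_smul_right, smul_sub,
        smul_add]⟩)

/-- The formula for `[[r, r]]` with `r = ∑ᵢ x i ⊗ y i`. -/
lemma lieYB_sum (br : E →ₗ[k] E →ₗ[k] (ℕ →₀ E)) {ι : Type*} (s : Finset ι) (x y : ι → E) :
    lieYB br (∑ i ∈ s, x i ⊗ₜ[k] y i) (∑ i ∈ s, x i ⊗ₜ[k] y i) = ∑ i ∈ s, ∑ j ∈ s,
      (subst (del₂ k E) (slot₁ (y i) (y j)) (br (x i) (x j))
        - subst (del₃ k E) (slot₂ (x i) (y j)) (br (x j) (y i))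
        - subst (del₂ k E) (slot₃ (x i) (x j)) (br (y j) (y i))) := by
  simp only [map_sum, LinearMap.sum_apply]
  rw [Finset.sum_comm]
  rfl

/-- The formula for `r • r` with `r = ∑ᵢ x i ⊗ y i`. -/
lemma assocYB_sum (pr : E →ₗ[k] E →ₗ[k] (ℕ →₀ E)) {ι : Type*} (s : Finset ι) (x y : ι → E) :
    assocYB pr (∑ i ∈ s, x i ⊗ₜ[k] y i) (∑ i ∈ s, x i ⊗ₜ[k] y i) = ∑ i ∈ s, ∑ j ∈ s,
      (subst (del₁ k E) (slot₃ (x i) (x j)) (pr (y i) (y j))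
        - subst (-(del₁ k E + del₂ k E)) (slot₂ (x i) (y j)) (pr (x j) (y i))
        + subst (del₂ k E) (slot₁ (y i) (y j)) (pr (x i) (x j))) := by
  simp only [map_sum, LinearMap.sum_apply]
  rw [Finset.sum_comm]
  rfl

/-- `r` is a skew-symmetric solution of the Poisson conformal Yang-Baxter equation in
`(E, br, pr)`: `τ r = -r`, and `[[r, r]]` and `r • r` vanish modulo
`∂⊗I⊗I + I⊗∂⊗I + I⊗I⊗∂`. -/
structure IsSkewPCYBESolution (br pr : E →ₗ[k] E →ₗ[k] (ℕ →₀ E)) (r : E ⊗[k] E) : Prop where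
  skew : TensorProduct.comm k E E r = -r
  lie : lieYB br r r ∈ LinearMap.range (del₁ k E + del₂ k E + del₃ k E)
  assoc : assocYB pr r r ∈ LinearMap.range (del₁ k E + del₂ k E + del₃ k E)

end YangBaxter

section Inclusion

variable {k : Type*} [Field k] {P : Type*} [AddCommGroup P] [Module k P]
  {Q : Type*} [AddCommGroup Q] [Module k Q]

/-- The inclusion `P ⊗ Q ⊂ (P ⊕ Q) ⊗ (P ⊕ Q)`. -/
def inclTensor : (P ⊗[k] Q) →ₗ[k] (P × Q) ⊗[k] (P × Q) :=
  TensorProduct.map (LinearMap.inl k P Q) (LinearMap.inr k P Q)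

/-- `r - τ r` in `(P ⊕ Q) ⊗ (P ⊕ Q)`, for `r ∈ P ⊗ Q`. -/
def skewOf (r : P ⊗[k] Q) : (P × Q) ⊗[k] (P × Q) :=
  inclTensor r - TensorProduct.comm k (P × Q) (P × Q) (inclTensor r)

end Inclusion

end PoissonConformal

end

open PoissonConformal

/-! Everything rests on evaluating polynomial identities at operators. Let Λ, M be commuting
endomorphisms of a space W and h : V → W a linear map. An identity in V[λ, μ] then yields one in W,
with Λ, M for λ, μ and h applied to the coefficients. If D commutes with Λ and h∂ = Dh, the
substitution -λ-∂ becomes -Λ-D. This calculus (`map_subst`, `subst_skewSubst`, `subst₂`) replaces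
all comparison of coefficients.

Semidirect product. Along any representation it is a Poisson conformal algebra
(`IsPoissonRep.semidirect`): the P-component of each axiom is the axiom of P. The V-component splits
according to which argument contributes its V-part, and each piece follows from representation
identities in two of the three variables λ, μ, ν = -λ-μ-∂. It remains that (ρ^*, -l^*) is a
representation (`IsPoissonRep.dual`). Duality reverses composition (`subst_comp_dualAction`). For
ρ^* the minus sign in the definition compensates the reversal, and for l^* the operators l(a), l(b)
commute, so the opposite sign is the right one. The compatibility of ρ^* with the product uses both
compatibilities of ρ and l, the terms l([a_λ b]) and l([b_μ a]) cancelling by skew-symmetry.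

Bijection. Since ∂ acts on V^{*c} by -λ, a basis b_i of V has a dual basis with f = ∑ f_{-∂}(b_i)
b_i^*, and multiplication by λ on Chom(V, P) corresponds to -(I⊗∂) - (∂⊗I) on P ⊗ V^{*c}. Hence T is
recovered from its values T_λ(b_i) (`chomToTensor`).

Yang-Baxter equation. Put S = T_0. As V^{*c} is an ideal with zero products, [[r,r]] and r • r lie
in the three components of the triple tensor product in which P occurs once. Take commuting Du, Dv
on W and c : P → W with c∂ = -(Du+Dv)c. Then a ⊗ f ⊗ g ↦ f_{-Du}(u) g_{-Dv}(v) c(a) turns the three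
operators ∂ into -(Du+Dv), Du, Dv, whose sum is zero, so it kills the image of the total ∂. On
[[r,r]] and r • r its value is, up to sign, the defect of the O-operator equation at (u, v), with Du
for λ and c on the coefficients; the other two components behave in the same way (`evalFst_lieYB`,
`evalFst_assocYB` and their analogues).

Two choices of W finish the proof. For W = P[λ], Du = -λ, Dv = λ-∂ and c the inclusion of constants,
the value determines the defect, so a solution gives an O-operator. For W the cokernel of the total
∂ and c(a) the class of a ⊗ b_i^* ⊗ b_j^*, summing the evaluations at (b_i, b_j) over all i, j and
over the three components returns the class of the tensor itself (`reconstruct`), so an O-operator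
gives a solution. -/

noncomputable section

namespace PoissonConformal

/-! ### Substitution of operators for the variable of a polynomial. -/

section SubstCalculus

variable {k : Type*} [Field k]
  {V : Type*} [AddCommGroup V] [Module k V]
  {V' : Type*} [AddCommGroup V'] [Module k V']
  {W : Type*} [AddCommGroup W] [Module k W]
  {W' : Type*} [AddCommGroup W'] [Module k W']

lemma subst_single (Λ : Module.End k W) (h : V →ₗ[k] W) (n : ℕ) (v : V) :
    subst Λ h (Finsupp.single n v) = (Λ ^ n) (h v) := by
  simp [subst]

lemma const_apply (v : V) : const k V v = Finsupp.single 0 v := rfl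

lemma subst_const (Λ : Module.End k W) (h : V →ₗ[k] W) (v : V) :
    subst Λ h (const k V v) = h v := by
  simp [const_apply, subst_single]

lemma intertwine_pow {φ : W →ₗ[k] W'} {Λ : Module.End k W} {Λ' : Module.End k W'}
    (hφ : ∀ w, φ (Λ w) = Λ' (φ w)) (n : ℕ) (w : W) : φ ((Λ ^ n) w) = (Λ' ^ n) (φ w) := by
  induction n with
  | zero => rfl
  | succ n ih => rw [pow_succ', pow_succ', Module.End.mul_apply, hφ, ih, Module.End.mul_apply]

lemma intertwine_aeval {φ : W →ₗ[k] W'} {Λ : Module.End k W} {Λ' : Module.End k W'}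
    (hφ : ∀ w, φ (Λ w) = Λ' (φ w)) (q : k[X]) (w : W) :
    φ (Polynomial.aeval Λ q w) = Polynomial.aeval Λ' q (φ w) := by
  induction q using Polynomial.induction_on' with
  | add p q hp hq => simp only [map_add, LinearMap.add_apply, hp, hq]
  | monomial n c =>
    simp only [Polynomial.aeval_monomial, Module.End.mul_apply, Module.algebraMap_end_apply,
      map_smul, intertwine_pow hφ]

/-- Naturality of substitution. -/
lemma map_subst {φ : W →ₗ[k] W'} {Λ : Module.End k W} {Λ' : Module.End k W'}
    (hφ : ∀ w, φ (Λ w) = Λ' (φ w)) (h : V →ₗ[k] W) (p : ℕ →₀ V) :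
    φ (subst Λ h p) = subst Λ' (φ ∘ₗ h) p := by
  simp only [subst_apply, Finsupp.sum, map_sum, intertwine_pow hφ, LinearMap.comp_apply]

/-- The axioms are written as nested substitutions, so naturality is needed at both levels at once.
-/
lemma map_subst_comp {V'' : Type*} [AddCommGroup V''] [Module k V'']
    {φ : W →ₗ[k] W'} {A B : Module.End k W}
    {A' B' : Module.End k W'} (hA : ∀ w, φ (A w) = A' (φ w)) (hB : ∀ w, φ (B w) = B' (φ w))
    (h : V →ₗ[k] W) (f : V'' →ₗ[k] (ℕ →₀ V)) (p : ℕ →₀ V'') :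
    φ (subst A (subst B h ∘ₗ f) p) = subst A' (subst B' (φ ∘ₗ h) ∘ₗ f) p := by
  rw [map_subst hA]
  exact congr(subst A' $(LinearMap.ext fun v => map_subst hB h (f v)) p)

lemma subst_congr {Λ : Module.End k W} {g h : V →ₗ[k] W} (hgh : ∀ v, g v = h v) (p : ℕ →₀ V) :
    subst Λ g p = subst Λ h p := by
  rw [LinearMap.ext hgh]

lemma subst_mapCoeff (Λ : Module.End k W) (h : V →ₗ[k] W) (g : V' →ₗ[k] V) (p : ℕ →₀ V') :
    subst Λ h (mapCoeff g p) = subst Λ (h ∘ₗ g) p := by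
  induction p using Finsupp.induction_linear with
  | zero => simp
  | add p q hp hq => simp only [map_add, hp, hq]
  | single n v => simp [mapCoeff, subst_single]

lemma subst_zero_right (Λ : Module.End k W) (p : ℕ →₀ V) :
    subst Λ (0 : V →ₗ[k] W) p = 0 := by
  simp [subst_apply]

lemma subst_neg_right (Λ : Module.End k W) (h : V →ₗ[k] W) (p : ℕ →₀ V) :
    subst Λ (-h) p = -subst Λ h p := by
  simp [subst_apply, Finsupp.sum]

lemma subst_sub_right (Λ : Module.End k W) (g h : V →ₗ[k] W) (p : ℕ →₀ V) :
    subst Λ (g - h) p = subst Λ g p - subst Λ h p := by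
  rw [sub_eq_add_neg, subst_add_right, subst_neg_right, sub_eq_add_neg]

lemma lam_single (n : ℕ) (v : V) :
    lam k V (Finsupp.single n v) = Finsupp.single (n + 1) v := by
  simp [lam, Finsupp.mapDomain_single]

lemma subst_lam (Λ : Module.End k W) (h : V →ₗ[k] W) (p : ℕ →₀ V) :
    subst Λ h (lam k V p) = Λ (subst Λ h p) := by
  induction p using Finsupp.induction_linear with
  | zero => simp
  | add p q hp hq => simp only [map_add, hp, hq]
  | single n v => rw [lam_single, subst_single, subst_single, pow_succ', Module.End.mul_apply]

lemma subst_lam_const (p : ℕ →₀ V) : subst (lam k V) (const k V) p = p := by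
  induction p using Finsupp.induction_linear with
  | zero => simp
  | add p q hp hq => simp only [map_add, hp, hq]
  | single n v =>
    rw [subst_single, const_apply]
    induction n with
    | zero => rfl
    | succ n ih => rw [pow_succ', Module.End.mul_apply, ih, lam_single]

lemma subst_comp_of_commute {Λ M : Module.End k W} (hc : Commute Λ M) (h : V →ₗ[k] W) (p : ℕ →₀ V) :
    subst Λ (M ∘ₗ h) p = M (subst Λ h p) :=
  (map_subst (fun w => congr($(hc.eq.symm) w)) h p).symm

end SubstCalculus

/-! ### Substitution in the presence of ∂, and in two variables. -/

section DelCalculus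

variable {k : Type*} [Field k]
  {V : Type*} [AddCommGroup V] [Module k V] [Module k[X] V] [IsScalarTower k k[X] V]
  {W : Type*} [AddCommGroup W] [Module k W]
  {W' : Type*} [AddCommGroup W'] [Module k W']

lemma aeval_del (q : k[X]) (v : V) : Polynomial.aeval (del k V) q v = q • v := by
  induction q using Polynomial.induction_on' with
  | add p q hp hq => simp only [map_add, LinearMap.add_apply, hp, hq, add_smul]
  | monomial n c =>
    rw [Polynomial.aeval_monomial, ← Polynomial.C_mul_X_pow_eq_monomial, mul_smul,
      ← Polynomial.algebraMap_eq, algebraMap_smul]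
    simp only [Module.End.mul_apply, Module.algebraMap_end_apply]
    congr 1
    induction n with
    | zero => simp
    | succ n ih => rw [pow_succ', pow_succ', Module.End.mul_apply, ih, mul_smul]; rfl

lemma del_single (n : ℕ) (v : V) :
    del k (ℕ →₀ V) (Finsupp.single n v) = Finsupp.single n (del k V v) := by
  simp [del]

lemma del_single₂ (n : ℕ × ℕ) (v : V) :
    del k (ℕ × ℕ →₀ V) (Finsupp.single n v) = Finsupp.single n (del k V v) := by
  simp [del]

lemma subst_del {Λ D : Module.End k W} (hc : Commute Λ D) {h : V →ₗ[k] W}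
    (hD : ∀ v, h (del k V v) = D (h v)) (p : ℕ →₀ V) :
    subst Λ h (del k (ℕ →₀ V) p) = D (subst Λ h p) := by
  induction p using Finsupp.induction_linear with
  | zero => simp
  | add p q hp hq => simp only [map_add, hp, hq]
  | single n v =>
    rw [del_single, subst_single, subst_single, hD]
    exact congr($((hc.pow_left n).eq) (h v))

/-- Substitution along h sends multiplication by λ to Λ and the action of ∂ on coefficients to D,
hence -λ-∂ to -Λ-D. The operator D may be chosen freely, subject only to its compatibility with h.
-/
lemma subst_skewSubst {Λ D : Module.End k W} (hc : Commute Λ D) {h : V →ₗ[k] W}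
    (hD : ∀ v, h (del k V v) = D (h v)) (p : ℕ →₀ V) :
    subst Λ h (skewSubst k V p) = subst (-Λ - D) h p := by
  rw [skewSubst, map_subst (φ := subst Λ h) (Λ' := -Λ - D)]
  · exact congr(subst _ $(LinearMap.ext fun v => subst_const Λ h v) p)
  · intro w
    simp only [LinearMap.sub_apply, LinearMap.neg_apply, map_sub, map_neg, subst_lam,
      subst_del hc hD]

lemma commute_lam_del : Commute (lam k V) (del k (ℕ →₀ V)) := by
  refine LinearMap.ext fun w => ?_
  induction w using Finsupp.induction_linear with
  | zero => simp
  | add p q hp hq => simp only [map_add, hp, hq]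
  | single n v => simp only [Module.End.mul_apply, lam_single, del_single]

/-- Substitution of commuting operators for the two variables of a polynomial in `V[λ, μ]`. -/
def subst₂ {V : Type*} [AddCommGroup V] [Module k V] (Λ M : Module.End k W) (h : V →ₗ[k] W) :
    (ℕ × ℕ →₀ V) →ₗ[k] W :=
  Finsupp.lsum k fun n => (Λ ^ n.1 * M ^ n.2) ∘ₗ h

section

variable {V : Type*} [AddCommGroup V] [Module k V]

lemma subst₂_single (Λ M : Module.End k W) (h : V →ₗ[k] W) (n : ℕ × ℕ) (v : V) :
    subst₂ Λ M h (Finsupp.single n v) = (Λ ^ n.1 * M ^ n.2) (h v) := by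
  simp [subst₂]

lemma lam₂_single (n : ℕ × ℕ) (v : V) :
    lam₂ k V (Finsupp.single n v) = Finsupp.single (n.1 + 1, n.2) v := by
  simp [lam₂, Finsupp.mapDomain_single]

lemma mu₂_single (n : ℕ × ℕ) (v : V) :
    mu₂ k V (Finsupp.single n v) = Finsupp.single (n.1, n.2 + 1) v := by
  simp [mu₂, Finsupp.mapDomain_single]

lemma subst₂_comp_const₂ (Λ M : Module.End k W) (h : V →ₗ[k] W) :
    subst₂ Λ M h ∘ₗ const₂ k V = h := by
  ext v; simp [const₂, subst₂_single]

lemma subst₂_lam₂ (Λ M : Module.End k W) (h : V →ₗ[k] W) (p : ℕ × ℕ →₀ V) :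
    subst₂ Λ M h (lam₂ k V p) = Λ (subst₂ Λ M h p) := by
  induction p using Finsupp.induction_linear with
  | zero => simp
  | add p q hp hq => simp only [map_add, hp, hq]
  | single n v =>
    rw [lam₂_single, subst₂_single, subst₂_single, pow_succ', mul_assoc, Module.End.mul_apply]

lemma subst₂_mu₂ {Λ M : Module.End k W} (hc : Commute Λ M) (h : V →ₗ[k] W) (p : ℕ × ℕ →₀ V) :
    subst₂ Λ M h (mu₂ k V p) = M (subst₂ Λ M h p) := by
  induction p using Finsupp.induction_linear with
  | zero => simp
  | add p q hp hq => simp only [map_add, hp, hq]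
  | single n v =>
    rw [mu₂_single, subst₂_single, subst₂_single, pow_succ', ← mul_assoc,
      (hc.pow_left n.1).eq, mul_assoc, Module.End.mul_apply]

lemma commute_lam₂_mu₂ : Commute (lam₂ k V) (mu₂ k V) := by
  refine LinearMap.ext fun w => ?_
  induction w using Finsupp.induction_linear with
  | zero => simp
  | add p q hp hq => simp only [map_add, hp, hq]
  | single n v => simp only [Module.End.mul_apply, lam₂_single, mu₂_single]

end

lemma subst₂_del {Λ M D : Module.End k W} (hΛ : Commute Λ D) (hM : Commute M D) {h : V →ₗ[k] W}
    (hD : ∀ v, h (del k V v) = D (h v)) (p : ℕ × ℕ →₀ V) :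
    subst₂ Λ M h (del k (ℕ × ℕ →₀ V) p) = D (subst₂ Λ M h p) := by
  induction p using Finsupp.induction_linear with
  | zero => simp
  | add p q hp hq => simp only [map_add, hp, hq]
  | single n v =>
    rw [del_single₂, subst₂_single, subst₂_single, hD]
    exact congr($(((hΛ.pow_left n.1).mul_left (hM.pow_left n.2)).eq) (h v))

lemma commute_lam₂_del : Commute (lam₂ k V) (del k (ℕ × ℕ →₀ V)) := by
  refine LinearMap.ext fun w => ?_
  induction w using Finsupp.induction_linear with
  | zero => simp
  | add p q hp hq => simp only [map_add, hp, hq]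
  | single n v => simp only [Module.End.mul_apply, lam₂_single, del_single₂]

lemma commute_mu₂_del : Commute (mu₂ k V) (del k (ℕ × ℕ →₀ V)) := by
  refine LinearMap.ext fun w => ?_
  induction w using Finsupp.induction_linear with
  | zero => simp
  | add p q hp hq => simp only [map_add, hp, hq]
  | single n v => simp only [Module.End.mul_apply, mu₂_single, del_single₂]

lemma const₂_del (v : V) :
    const₂ k V (del k V v) = del k (ℕ × ℕ →₀ V) (const₂ k V v) :=
  (del_single₂ _ _).symm

lemma const_del (v : V) : const k V (del k V v) = del k (ℕ →₀ V) (const k V v) :=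
  (del_single _ _).symm

end DelCalculus

/-! ### The axioms evaluated at arbitrary commuting operators. -/

section UniversalIdentities

variable {k : Type*} [Field k]
  {P : Type*} [AddCommGroup P] [Module k P] [Module k[X] P] [IsScalarTower k k[X] P]
  {V : Type*} [AddCommGroup V] [Module k V] [Module k[X] V] [IsScalarTower k k[X] V]
  {W : Type*} [AddCommGroup W] [Module k W]
  {U : Type*} [AddCommGroup U] [Module k U]
  {br pr : P →ₗ[k] P →ₗ[k] (ℕ →₀ P)} {ρ l m : P →ₗ[k] V →ₗ[k] (ℕ →₀ V)}
  {Λ M D : Module.End k W}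

/-- This and the next two lemmas treat the nested shapes (x_λ y)_{λ+μ} z, y_μ(x_λ z) and x_λ(y_μ z),
from which most of the axioms are built. -/
lemma subst₂_lam_add (hc : Commute Λ M) (h : V →ₗ[k] W) (f : U →ₗ[k] (ℕ →₀ V)) (p : ℕ →₀ U) :
    subst₂ Λ M h (subst (lam₂ k V) (subst (lam₂ k V + mu₂ k V) (const₂ k V) ∘ₗ f) p) =
      subst Λ (subst (Λ + M) h ∘ₗ f) p := by
  rw [map_subst_comp (subst₂_lam₂ Λ M h) (B' := Λ + M) (fun w => by
    simp only [LinearMap.add_apply, map_add, subst₂_lam₂, subst₂_mu₂ hc]), subst₂_comp_const₂]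

lemma subst₂_lam_mu (hc : Commute Λ M) (h : V →ₗ[k] W) (f : U →ₗ[k] (ℕ →₀ V)) (p : ℕ →₀ U) :
    subst₂ Λ M h (subst (lam₂ k V) (subst (mu₂ k V) (const₂ k V) ∘ₗ f) p) =
      subst Λ (subst M h ∘ₗ f) p := by
  rw [map_subst_comp (subst₂_lam₂ Λ M h) (subst₂_mu₂ hc h), subst₂_comp_const₂]

lemma subst₂_mu_lam (hc : Commute Λ M) (h : V →ₗ[k] W) (f : U →ₗ[k] (ℕ →₀ V)) (p : ℕ →₀ U) :
    subst₂ Λ M h (subst (mu₂ k V) (subst (lam₂ k V) (const₂ k V) ∘ₗ f) p) =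
      subst M (subst Λ h ∘ₗ f) p := by
  rw [map_subst_comp (subst₂_mu₂ hc h) (subst₂_lam₂ Λ M h), subst₂_comp_const₂]

lemma IsSesquilinear.subst_left (hm : IsSesquilinear m) (h : V →ₗ[k] W) (a : P) (v : V) :
    subst Λ h (m (del k P a) v) = (-Λ) (subst Λ h (m a v)) := by
  rw [hm.del_left, map_neg, subst_lam, LinearMap.neg_apply]

lemma IsSesquilinear.subst_right (hm : IsSesquilinear m) (hc : Commute Λ D) {h : V →ₗ[k] W}
    (hD : ∀ v, h (del k V v) = D (h v)) (a : P) (v : V) :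
    subst Λ h (m a (del k V v)) = (D + Λ) (subst Λ h (m a v)) := by
  rw [hm.del_right, LinearMap.add_apply, map_add, subst_lam, subst_del hc hD,
    LinearMap.add_apply]

/-- `m(b)_K` applied to the value of `p(-λ-∂)` at `λ = Λ`. -/
lemma IsSesquilinear.subst_comp_skewSubst (hm : IsSesquilinear m) {K : Module.End k W}
    (hKD : Commute K D) (hΛK : Commute Λ K) (hΛD : Commute Λ D) {h : V →ₗ[k] W}
    (hD : ∀ v, h (del k V v) = D (h v)) (b : P) (p : ℕ →₀ V) :
    subst Λ (subst K h ∘ₗ m b) (skewSubst k V p) =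
      subst (-Λ - (D + K)) (subst K h ∘ₗ m b) p :=
  subst_skewSubst (hΛD.add_right hΛK) (fun v => hm.subst_right hKD hD b v) p

lemma IsLieConformal.skew_subst (hP : IsLieConformal br) (hc : Commute Λ D) {h : P →ₗ[k] W}
    (hD : ∀ v, h (del k P v) = D (h v)) (a b : P) :
    subst Λ h (br a b) = -subst (-Λ - D) h (br b a) := by
  rw [hP.skew, map_neg, subst_skewSubst hc hD]

lemma IsCommAssocConformal.comm_subst (hP : IsCommAssocConformal pr) (hc : Commute Λ D)
    {h : P →ₗ[k] W} (hD : ∀ v, h (del k P v) = D (h v)) (a b : P) :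
    subst Λ h (pr a b) = subst (-Λ - D) h (pr b a) := by
  rw [hP.comm, subst_skewSubst hc hD]

lemma IsLieRep.lie_subst (hV : IsLieRep br ρ) (hc : Commute Λ M) (h : V →ₗ[k] W)
    (a b : P) (v : V) :
    subst Λ (subst (Λ + M) h ∘ₗ ρ.flip v) (br a b) =
      subst M (subst Λ h ∘ₗ ρ a) (ρ b v) - subst Λ (subst M h ∘ₗ ρ b) (ρ a v) := by
  have := congrArg (subst₂ Λ M h) (hV.lie a b v)
  rwa [map_sub, subst₂_mu_lam hc, subst₂_lam_add hc, subst₂_lam_mu hc] at this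

lemma IsCommAssocRep.mul_subst (hV : IsCommAssocRep pr l) (hc : Commute Λ M) (h : V →ₗ[k] W)
    (a b : P) (v : V) :
    subst Λ (subst (Λ + M) h ∘ₗ l.flip v) (pr a b) = subst M (subst Λ h ∘ₗ l a) (l b v) := by
  have := congrArg (subst₂ Λ M h) (hV.mul a b v)
  rwa [subst₂_mu_lam hc, subst₂_lam_add hc] at this

/-- The operators of a representation of a commutative associative conformal algebra commute. -/
lemma IsCommAssocRep.swap_subst (hP : IsCommAssocConformal pr) (hV : IsCommAssocRep pr l)
    (hc : Commute Λ M) (h : V →ₗ[k] W) (a b : P) (v : V) :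
    subst Λ (subst M h ∘ₗ l b) (l a v) = subst M (subst Λ h ∘ₗ l a) (l b v) := by
  -- On p ↦ l(p)_{Λ+M} v the operator ∂ of P acts as -(Λ+M). Commutativity of the product of P
  -- therefore exchanges a substitution of M for one of -M + (Λ+M) = Λ.
  have hK : ∀ p, (subst (Λ + M) h ∘ₗ l.flip v) (del k P p) =
      (-(Λ + M)) ((subst (Λ + M) h ∘ₗ l.flip v) p) := fun p => hV.sesq.subst_left h p v
  have h1 : Commute M (-(Λ + M)) := (hc.symm.add_right (Commute.refl M)).neg_right
  rw [← hV.mul_subst hc.symm, ← hV.mul_subst hc, add_comm M Λ, hP.comm_subst h1 hK]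
  congr 2
  abel

lemma IsPoissonRep.rho_l_subst (hV : IsPoissonRep br pr ρ l) (hc : Commute Λ M) (h : V →ₗ[k] W)
    (a b : P) (v : V) :
    subst M (subst Λ h ∘ₗ ρ a) (l b v) =
      subst Λ (subst (Λ + M) h ∘ₗ l.flip v) (br a b) + subst Λ (subst M h ∘ₗ l b) (ρ a v) := by
  have := congrArg (subst₂ Λ M h) (hV.rho_l a b v)
  rwa [map_add, subst₂_mu_lam hc, subst₂_lam_add hc, subst₂_lam_mu hc] at this

/-- The compatibility of `ρ` and `l` with the product, evaluated at commuting operators. -/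
lemma IsPoissonRep.rho_mul_subst_del (hV : IsPoissonRep br pr ρ l) (hc : Commute Λ M)
    (hΛ : Commute Λ D) (hM : Commute M D) {h : V →ₗ[k] W} (hD : ∀ v, h (del k V v) = D (h v))
    (a b : P) (v : V) :
    subst M (subst (-Λ - D) h ∘ₗ ρ.flip v) (pr a b) =
      subst Λ (subst (-Λ - M - D) h ∘ₗ l b) (skewSubst k V (ρ a v)) +
        subst Λ (subst M h ∘ₗ l a) (skewSubst k V (ρ b v)) := by
  have := congrArg (subst₂ Λ M h) (hV.rho_mul a b v)
  rwa [map_add, subst₂_lam_mu hc,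
    map_subst_comp (subst₂_lam₂ Λ M h) (B' := -Λ - M - D) (fun w => by
      simp only [LinearMap.sub_apply, LinearMap.neg_apply, map_sub, map_neg, subst₂_lam₂,
        subst₂_mu₂ hc, subst₂_del hΛ hM hD]),
    map_subst_comp (subst₂_mu₂ hc h) (B' := -Λ - D) (fun w => by
      simp only [LinearMap.sub_apply, LinearMap.neg_apply, map_sub, map_neg, subst₂_lam₂,
        subst₂_del hΛ hM hD]), subst₂_comp_const₂] at this

/-- `ρ(a_λ b)_{λ+μ} v = l(b)_μ (ρ(a)_λ v) + l(a)_λ (ρ(b)_μ v)` -/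
lemma IsPoissonRep.rho_mul' (hV : IsPoissonRep br pr ρ l) (a b : P) (v : V) :
    subst (lam₂ k V) (subst (lam₂ k V + mu₂ k V) (const₂ k V) ∘ₗ ρ.flip v) (pr a b) =
      subst (lam₂ k V) (subst (mu₂ k V) (const₂ k V) ∘ₗ l b) (ρ a v) +
        subst (mu₂ k V) (subst (lam₂ k V) (const₂ k V) ∘ₗ l a) (ρ b v) := by
  have c1 : Commute (lam₂ k V) (mu₂ k V) := commute_lam₂_mu₂
  have c2 : Commute (lam₂ k V) (del k (ℕ × ℕ →₀ V)) := commute_lam₂_del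
  have c3 : Commute (mu₂ k V) (del k (ℕ × ℕ →₀ V)) := commute_mu₂_del
  have d1 : Commute (-lam₂ k V - mu₂ k V - del k (ℕ × ℕ →₀ V)) (lam₂ k V) :=
    (((Commute.refl _).neg_left.sub_left c1.symm).sub_left c2.symm)
  have d2 : Commute (-lam₂ k V - mu₂ k V - del k (ℕ × ℕ →₀ V)) (mu₂ k V) :=
    ((c1.neg_left.sub_left (Commute.refl _)).sub_left c3.symm)
  have d3 : Commute (-lam₂ k V - mu₂ k V - del k (ℕ × ℕ →₀ V)) (del k (ℕ × ℕ →₀ V)) :=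
    ((c2.neg_left.sub_left c3).sub_left (Commute.refl _))
  have e1 : -(-lam₂ k V - mu₂ k V - del k (ℕ × ℕ →₀ V)) - del k (ℕ × ℕ →₀ V) =
      lam₂ k V + mu₂ k V := by abel
  have e2 : -(-lam₂ k V - mu₂ k V - del k (ℕ × ℕ →₀ V)) - lam₂ k V - del k (ℕ × ℕ →₀ V) =
      mu₂ k V := by abel
  have e3 : -(-lam₂ k V - mu₂ k V - del k (ℕ × ℕ →₀ V)) - (del k (ℕ × ℕ →₀ V) + mu₂ k V) =
      lam₂ k V := by abel
  have e4 : -(-lam₂ k V - mu₂ k V - del k (ℕ × ℕ →₀ V)) - (del k (ℕ × ℕ →₀ V) + lam₂ k V) =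
      mu₂ k V := by abel
  -- The axiom is taken at (-λ-μ-∂, λ) in place of (λ, μ), so that -λ-∂ becomes λ+μ. In each inner
  -- `skewSubst` the ∂ has to pass an operator l(·)_K and picks up K by sesquilinearity, which
  -- leaves λ and μ.
  have := hV.rho_mul_subst_del d1 d3 c2 (h := const₂ k V) const₂_del a b v
  rwa [e1, e2, hV.commAssoc.sesq.subst_comp_skewSubst c3 d2 d3 const₂_del,
    hV.commAssoc.sesq.subst_comp_skewSubst c2 d1 d3 const₂_del, e3, e4] at this

lemma IsPoissonRep.rho_mul_subst (hV : IsPoissonRep br pr ρ l) (hc : Commute Λ M)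
    (h : V →ₗ[k] W) (a b : P) (v : V) :
    subst Λ (subst (Λ + M) h ∘ₗ ρ.flip v) (pr a b) =
      subst Λ (subst M h ∘ₗ l b) (ρ a v) + subst M (subst Λ h ∘ₗ l a) (ρ b v) := by
  have := congrArg (subst₂ Λ M h) (hV.rho_mul' a b v)
  rwa [map_add, subst₂_mu_lam hc, subst₂_lam_add hc, subst₂_lam_mu hc] at this

/-- Criterion for the compatibility of `ρ` and `l` with the product. -/
lemma rho_mul_of_subst (hl : IsSesquilinear l)
    (H : ∀ a b v,
      subst (lam₂ k V) (subst (lam₂ k V + mu₂ k V) (const₂ k V) ∘ₗ ρ.flip v) (pr a b) =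
        subst (lam₂ k V) (subst (mu₂ k V) (const₂ k V) ∘ₗ l b) (ρ a v) +
          subst (mu₂ k V) (subst (lam₂ k V) (const₂ k V) ∘ₗ l a) (ρ b v)) (a b : P) (v : V) :
    subst (mu₂ k V)
        (subst (-lam₂ k V - del k (ℕ × ℕ →₀ V)) (const₂ k V) ∘ₗ ρ.flip v) (pr a b) =
      subst (lam₂ k V)
        (subst (-lam₂ k V - mu₂ k V - del k (ℕ × ℕ →₀ V)) (const₂ k V) ∘ₗ l b)
        (skewSubst k V (ρ a v)) +
      subst (lam₂ k V) (subst (mu₂ k V) (const₂ k V) ∘ₗ l a) (skewSubst k V (ρ b v)) := by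
  have c1 : Commute (lam₂ k V) (mu₂ k V) := commute_lam₂_mu₂
  have c2 : Commute (lam₂ k V) (del k (ℕ × ℕ →₀ V)) := commute_lam₂_del
  have c3 : Commute (mu₂ k V) (del k (ℕ × ℕ →₀ V)) := commute_mu₂_del
  have d1 : Commute (-lam₂ k V - mu₂ k V - del k (ℕ × ℕ →₀ V)) (lam₂ k V) :=
    (((Commute.refl _).neg_left.sub_left c1.symm).sub_left c2.symm)
  have d2 : Commute (-lam₂ k V - mu₂ k V - del k (ℕ × ℕ →₀ V)) (mu₂ k V) :=
    ((c1.neg_left.sub_left (Commute.refl _)).sub_left c3.symm)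
  have d3 : Commute (-lam₂ k V - mu₂ k V - del k (ℕ × ℕ →₀ V)) (del k (ℕ × ℕ →₀ V)) :=
    ((c2.neg_left.sub_left c3).sub_left (Commute.refl _))
  have e1 : mu₂ k V + (-lam₂ k V - mu₂ k V - del k (ℕ × ℕ →₀ V)) =
      -lam₂ k V - del k (ℕ × ℕ →₀ V) := by abel
  have e3 : -lam₂ k V - (del k (ℕ × ℕ →₀ V) + (-lam₂ k V - mu₂ k V - del k (ℕ × ℕ →₀ V))) =
      mu₂ k V := by abel
  have e4 : -lam₂ k V - (del k (ℕ × ℕ →₀ V) + mu₂ k V) =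
      -lam₂ k V - mu₂ k V - del k (ℕ × ℕ →₀ V) := by abel
  -- The inverse of the change of variables in `IsPoissonRep.rho_mul'`: both permute λ, μ, -λ-μ-∂
  -- cyclically.
  have := congrArg (subst₂ (mu₂ k V) (-lam₂ k V - mu₂ k V - del k (ℕ × ℕ →₀ V)) (const₂ k V))
    (H a b v)
  rw [map_add, subst₂_mu_lam d2.symm, subst₂_lam_add d2.symm, subst₂_lam_mu d2.symm] at this
  rwa [hl.subst_comp_skewSubst d3 d1.symm c2 const₂_del,
    hl.subst_comp_skewSubst c3 c1 c2 const₂_del, e3, e4, ← e1]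

end UniversalIdentities

/-! ### The semidirect product along a representation. -/

section Semidirect

lemma finsupp_prod_ext {k ι P V : Type*} [Field k] [AddCommGroup P] [Module k P]
    [AddCommGroup V] [Module k V] {s t : ι →₀ P × V}
    (h₁ : Finsupp.mapRange.linearMap (LinearMap.fst k P V) s =
      Finsupp.mapRange.linearMap (LinearMap.fst k P V) t)
    (h₂ : Finsupp.mapRange.linearMap (LinearMap.snd k P V) s =
      Finsupp.mapRange.linearMap (LinearMap.snd k P V) t) : s = t := by
  ext1 i
  exact Prod.ext (DFunLike.congr_fun h₁ i) (DFunLike.congr_fun h₂ i)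

variable {k : Type*} [Field k]
  {P : Type*} [AddCommGroup P] [Module k P] [Module k[X] P] [IsScalarTower k k[X] P]
  {V : Type*} [AddCommGroup V] [Module k V] [Module k[X] V] [IsScalarTower k k[X] V]
  {W : Type*} [AddCommGroup W] [Module k W]
  {br pr : P →ₗ[k] P →ₗ[k] (ℕ →₀ P)} {ρ l m : P →ₗ[k] V →ₗ[k] (ℕ →₀ V)}
  {Λ M D : Module.End k W}

lemma del_prod (x : P × V) : del k (P × V) x = (del k P x.1, del k V x.2) := rfl

section mapRange

variable {A B : Type*} [AddCommGroup A] [Module k A] [AddCommGroup B] [Module k B] (g : A →ₗ[k] B)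

lemma mapRange_lam₂ (p : ℕ × ℕ →₀ A) :
    Finsupp.mapRange.linearMap g (lam₂ k A p) = lam₂ k B (Finsupp.mapRange.linearMap g p) := by
  induction p using Finsupp.induction_linear with
  | zero => simp
  | add p q hp hq => simp only [map_add, hp, hq]
  | single n v => simp [lam₂_single]

lemma mapRange_mu₂ (p : ℕ × ℕ →₀ A) :
    Finsupp.mapRange.linearMap g (mu₂ k A p) = mu₂ k B (Finsupp.mapRange.linearMap g p) := by
  induction p using Finsupp.induction_linear with
  | zero => simp
  | add p q hp hq => simp only [map_add, hp, hq]
  | single n v => simp [mu₂_single]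

lemma mapRange_const₂ :
    Finsupp.mapRange.linearMap g ∘ₗ const₂ k A = const₂ k B ∘ₗ g := by
  ext1 v; simp [const₂]

lemma mapCoeff_lam (p : ℕ →₀ A) : mapCoeff g (lam k A p) = lam k B (mapCoeff g p) := by
  induction p using Finsupp.induction_linear with
  | zero => simp
  | add p q hp hq => simp only [map_add, hp, hq]
  | single n v => simp [mapCoeff, lam_single]

lemma mapRange_lam_add {U : Type*} [AddCommGroup U] [Module k U] (f : U →ₗ[k] (ℕ →₀ A))
    (p : ℕ →₀ U) :
    Finsupp.mapRange.linearMap g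
        (subst (lam₂ k A) (subst (lam₂ k A + mu₂ k A) (const₂ k A) ∘ₗ f) p) =
      subst (lam₂ k B) (subst (lam₂ k B + mu₂ k B) (const₂ k B ∘ₗ g) ∘ₗ f) p := by
  rw [map_subst_comp (mapRange_lam₂ g) (B' := lam₂ k B + mu₂ k B) (fun w => by
    simp only [LinearMap.add_apply, map_add, mapRange_lam₂, mapRange_mu₂]), mapRange_const₂]

lemma mapRange_lam_mu {U : Type*} [AddCommGroup U] [Module k U] (f : U →ₗ[k] (ℕ →₀ A))
    (p : ℕ →₀ U) :
    Finsupp.mapRange.linearMap g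
        (subst (lam₂ k A) (subst (mu₂ k A) (const₂ k A) ∘ₗ f) p) =
      subst (lam₂ k B) (subst (mu₂ k B) (const₂ k B ∘ₗ g) ∘ₗ f) p := by
  rw [map_subst_comp (mapRange_lam₂ g) (mapRange_mu₂ g), mapRange_const₂]

lemma mapRange_mu_lam {U : Type*} [AddCommGroup U] [Module k U] (f : U →ₗ[k] (ℕ →₀ A))
    (p : ℕ →₀ U) :
    Finsupp.mapRange.linearMap g
        (subst (mu₂ k A) (subst (lam₂ k A) (const₂ k A) ∘ₗ f) p) =
      subst (mu₂ k B) (subst (lam₂ k B) (const₂ k B ∘ₗ g) ∘ₗ f) p := by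
  rw [map_subst_comp (mapRange_mu₂ g) (mapRange_lam₂ g), mapRange_const₂]

end mapRange

lemma mapCoeff_fst_semidirectBracket (x y : P × V) :
    mapCoeff (LinearMap.fst k P V) (semidirectBracket br ρ x y) = br x.1 y.1 := by
  ext1 n
  change (br x.1 y.1) n + 0 = _
  simp

lemma mapCoeff_snd_semidirectBracket (x y : P × V) :
    mapCoeff (LinearMap.snd k P V) (semidirectBracket br ρ x y) =
      ρ x.1 y.2 - skewSubst k V (ρ y.1 x.2) := by
  ext1 n
  change 0 + (ρ x.1 y.2 - skewSubst k V (ρ y.1 x.2)) n = _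
  simp

lemma mapCoeff_fst_semidirectProduct (x y : P × V) :
    mapCoeff (LinearMap.fst k P V) (semidirectProduct pr l x y) = pr x.1 y.1 := by
  ext1 n
  change (pr x.1 y.1) n + 0 = _
  simp

lemma mapCoeff_snd_semidirectProduct (x y : P × V) :
    mapCoeff (LinearMap.snd k P V) (semidirectProduct pr l x y) =
      l x.1 y.2 + skewSubst k V (l y.1 x.2) := by
  ext1 n
  change 0 + (l x.1 y.2 + skewSubst k V (l y.1 x.2)) n = _
  simp

lemma subst_fst_semidirectBracket (h : P →ₗ[k] W) (x y : P × V) :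
    subst Λ (h ∘ₗ LinearMap.fst k P V) (semidirectBracket br ρ x y) =
      subst Λ h (br x.1 y.1) := by
  rw [← subst_mapCoeff, mapCoeff_fst_semidirectBracket]

lemma subst_snd_semidirectBracket (h : V →ₗ[k] W) (x y : P × V) :
    subst Λ (h ∘ₗ LinearMap.snd k P V) (semidirectBracket br ρ x y) =
      subst Λ h (ρ x.1 y.2) - subst Λ h (skewSubst k V (ρ y.1 x.2)) := by
  rw [← subst_mapCoeff, mapCoeff_snd_semidirectBracket, map_sub]

lemma subst_fst_semidirectProduct (h : P →ₗ[k] W) (x y : P × V) :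
    subst Λ (h ∘ₗ LinearMap.fst k P V) (semidirectProduct pr l x y) =
      subst Λ h (pr x.1 y.1) := by
  rw [← subst_mapCoeff, mapCoeff_fst_semidirectProduct]

lemma subst_snd_semidirectProduct (h : V →ₗ[k] W) (x y : P × V) :
    subst Λ (h ∘ₗ LinearMap.snd k P V) (semidirectProduct pr l x y) =
      subst Λ h (l x.1 y.2) + subst Λ h (skewSubst k V (l y.1 x.2)) := by
  rw [← subst_mapCoeff, mapCoeff_snd_semidirectProduct, map_add]

section fst

variable (h : P →ₗ[k] W) (x : P × V)

lemma subst_fst_comp_semidirectBracket :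
    subst Λ (h ∘ₗ LinearMap.fst k P V) ∘ₗ semidirectBracket br ρ x =
      (subst Λ h ∘ₗ br x.1) ∘ₗ LinearMap.fst k P V :=
  LinearMap.ext fun y => by
    simp only [LinearMap.comp_apply, LinearMap.flip_apply, subst_fst_semidirectBracket,
      LinearMap.fst_apply]

lemma subst_fst_comp_semidirectBracket_flip :
    subst Λ (h ∘ₗ LinearMap.fst k P V) ∘ₗ (semidirectBracket br ρ).flip x =
      (subst Λ h ∘ₗ br.flip x.1) ∘ₗ LinearMap.fst k P V :=
  LinearMap.ext fun y => by
    simp only [LinearMap.comp_apply, LinearMap.flip_apply, subst_fst_semidirectBracket,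
      LinearMap.fst_apply]

lemma subst_fst_comp_semidirectProduct :
    subst Λ (h ∘ₗ LinearMap.fst k P V) ∘ₗ semidirectProduct pr l x =
      (subst Λ h ∘ₗ pr x.1) ∘ₗ LinearMap.fst k P V :=
  LinearMap.ext fun y => by
    simp only [LinearMap.comp_apply, LinearMap.flip_apply, subst_fst_semidirectProduct,
      LinearMap.fst_apply]

lemma subst_fst_comp_semidirectProduct_flip :
    subst Λ (h ∘ₗ LinearMap.fst k P V) ∘ₗ (semidirectProduct pr l).flip x =
      (subst Λ h ∘ₗ pr.flip x.1) ∘ₗ LinearMap.fst k P V :=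
  LinearMap.ext fun y => by
    simp only [LinearMap.comp_apply, LinearMap.flip_apply, subst_fst_semidirectProduct,
      LinearMap.fst_apply]

end fst

section snd

variable {h : V →ₗ[k] W} (hc : Commute Λ D) (hD : ∀ v, h (del k V v) = D (h v)) (x : P × V)

include hc hD

/-- The term in which the argument on the right acts on the one on the left carries -λ-∂, which h
turns into -Λ-D. In this way -λ-∂ and -λ-μ-∂ enter the V-components of the axioms. -/
lemma subst_snd_comp_semidirectBracket :
    subst Λ (h ∘ₗ LinearMap.snd k P V) ∘ₗ semidirectBracket br ρ x =
      (subst Λ h ∘ₗ ρ x.1) ∘ₗ LinearMap.snd k P V -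
        (subst (-Λ - D) h ∘ₗ ρ.flip x.2) ∘ₗ LinearMap.fst k P V :=
  LinearMap.ext fun y => by
    simp only [LinearMap.comp_apply, LinearMap.flip_apply, LinearMap.sub_apply,
      LinearMap.add_apply, subst_snd_semidirectBracket, subst_skewSubst hc hD,
      LinearMap.fst_apply, LinearMap.snd_apply]

lemma subst_snd_comp_semidirectBracket_flip :
    subst Λ (h ∘ₗ LinearMap.snd k P V) ∘ₗ (semidirectBracket br ρ).flip x =
      (subst Λ h ∘ₗ ρ.flip x.2) ∘ₗ LinearMap.fst k P V -
        (subst (-Λ - D) h ∘ₗ ρ x.1) ∘ₗ LinearMap.snd k P V :=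
  LinearMap.ext fun y => by
    simp only [LinearMap.comp_apply, LinearMap.flip_apply, LinearMap.sub_apply,
      LinearMap.add_apply, subst_snd_semidirectBracket, subst_skewSubst hc hD,
      LinearMap.fst_apply, LinearMap.snd_apply]

lemma subst_snd_comp_semidirectProduct :
    subst Λ (h ∘ₗ LinearMap.snd k P V) ∘ₗ semidirectProduct pr l x =
      (subst Λ h ∘ₗ l x.1) ∘ₗ LinearMap.snd k P V +
        (subst (-Λ - D) h ∘ₗ l.flip x.2) ∘ₗ LinearMap.fst k P V :=
  LinearMap.ext fun y => by
    simp only [LinearMap.comp_apply, LinearMap.flip_apply, LinearMap.sub_apply,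
      LinearMap.add_apply, subst_snd_semidirectProduct, subst_skewSubst hc hD,
      LinearMap.fst_apply, LinearMap.snd_apply]

lemma subst_snd_comp_semidirectProduct_flip :
    subst Λ (h ∘ₗ LinearMap.snd k P V) ∘ₗ (semidirectProduct pr l).flip x =
      (subst Λ h ∘ₗ l.flip x.2) ∘ₗ LinearMap.fst k P V +
        (subst (-Λ - D) h ∘ₗ l x.1) ∘ₗ LinearMap.snd k P V :=
  LinearMap.ext fun y => by
    simp only [LinearMap.comp_apply, LinearMap.flip_apply, LinearMap.sub_apply,
      LinearMap.add_apply, subst_snd_semidirectProduct, subst_skewSubst hc hD,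
      LinearMap.fst_apply, LinearMap.snd_apply]

end snd

/-- The substitution exchanges -λ and ∂+λ, the factors by which ∂ leaves the left and the right
argument. So the reversed action x, y ↦ m(y)_{-λ-∂} x is sesquilinear in the required sense. -/
lemma skewSubst_lam (p : ℕ →₀ V) :
    skewSubst k V (lam k V p) = -(lam k V (skewSubst k V p) + del k _ (skewSubst k V p)) := by
  rw [skewSubst, subst_lam]
  simp only [LinearMap.sub_apply, LinearMap.neg_apply]
  abel

lemma skewSubst_del (p : ℕ →₀ V) :
    skewSubst k V (del k _ p) = del k _ (skewSubst k V p) :=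
  subst_del ((Commute.neg_left (commute_lam_del (k := k) (V := V))).sub_left (Commute.refl _)) const_del p

lemma skewSubst_skewSubst (p : ℕ →₀ V) : skewSubst k V (skewSubst k V p) = p := by
  refine (subst_skewSubst ((Commute.neg_left (commute_lam_del (k := k) (V := V))).sub_left (Commute.refl _))
    const_del p).trans ?_
  rw [show -(-lam k V - del k (ℕ →₀ V)) - del k (ℕ →₀ V) = lam k V by abel, subst_lam_const]

lemma mapCoeff_del {A B : Type*} [AddCommGroup A] [Module k A] [Module k[X] A]
    [IsScalarTower k k[X] A] [AddCommGroup B] [Module k B] [Module k[X] B]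
    [IsScalarTower k k[X] B] {g : A →ₗ[k] B} (hg : ∀ a, g (del k A a) = del k B (g a))
    (p : ℕ →₀ A) : mapCoeff g (del k _ p) = del k _ (mapCoeff g p) := by
  ext1 n
  exact hg (p n)

lemma mapCoeff_skewSubst {A B : Type*} [AddCommGroup A] [Module k A] [Module k[X] A]
    [IsScalarTower k k[X] A] [AddCommGroup B] [Module k B] [Module k[X] B]
    [IsScalarTower k k[X] B] {g : A →ₗ[k] B} (hg : ∀ a, g (del k A a) = del k B (g a))
    (p : ℕ →₀ A) : mapCoeff g (skewSubst k A p) = skewSubst k B (mapCoeff g p) := by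
  rw [skewSubst, skewSubst, subst_mapCoeff, map_subst (Λ' := -lam k B - del k (ℕ →₀ B))]
  · refine subst_congr (fun v => ?_) p
    simp [const_apply, mapCoeff]
  · intro w
    simp only [LinearMap.sub_apply, LinearMap.neg_apply, map_sub, map_neg, mapCoeff_lam,
      mapCoeff_del hg]

lemma semidirectBracket_sesq (hbr : IsSesquilinear br) (hρ : IsSesquilinear ρ) :
    IsSesquilinear (semidirectBracket br ρ) where
  del_left x y := by
    apply finsupp_prod_ext (k := k)
    · change mapCoeff _ _ = mapCoeff _ _
      rw [map_neg, mapCoeff_lam, mapCoeff_fst_semidirectBracket, mapCoeff_fst_semidirectBracket]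
      exact hbr.del_left _ _
    · change mapCoeff _ _ = mapCoeff _ _
      rw [map_neg, mapCoeff_lam, mapCoeff_snd_semidirectBracket, mapCoeff_snd_semidirectBracket]
      simp only [del_prod, hρ.del_left, hρ.del_right, map_sub, map_add, LinearMap.add_apply,
        skewSubst_lam, skewSubst_del]
      abel
  del_right x y := by
    apply finsupp_prod_ext (k := k)
    · change mapCoeff _ _ = mapCoeff _ _
      rw [LinearMap.add_apply, map_add, mapCoeff_lam,
        mapCoeff_del (g := LinearMap.fst k P V) (fun _ => rfl),
        mapCoeff_fst_semidirectBracket, mapCoeff_fst_semidirectBracket]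
      exact hbr.del_right _ _
    · change mapCoeff _ _ = mapCoeff _ _
      rw [LinearMap.add_apply, map_add, mapCoeff_lam,
        mapCoeff_del (g := LinearMap.snd k P V) (fun _ => rfl),
        mapCoeff_snd_semidirectBracket, mapCoeff_snd_semidirectBracket]
      simp only [del_prod, hρ.del_left, hρ.del_right, map_sub, map_add, map_neg,
        LinearMap.add_apply, skewSubst_lam, skewSubst_del]
      abel

lemma semidirectProduct_sesq (hpr : IsSesquilinear pr) (hl : IsSesquilinear l) :
    IsSesquilinear (semidirectProduct pr l) where
  del_left x y := by
    apply finsupp_prod_ext (k := k)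
    · change mapCoeff _ _ = mapCoeff _ _
      rw [map_neg, mapCoeff_lam, mapCoeff_fst_semidirectProduct, mapCoeff_fst_semidirectProduct]
      exact hpr.del_left _ _
    · change mapCoeff _ _ = mapCoeff _ _
      rw [map_neg, mapCoeff_lam, mapCoeff_snd_semidirectProduct, mapCoeff_snd_semidirectProduct]
      simp only [del_prod, hl.del_left, hl.del_right, map_add, LinearMap.add_apply,
        skewSubst_lam, skewSubst_del]
      abel
  del_right x y := by
    apply finsupp_prod_ext (k := k)
    · change mapCoeff _ _ = mapCoeff _ _
      rw [LinearMap.add_apply, map_add, mapCoeff_lam,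
        mapCoeff_del (g := LinearMap.fst k P V) (fun _ => rfl),
        mapCoeff_fst_semidirectProduct, mapCoeff_fst_semidirectProduct]
      exact hpr.del_right _ _
    · change mapCoeff _ _ = mapCoeff _ _
      rw [LinearMap.add_apply, map_add, mapCoeff_lam,
        mapCoeff_del (g := LinearMap.snd k P V) (fun _ => rfl),
        mapCoeff_snd_semidirectProduct, mapCoeff_snd_semidirectProduct]
      simp only [del_prod, hl.del_left, hl.del_right, map_add, map_neg,
        LinearMap.add_apply, skewSubst_lam, skewSubst_del]
      abel

lemma semidirectBracket_skew (hP : IsLieConformal br) (x y : P × V) :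
    semidirectBracket br ρ x y = -skewSubst k (P × V) (semidirectBracket br ρ y x) := by
  apply finsupp_prod_ext (k := k)
  · change mapCoeff _ _ = mapCoeff _ _
    rw [map_neg, mapCoeff_skewSubst (g := LinearMap.fst k P V) (fun _ => rfl),
      mapCoeff_fst_semidirectBracket, mapCoeff_fst_semidirectBracket]
    exact hP.skew _ _
  · change mapCoeff _ _ = mapCoeff _ _
    rw [map_neg, mapCoeff_skewSubst (g := LinearMap.snd k P V) (fun _ => rfl),
      mapCoeff_snd_semidirectBracket, mapCoeff_snd_semidirectBracket, map_sub,
      skewSubst_skewSubst]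
    abel

lemma semidirectProduct_comm (hP : IsCommAssocConformal pr) (x y : P × V) :
    semidirectProduct pr l x y = skewSubst k (P × V) (semidirectProduct pr l y x) := by
  apply finsupp_prod_ext (k := k)
  · change mapCoeff _ _ = mapCoeff _ _
    rw [mapCoeff_skewSubst (g := LinearMap.fst k P V) (fun _ => rfl),
      mapCoeff_fst_semidirectProduct, mapCoeff_fst_semidirectProduct]
    exact hP.comm _ _
  · change mapCoeff _ _ = mapCoeff _ _
    rw [mapCoeff_skewSubst (g := LinearMap.snd k P V) (fun _ => rfl),
      mapCoeff_snd_semidirectProduct, mapCoeff_snd_semidirectProduct, map_add,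
      skewSubst_skewSubst]
    abel

/-- Needed to use ν = -λ-μ-∂ as a variable on the same footing as λ and μ. -/
lemma commute_neg_lam₂_sub_del :
    Commute (lam₂ k V) (-lam₂ k V - mu₂ k V - del k (ℕ × ℕ →₀ V)) ∧
    Commute (mu₂ k V) (-lam₂ k V - mu₂ k V - del k (ℕ × ℕ →₀ V)) ∧
    Commute (-lam₂ k V - mu₂ k V - del k (ℕ × ℕ →₀ V)) (del k (ℕ × ℕ →₀ V)) :=
  ⟨((Commute.refl _).neg_right.sub_right commute_lam₂_mu₂).sub_right commute_lam₂_del,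
    ((Commute.neg_right (commute_lam₂_mu₂ (k := k) (V := V)).symm).sub_right (Commute.refl _)).sub_right commute_mu₂_del,
    ((Commute.neg_left (commute_lam₂_del (k := k) (V := V))).sub_left commute_mu₂_del).sub_left (Commute.refl _)⟩

lemma semidirectBracket_jacobi (hP : IsLieConformal br) (hV : IsLieRep br ρ) (x y z : P × V) :
    subst (mu₂ k (P × V)) (subst (lam₂ k (P × V)) (const₂ k (P × V)) ∘ₗ
        semidirectBracket br ρ x) (semidirectBracket br ρ y z) =
      subst (lam₂ k (P × V)) (subst (lam₂ k (P × V) + mu₂ k (P × V)) (const₂ k (P × V)) ∘ₗ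
        (semidirectBracket br ρ).flip z) (semidirectBracket br ρ x y) +
      subst (lam₂ k (P × V)) (subst (mu₂ k (P × V)) (const₂ k (P × V)) ∘ₗ
        semidirectBracket br ρ y) (semidirectBracket br ρ x z) := by
  apply finsupp_prod_ext (k := k)
  · simp only [map_add, mapRange_lam_add, mapRange_lam_mu, mapRange_mu_lam,
      subst_fst_comp_semidirectBracket, subst_fst_comp_semidirectBracket_flip,
      subst_fst_semidirectBracket]
    exact hP.jacobi _ _ _
  · have c1 : Commute (lam₂ k V) (mu₂ k V) := commute_lam₂_mu₂
    have c2 : Commute (lam₂ k V) (del k (ℕ × ℕ →₀ V)) := commute_lam₂_del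
    have c3 : Commute (mu₂ k V) (del k (ℕ × ℕ →₀ V)) := commute_mu₂_del
    have c4 := c2.add_left c3
    obtain ⟨d1, d2, d3⟩ := commute_neg_lam₂_sub_del (k := k) (V := V)
    simp only [map_add, mapRange_lam_add, mapRange_lam_mu, mapRange_mu_lam,
      subst_snd_comp_semidirectBracket c2 const₂_del,
      subst_snd_comp_semidirectBracket c3 const₂_del,
      subst_snd_comp_semidirectBracket_flip c4 const₂_del, subst_sub_right,
      subst_fst_semidirectBracket, subst_snd_semidirectBracket]
    -- With ν = -λ-μ-∂, the terms containing the V-part of z, y or x are governed by the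
    -- representation identity at (λ, μ), (λ, ν) or (μ, ν) respectively.
    have hz := hV.lie_subst c1 (const₂ k V) x.1 y.1 z.2
    have hy := hV.lie_subst d1 (const₂ k V) x.1 z.1 y.2
    have hx := hV.lie_subst d2 (const₂ k V) y.1 z.1 x.2
    have e1 : -(lam₂ k V + mu₂ k V) - del k (ℕ × ℕ →₀ V) =
      -lam₂ k V - mu₂ k V - del k (ℕ × ℕ →₀ V) := by abel
    have e2 : lam₂ k V + (-lam₂ k V - mu₂ k V - del k (ℕ × ℕ →₀ V)) =
      -mu₂ k V - del k (ℕ × ℕ →₀ V) := by abel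
    have e3 : mu₂ k V + (-lam₂ k V - mu₂ k V - del k (ℕ × ℕ →₀ V)) =
      -lam₂ k V - del k (ℕ × ℕ →₀ V) := by abel
    have e4 : -mu₂ k V - (del k (ℕ × ℕ →₀ V) + lam₂ k V) =
      -lam₂ k V - mu₂ k V - del k (ℕ × ℕ →₀ V) := by abel
    have e5 : -lam₂ k V - (del k (ℕ × ℕ →₀ V) + mu₂ k V) =
      -lam₂ k V - mu₂ k V - del k (ℕ × ℕ →₀ V) := by abel
    have e6 : -lam₂ k V - (del k (ℕ × ℕ →₀ V) +
      (-lam₂ k V - mu₂ k V - del k (ℕ × ℕ →₀ V))) = mu₂ k V := by abel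
    rw [e2] at hy
    rw [e3] at hx
    rw [e1, hV.sesq.subst_comp_skewSubst c2 c1.symm c3 const₂_del,
      hV.sesq.subst_comp_skewSubst d3 d1 c2 const₂_del,
      hV.sesq.subst_comp_skewSubst c3 c1 c2 const₂_del, e4, e5, e6, hx, hy, hz]
    abel

lemma semidirectProduct_assoc (hP : IsCommAssocConformal pr) (hV : IsCommAssocRep pr l)
    (x y z : P × V) :
    subst (lam₂ k (P × V)) (subst (lam₂ k (P × V) + mu₂ k (P × V)) (const₂ k (P × V)) ∘ₗ
        (semidirectProduct pr l).flip z) (semidirectProduct pr l x y) =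
      subst (mu₂ k (P × V)) (subst (lam₂ k (P × V)) (const₂ k (P × V)) ∘ₗ
        semidirectProduct pr l x) (semidirectProduct pr l y z) := by
  apply finsupp_prod_ext (k := k)
  · simp only [map_add, mapRange_lam_add, mapRange_lam_mu, mapRange_mu_lam,
      subst_fst_comp_semidirectProduct, subst_fst_comp_semidirectProduct_flip,
      subst_fst_semidirectProduct]
    exact hP.assoc _ _ _
  · have c1 : Commute (lam₂ k V) (mu₂ k V) := commute_lam₂_mu₂
    have c2 : Commute (lam₂ k V) (del k (ℕ × ℕ →₀ V)) := commute_lam₂_del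
    have c3 : Commute (mu₂ k V) (del k (ℕ × ℕ →₀ V)) := commute_mu₂_del
    have c4 := c2.add_left c3
    obtain ⟨d1, d2, d3⟩ := commute_neg_lam₂_sub_del (k := k) (V := V)
    simp only [map_add, mapRange_lam_add, mapRange_lam_mu, mapRange_mu_lam,
      subst_snd_comp_semidirectProduct c2 const₂_del,
      subst_snd_comp_semidirectProduct_flip c4 const₂_del, subst_add_right,
      subst_fst_semidirectProduct, subst_snd_semidirectProduct]
    -- The same three pairs of variables as for the Jacobi identity. When the V-part comes from x or
    -- y the operators on the two sides appear in opposite orders, hence the appeal to their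
    -- commutation.
    have hz := hV.mul_subst c1 (const₂ k V) x.1 y.1 z.2
    have hy := hV.swap_subst hP d1 (const₂ k V) x.1 z.1 y.2
    have hx := hV.mul_subst d2 (const₂ k V) y.1 z.1 x.2
    have hx' := hV.swap_subst hP d2 (const₂ k V) y.1 z.1 x.2
    have e1 : -(lam₂ k V + mu₂ k V) - del k (ℕ × ℕ →₀ V) =
      -lam₂ k V - mu₂ k V - del k (ℕ × ℕ →₀ V) := by abel
    have e3 : mu₂ k V + (-lam₂ k V - mu₂ k V - del k (ℕ × ℕ →₀ V)) =
      -lam₂ k V - del k (ℕ × ℕ →₀ V) := by abel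
    have e4 : -mu₂ k V - (del k (ℕ × ℕ →₀ V) + lam₂ k V) =
      -lam₂ k V - mu₂ k V - del k (ℕ × ℕ →₀ V) := by abel
    have e6 : -lam₂ k V - (del k (ℕ × ℕ →₀ V) +
      (-lam₂ k V - mu₂ k V - del k (ℕ × ℕ →₀ V))) = mu₂ k V := by abel
    rw [e3] at hx
    rw [e1, hV.sesq.subst_comp_skewSubst c2 c1.symm c3 const₂_del,
      hV.sesq.subst_comp_skewSubst d3 d1 c2 const₂_del, e4, e6, hx, hx', hy, hz]
    abel

lemma semidirect_leibniz (hP : IsPoissonConformal br pr) (hV : IsPoissonRep br pr ρ l)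
    (x y z : P × V) :
    subst (mu₂ k (P × V)) (subst (lam₂ k (P × V)) (const₂ k (P × V)) ∘ₗ
        semidirectBracket br ρ x) (semidirectProduct pr l y z) =
      subst (lam₂ k (P × V)) (subst (lam₂ k (P × V) + mu₂ k (P × V)) (const₂ k (P × V)) ∘ₗ
        (semidirectProduct pr l).flip z) (semidirectBracket br ρ x y) +
      subst (lam₂ k (P × V)) (subst (mu₂ k (P × V)) (const₂ k (P × V)) ∘ₗ
        semidirectProduct pr l y) (semidirectBracket br ρ x z) := by
  apply finsupp_prod_ext (k := k)
  · simp only [map_add, mapRange_lam_add, mapRange_lam_mu, mapRange_mu_lam,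
      subst_fst_comp_semidirectBracket, subst_fst_comp_semidirectProduct,
      subst_fst_comp_semidirectProduct_flip, subst_fst_semidirectProduct,
      subst_fst_semidirectBracket]
    exact hP.leibniz _ _ _
  · have c1 : Commute (lam₂ k V) (mu₂ k V) := commute_lam₂_mu₂
    have c2 : Commute (lam₂ k V) (del k (ℕ × ℕ →₀ V)) := commute_lam₂_del
    have c3 : Commute (mu₂ k V) (del k (ℕ × ℕ →₀ V)) := commute_mu₂_del
    have c4 := c2.add_left c3
    obtain ⟨d1, d2, d3⟩ := commute_neg_lam₂_sub_del (k := k) (V := V)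
    simp only [map_add, mapRange_lam_add, mapRange_lam_mu, mapRange_mu_lam,
      subst_snd_comp_semidirectBracket c2 const₂_del,
      subst_snd_comp_semidirectProduct c3 const₂_del,
      subst_snd_comp_semidirectProduct_flip c4 const₂_del, subst_add_right, subst_sub_right,
      subst_fst_semidirectProduct, subst_snd_semidirectProduct,
      subst_fst_semidirectBracket, subst_snd_semidirectBracket]
    have hz := hV.rho_l_subst c1 (const₂ k V) x.1 y.1 z.2
    have hy := hV.rho_l_subst d1 (const₂ k V) x.1 z.1 y.2
    -- When the V-part comes from x, the product y_μ z acts on it through -λ-∂, and the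
    -- compatibility of ρ with the product is needed exactly in its original form.
    have hx := hV.rho_mul y.1 z.1 x.2
    have e1 : -(lam₂ k V + mu₂ k V) - del k (ℕ × ℕ →₀ V) =
      -lam₂ k V - mu₂ k V - del k (ℕ × ℕ →₀ V) := by abel
    have e2 : lam₂ k V + (-lam₂ k V - mu₂ k V - del k (ℕ × ℕ →₀ V)) =
      -mu₂ k V - del k (ℕ × ℕ →₀ V) := by abel
    have e4 : -mu₂ k V - (del k (ℕ × ℕ →₀ V) + lam₂ k V) =
      -lam₂ k V - mu₂ k V - del k (ℕ × ℕ →₀ V) := by abel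
    rw [e2] at hy
    rw [e1, hV.lie.sesq.subst_comp_skewSubst c2 c1.symm c3 const₂_del, e4, hx, hy, hz]
    abel

/-- The semidirect product along a representation is a Poisson conformal algebra. -/
theorem IsPoissonRep.semidirect (hP : IsPoissonConformal br pr) (hV : IsPoissonRep br pr ρ l) :
    IsPoissonConformal (semidirectBracket br ρ) (semidirectProduct pr l) where
  lie :=
    { sesq := semidirectBracket_sesq hP.lie.sesq hV.lie.sesq
      skew := semidirectBracket_skew hP.lie
      jacobi := semidirectBracket_jacobi hP.lie hV.lie }
  commAssoc :=
    { sesq := semidirectProduct_sesq hP.commAssoc.sesq hV.commAssoc.sesq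
      assoc := semidirectProduct_assoc hP.commAssoc hV.commAssoc
      comm := semidirectProduct_comm hP.commAssoc }
  leibniz := semidirect_leibniz hP hV

end Semidirect

/-! ### The dual of a representation. -/

section DualRep

variable {k : Type*} [Field k]
  {P : Type*} [AddCommGroup P] [Module k P] [Module k[X] P] [IsScalarTower k k[X] P]
  {V : Type*} [AddCommGroup V] [Module k V] [Module k[X] V] [IsScalarTower k k[X] V]
  {W : Type*} [AddCommGroup W] [Module k W]
  {br pr : P →ₗ[k] P →ₗ[k] (ℕ →₀ P)} {ρ l m n : P →ₗ[k] V →ₗ[k] (ℕ →₀ V)}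
  {Λ M N : Module.End k W} {w : W}

/-- The pairing `(f, u) ↦ f_N(u) w`, for an operator `N` on `W` and `w : W`. -/
def confPairing (N : Module.End k W) (w : W) : ConfDual k V →ₗ[k] V →ₗ[k] W :=
  ConfDual.toLin.compr₂ (LinearMap.applyₗ w ∘ₗ (Polynomial.aeval (R := k) N).toLinearMap)

lemma confPairing_apply (f : ConfDual k V) (u : V) :
    confPairing N w f u = Polynomial.aeval N (f.toLin u) w := rfl

lemma confPairing_del_left (f : ConfDual k V) (u : V) :
    confPairing N w (del k _ f) u = -N (confPairing N w f u) := by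
  simp only [confPairing_apply, ConfDual.toLin_del_apply, map_neg, map_mul, Polynomial.aeval_X,
    Module.End.mul_apply, LinearMap.neg_apply]

/-- Evaluation of a polynomial in two variables at a pair of operators. -/
def evalOps (Λ N : Module.End k W) (w : W) : k[X][X] →ₗ[k] W :=
  Polynomial.lsum fun n => (Λ ^ n) ∘ₗ LinearMap.applyₗ w ∘ₗ (Polynomial.aeval (R := k) N).toLinearMap

lemma evalOps_monomial (i : ℕ) (c : k[X]) :
    evalOps Λ N w (Polynomial.monomial i c) = (Λ ^ i) (Polynomial.aeval N c w) := by
  simp [evalOps, Polynomial.sum_monomial_index]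

lemma evalOps_X_mul (q : k[X][X]) :
    evalOps Λ N w (Polynomial.X * q) = Λ (evalOps Λ N w q) := by
  induction q using Polynomial.induction_on' with
  | add p q hp hq => simp only [mul_add, map_add, hp, hq]
  | monomial i c =>
    rw [Polynomial.X_mul_monomial, evalOps_monomial, evalOps_monomial, pow_succ',
      Module.End.mul_apply]

lemma evalOps_C_X_mul (hc : Commute Λ N) (q : k[X][X]) :
    evalOps Λ N w (Polynomial.C Polynomial.X * q) = N (evalOps Λ N w q) := by
  induction q using Polynomial.induction_on' with
  | add p q hp hq => simp only [mul_add, map_add, hp, hq]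
  | monomial i c =>
    rw [Polynomial.C_mul_monomial, evalOps_monomial, evalOps_monomial, map_mul,
      Polynomial.aeval_X, Module.End.mul_apply]
    exact congr($((hc.pow_left i).eq) (Polynomial.aeval N c w))

/-- Evaluation intertwines multiplication by μ-λ with N-Λ, so the argument μ-λ in the definition of
the dual action becomes N-Λ. -/
lemma evalOps_aeval (hc : Commute Λ N) (q : k[X]) :
    evalOps Λ N w (Polynomial.aeval (R := k) (Polynomial.C Polynomial.X - Polynomial.X : k[X][X]) q) =
      Polynomial.aeval (N - Λ) q w := by
  have h := intertwine_aeval (φ := evalOps Λ N w)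
    (Λ := Algebra.lmul k k[X][X] (Polynomial.C Polynomial.X - Polynomial.X)) (Λ' := N - Λ)
    (fun s => by
      simp only [Algebra.coe_lmul_eq_mul, LinearMap.mul_apply_apply, sub_mul, map_sub,
        evalOps_X_mul, evalOps_C_X_mul hc, LinearMap.sub_apply]) q 1
  rw [Polynomial.aeval_algHom_apply] at h
  simp only [Algebra.coe_lmul_eq_mul, LinearMap.mul_apply_apply, mul_one] at h
  rw [h, ← Polynomial.C_1, ← Polynomial.monomial_zero_left, evalOps_monomial]
  simp

lemma evalOps_X_pow_mul (i : ℕ) (q : k[X][X]) :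
    evalOps Λ N w (Polynomial.X ^ i * q) = (Λ ^ i) (evalOps Λ N w q) := by
  induction i with
  | zero => simp
  | succ i ih => rw [pow_succ', pow_succ', mul_assoc, evalOps_X_mul, ih, Module.End.mul_apply]

lemma subst_sum_right {ι : Type*} {U : Type*} [AddCommGroup U] [Module k U] (s : Finset ι)
    (h : ι → U →ₗ[k] W) (p : ℕ →₀ U) :
    subst Λ (∑ i ∈ s, h i) p = ∑ i ∈ s, subst Λ (h i) p := by
  classical
  induction s using Finset.induction_on with
  | empty => simp [subst_zero_right]
  | insert i s hi ih => rw [Finset.sum_insert hi, Finset.sum_insert hi, subst_add_right, ih]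

variable [Module.Finite k[X] V]

/-- `(m^*(a)_Λ f)_N u = -f_{N-Λ}(m(a)_Λ u)` -/
lemma subst_dualAction (hm : IsSesquilinear m) (hc : Commute Λ N) (a : P) (f : ConfDual k V)
    (u : V) :
    subst Λ ((confPairing N w).flip u) (dualAction m hm a f) =
      -subst Λ (confPairing (N - Λ) w f) (m a u) := by
  have h := congrArg (evalOps Λ N w) (dualAction_formula m hm a f u)
  have hC : ∀ c : k[X], evalOps Λ N w (Polynomial.C c) = Polynomial.aeval N c w := fun c => by
    rw [← Polynomial.monomial_zero_left, evalOps_monomial]; rfl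
  simp only [Finsupp.sum, map_sum, map_neg, evalOps_X_pow_mul, evalOps_aeval hc, hC] at h
  simpa only [subst_apply, Finsupp.sum, LinearMap.flip_apply, confPairing_apply] using h

lemma subst_comp_dualAction_flip (hm : IsSesquilinear m) (hc : Commute Λ N) (f : ConfDual k V)
    (u : V) :
    subst Λ ((confPairing N w).flip u) ∘ₗ (dualAction m hm).flip f =
      -(subst Λ (confPairing (N - Λ) w f) ∘ₗ m.flip u) :=
  LinearMap.ext fun a => subst_dualAction hm hc a f u

/-- Duality reverses the order of composition. -/
lemma subst_comp_dualAction (hm : IsSesquilinear m) (hn : IsSesquilinear n) (hΛN : Commute Λ N)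
    (hMN : Commute M N) (hΛM : Commute Λ M) (a b : P) (f : ConfDual k V) (u : V) :
    subst M (subst Λ ((confPairing N w).flip u) ∘ₗ dualAction m hm a) (dualAction n hn b f) =
      subst Λ (subst M (confPairing (N - (Λ + M)) w f) ∘ₗ n b) (m a u) := by
  -- Pairing m^*(a)_Λ g with u is a finite combination of pairings of g, at N-Λ, with the
  -- coefficients of m(a)u. The formula for a single dual action can then be applied to each of them
  -- with g replaced by n^*(b)f.
  have h1 : subst Λ ((confPairing N w).flip u) ∘ₗ dualAction m hm a =
      -∑ i ∈ (m a u).support, (Λ ^ i) ∘ₗ (confPairing (N - Λ) w).flip (m a u i) := by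
    ext1 g
    rw [LinearMap.comp_apply, subst_dualAction hm hΛN]
    simp only [subst_apply, Finsupp.sum, LinearMap.neg_apply, LinearMap.sum_apply,
      LinearMap.comp_apply, LinearMap.flip_apply]
  rw [h1, subst_neg_right, subst_sum_right, subst_apply _ _ (m a u), Finsupp.sum,
    ← Finset.sum_neg_distrib]
  refine Finset.sum_congr rfl fun i _ => ?_
  rw [subst_comp_of_commute (hΛM.symm.pow_right i),
    subst_dualAction hn (hMN.sub_right hΛM.symm), map_neg, neg_neg, sub_sub, LinearMap.comp_apply]

/-- Elements of V^{*c}[λ, μ] are compared after evaluation at every u, in k[X][λ, μ]. There X acts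
as ∂, so this evaluation is the pairing with N = ∂ and w = 1, to which the general formulas for dual
actions apply. -/
lemma const₂_comp_toLin (u : V) :
    const₂ k k[X] ∘ₗ (ConfDual.toLin (k := k)).flip u =
      (confPairing (del k (ℕ × ℕ →₀ k[X])) (const₂ k k[X] 1)).flip u := by
  ext1 f
  rw [LinearMap.comp_apply, LinearMap.flip_apply, LinearMap.flip_apply, confPairing_apply,
    aeval_del]
  simp [const₂]

lemma const_comp_toLin (u : V) :
    const k k[X] ∘ₗ (ConfDual.toLin (k := k)).flip u =
      (confPairing (del k (ℕ →₀ k[X])) (const k k[X] 1)).flip u := by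
  ext1 f
  rw [LinearMap.comp_apply, LinearMap.flip_apply, LinearMap.flip_apply, confPairing_apply,
    aeval_del]
  simp [const]

lemma confDual_finsupp_ext {ι : Type*} {s t : ι →₀ ConfDual k V}
    (h : ∀ u, Finsupp.mapRange.linearMap ((ConfDual.toLin (k := k)).flip u) s =
      Finsupp.mapRange.linearMap ((ConfDual.toLin (k := k)).flip u) t) : s = t := by
  ext1 i
  exact ConfDual.ext fun u => DFunLike.congr_fun (h u) i

lemma mapCoeff_eq_subst {A B : Type*} [AddCommGroup A] [Module k A] [AddCommGroup B] [Module k B]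
    (g : A →ₗ[k] B) (p : ℕ →₀ A) : mapCoeff g p = subst (lam k B) (const k B ∘ₗ g) p := by
  rw [← subst_mapCoeff, subst_lam_const]

lemma dualAction_sesq (hm : IsSesquilinear m) : IsSesquilinear (dualAction m hm) where
  del_left a f := by
    refine confDual_finsupp_ext fun u => ?_
    change mapCoeff _ _ = mapCoeff _ _
    rw [map_neg, mapCoeff_lam, mapCoeff_eq_subst, mapCoeff_eq_subst, const_comp_toLin,
      subst_dualAction hm commute_lam_del, subst_dualAction hm commute_lam_del, hm.subst_left,
      LinearMap.neg_apply, map_neg]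
  del_right a f := by
    refine confDual_finsupp_ext fun u => ?_
    change mapCoeff _ _ = mapCoeff _ _
    have c : Commute (lam k k[X]) (del k (ℕ →₀ k[X])) := commute_lam_del
    have h1 : ∀ g, (confPairing (del k (ℕ →₀ k[X])) (const k k[X] 1)).flip u
        (del k (ConfDual k V) g) = (-del k (ℕ →₀ k[X]))
          ((confPairing (del k (ℕ →₀ k[X])) (const k k[X] 1)).flip u g) :=
      fun g => confPairing_del_left g u
    have h2 : confPairing (del k (ℕ →₀ k[X]) - lam k k[X]) (const k k[X] 1) (del k _ f) =
        (-(del k (ℕ →₀ k[X]) - lam k k[X])) ∘ₗ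
          confPairing (del k (ℕ →₀ k[X]) - lam k k[X]) (const k k[X] 1) f :=
      LinearMap.ext fun x => confPairing_del_left f x
    rw [LinearMap.add_apply, map_add, mapCoeff_lam, mapCoeff_eq_subst, mapCoeff_eq_subst,
      mapCoeff_eq_subst, const_comp_toLin, subst_del c.neg_right h1,
      subst_dualAction hm c, subst_dualAction hm c, h2,
      subst_comp_of_commute (c.sub_right (Commute.refl _)).neg_right]
    simp only [LinearMap.neg_apply, LinearMap.sub_apply, map_neg]
    abel

/-- Evaluated at u, a composite of two dual actions has no sign but the reversed order, while
ρ^*([a_λ b]) has a sign. So the claim is the identity for ρ, at N-(λ+μ). -/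
lemma dualAction_lie (hV : IsLieRep br ρ) (a b : P) (f : ConfDual k V) :
    subst (lam₂ k _) (subst (lam₂ k _ + mu₂ k _) (const₂ k _) ∘ₗ (dualAction ρ hV.sesq).flip f)
        (br a b) =
      subst (mu₂ k _) (subst (lam₂ k _) (const₂ k _) ∘ₗ dualAction ρ hV.sesq a)
        (dualAction ρ hV.sesq b f) -
      subst (lam₂ k _) (subst (mu₂ k _) (const₂ k _) ∘ₗ dualAction ρ hV.sesq b)
        (dualAction ρ hV.sesq a f) := by
  have c1 : Commute (lam₂ k k[X]) (mu₂ k k[X]) := commute_lam₂_mu₂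
  have c2 : Commute (lam₂ k k[X]) (del k (ℕ × ℕ →₀ k[X])) := commute_lam₂_del
  have c3 : Commute (mu₂ k k[X]) (del k (ℕ × ℕ →₀ k[X])) := commute_mu₂_del
  refine confDual_finsupp_ext fun u => ?_
  rw [map_sub, mapRange_lam_add, mapRange_mu_lam, mapRange_lam_mu, const₂_comp_toLin,
    subst_comp_dualAction_flip _ (c2.add_left c3), subst_comp_dualAction _ _ c2 c3 c1,
    subst_comp_dualAction _ _ c3 c2 c1.symm, subst_neg_right, hV.lie_subst c1, add_comm (mu₂ k k[X])]
  abel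

/-- With -l^* no sign is left on either side, and the reversed order is harmless because the
operators l(a) and l(b) commute. -/
lemma neg_dualAction_mul (hP : IsCommAssocConformal pr) (hV : IsCommAssocRep pr l) (a b : P)
    (f : ConfDual k V) :
    subst (lam₂ k _)
        (subst (lam₂ k _ + mu₂ k _) (const₂ k _) ∘ₗ (-dualAction l hV.sesq).flip f) (pr a b) =
      subst (mu₂ k _) (subst (lam₂ k _) (const₂ k _) ∘ₗ (-dualAction l hV.sesq) a)
        ((-dualAction l hV.sesq) b f) := by
  have c1 : Commute (lam₂ k k[X]) (mu₂ k k[X]) := commute_lam₂_mu₂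
  have c2 : Commute (lam₂ k k[X]) (del k (ℕ × ℕ →₀ k[X])) := commute_lam₂_del
  have c3 : Commute (mu₂ k k[X]) (del k (ℕ × ℕ →₀ k[X])) := commute_mu₂_del
  refine confDual_finsupp_ext fun u => ?_
  change _ = Finsupp.mapRange.linearMap _ (subst _ (_ ∘ₗ (-(dualAction l hV.sesq a))) _)
  change Finsupp.mapRange.linearMap _ (subst _ (_ ∘ₗ (-(dualAction l hV.sesq).flip f)) _) = _
  rw [LinearMap.neg_apply, LinearMap.neg_apply, LinearMap.comp_neg, LinearMap.comp_neg,
    subst_neg_right, subst_neg_right, map_neg (subst _ _), neg_neg, map_neg,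
    mapRange_lam_add, mapRange_mu_lam, const₂_comp_toLin,
    subst_comp_dualAction_flip _ (c2.add_left c3), subst_comp_dualAction _ _ c2 c3 c1,
    subst_neg_right, neg_neg, hV.mul_subst c1, hV.swap_subst hP c1]

/-- Evaluation at u gives the same compatibility of ρ and l, with its two composites exchanged
between the sides. -/
lemma neg_dualAction_rho_l (hV : IsPoissonRep br pr ρ l) (a b : P) (f : ConfDual k V) :
    subst (mu₂ k _) (subst (lam₂ k _) (const₂ k _) ∘ₗ dualAction ρ hV.lie.sesq a)
        ((-dualAction l hV.commAssoc.sesq) b f) =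
      subst (lam₂ k _) (subst (lam₂ k _ + mu₂ k _) (const₂ k _) ∘ₗ
        (-dualAction l hV.commAssoc.sesq).flip f) (br a b) +
      subst (lam₂ k _) (subst (mu₂ k _) (const₂ k _) ∘ₗ (-dualAction l hV.commAssoc.sesq) b)
        (dualAction ρ hV.lie.sesq a f) := by
  have c1 : Commute (lam₂ k k[X]) (mu₂ k k[X]) := commute_lam₂_mu₂
  have c2 : Commute (lam₂ k k[X]) (del k (ℕ × ℕ →₀ k[X])) := commute_lam₂_del
  have c3 : Commute (mu₂ k k[X]) (del k (ℕ × ℕ →₀ k[X])) := commute_mu₂_del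
  refine confDual_finsupp_ext fun u => ?_
  change _ = Finsupp.mapRange.linearMap _ (subst _ (_ ∘ₗ (-(dualAction l _).flip f)) _ +
    subst _ (_ ∘ₗ (-(dualAction l _ b))) _)
  rw [LinearMap.neg_apply, LinearMap.neg_apply, LinearMap.comp_neg, LinearMap.comp_neg,
    subst_neg_right, subst_neg_right, map_neg (subst _ _), map_add, map_neg, map_neg, map_neg,
    mapRange_lam_add, mapRange_mu_lam, mapRange_lam_mu, const₂_comp_toLin,
    subst_comp_dualAction_flip _ (c2.add_left c3), subst_comp_dualAction _ _ c2 c3 c1,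
    subst_comp_dualAction _ _ c3 c2 c1.symm, subst_neg_right, hV.rho_l_subst c1,
    add_comm (mu₂ k k[X])]
  abel

lemma neg_dualAction_rho_mul (hP : IsPoissonConformal br pr) (hV : IsPoissonRep br pr ρ l)
    (a b : P) (f : ConfDual k V) :
    subst (lam₂ k _) (subst (lam₂ k _ + mu₂ k _) (const₂ k _) ∘ₗ
        (dualAction ρ hV.lie.sesq).flip f) (pr a b) =
      subst (lam₂ k _) (subst (mu₂ k _) (const₂ k _) ∘ₗ (-dualAction l hV.commAssoc.sesq) b)
        (dualAction ρ hV.lie.sesq a f) +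
      subst (mu₂ k _) (subst (lam₂ k _) (const₂ k _) ∘ₗ (-dualAction l hV.commAssoc.sesq) a)
        (dualAction ρ hV.lie.sesq b f) := by
  have c1 : Commute (lam₂ k k[X]) (mu₂ k k[X]) := commute_lam₂_mu₂
  have c2 : Commute (lam₂ k k[X]) (del k (ℕ × ℕ →₀ k[X])) := commute_lam₂_del
  have c3 : Commute (mu₂ k k[X]) (del k (ℕ × ℕ →₀ k[X])) := commute_mu₂_del
  refine confDual_finsupp_ext fun u => ?_
  rw [LinearMap.neg_apply, LinearMap.neg_apply, LinearMap.comp_neg, LinearMap.comp_neg,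
    subst_neg_right, subst_neg_right, map_add, map_neg, map_neg,
    mapRange_lam_add, mapRange_mu_lam, mapRange_lam_mu, const₂_comp_toLin,
    subst_comp_dualAction_flip _ (c2.add_left c3), subst_comp_dualAction _ _ c2 c3 c1,
    subst_comp_dualAction _ _ c3 c2 c1.symm, subst_neg_right, hV.rho_mul_subst c1,
    add_comm (mu₂ k k[X])]
  set h := confPairing (del k (ℕ × ℕ →₀ k[X]) - (lam₂ k k[X] + mu₂ k k[X])) (const₂ k k[X] 1) f
  -- The reversal leaves ρ(a)_λ l(b)_μ + ρ(b)_μ l(a)_λ where l(b)_μ ρ(a)_λ + l(a)_λ ρ(b)_μ is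
  -- wanted. The two commutators contribute l([a_λ b])_{λ+μ} and l([b_μ a])_{λ+μ}, which cancel
  -- because ∂ acts on p ↦ l(p)_{λ+μ} u as -(λ+μ).
  have h1 := hV.rho_l_subst c1 h a b u
  have h2 := hV.rho_l_subst c1.symm h b a u
  have h3 : subst (lam₂ k k[X]) (subst (lam₂ k k[X] + mu₂ k k[X]) h ∘ₗ l.flip u) (br a b) =
      -subst (mu₂ k k[X]) (subst (mu₂ k k[X] + lam₂ k k[X]) h ∘ₗ l.flip u) (br b a) := by
    rw [add_comm (mu₂ k k[X]), hP.lie.skew_subst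
      ((Commute.refl (lam₂ k k[X])).add_right c1).neg_right
      (fun p => hV.commAssoc.sesq.subst_left h p u)]
    congr 3
    abel
  rw [h1, h2, h3]
  abel

lemma IsSesquilinear.neg {A B : Type*} [AddCommGroup A] [Module k A] [Module k[X] A]
    [IsScalarTower k k[X] A] [AddCommGroup B] [Module k B] [Module k[X] B]
    [IsScalarTower k k[X] B] {m : A →ₗ[k] B →ₗ[k] (ℕ →₀ B)} (hm : IsSesquilinear m) :
    IsSesquilinear (-m) where
  del_left a v := by simp [hm.del_left]
  del_right a v := by simp [hm.del_right]; abel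

/-- The dual `(ρ^*, -l^*)` of a representation is a representation. -/
theorem IsPoissonRep.dual (hP : IsPoissonConformal br pr) (hV : IsPoissonRep br pr ρ l) :
    IsPoissonRep br pr (dualAction ρ hV.lie.sesq) (-dualAction l hV.commAssoc.sesq) where
  lie := ⟨dualAction_sesq _, dualAction_lie hV.lie⟩
  commAssoc := ⟨(dualAction_sesq _).neg, neg_dualAction_mul hP.commAssoc hV.commAssoc⟩
  rho_mul := rho_mul_of_subst (dualAction_sesq _).neg (neg_dualAction_rho_mul hP hV)
  rho_l := neg_dualAction_rho_l hV

end DualRep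

/-! ### Dual bases and the bijection with Chom(V, P). -/

section DualBasis

variable {k : Type*} [Field k]
  {P : Type*} [AddCommGroup P] [Module k P] [Module k[X] P] [IsScalarTower k k[X] P]
  {V : Type*} [AddCommGroup V] [Module k V] [Module k[X] V] [IsScalarTower k k[X] V]
  {W : Type*} [AddCommGroup W] [Module k W]

lemma ConfDual.toLin_smul (f : ConfDual k V) (q : k[X]) (u : V) :
    f.toLin (q • u) = q * f.toLin u := by
  rw [← aeval_del (k := k), intertwine_aeval (Λ' := del k k[X]) f.toLin_del, aeval_del, smul_eq_mul]

lemma Chom.apply_smul (T : Chom k V P) (q : k[X]) (u : V) :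
    T.1 (q • u) = Polynomial.aeval (del k (ℕ →₀ P) + lam k P) q (T.1 u) := by
  rw [← aeval_del (k := k), intertwine_aeval T.2]

/-- As (∂f)_λ = -λ f_λ, it is -∂ that multiplies the values of f by the variable. -/
lemma ConfDual.toLin_aeval_neg_del (q : k[X]) (f : ConfDual k V) (u : V) :
    (Polynomial.aeval (-del k (ConfDual k V)) q f).toLin u = q * f.toLin u := by
  have h := intertwine_aeval (φ := (ConfDual.toLin (k := k)).flip u)
    (Λ := -del k (ConfDual k V)) (Λ' := del k k[X])
    (fun g => by
      simp only [LinearMap.flip_apply, LinearMap.neg_apply, map_neg, ConfDual.toLin_del_apply,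
        neg_neg]
      rfl) q f
  rw [aeval_del] at h
  exact h

variable {ι : Type*} [Fintype ι] (b : Module.Basis ι k[X] V)

/-- The basis of the conformal dual which is dual to a `k[∂]`-basis. -/
def confCoord (i : ι) : ConfDual k V :=
  ConfDual.mk ((b.coord i).restrictScalars k) fun u => (b.coord i).map_smul Polynomial.X u

lemma confCoord_toLin (i : ι) (u : V) : (confCoord b i).toLin u = b.repr u i := rfl

/-- Values of f are k[X]-linear in the vector, so f_λ(u) = ∑ f_λ(b_i) b_i^*(u), and multiplication
by f_λ(b_i) is the operator f_{-∂}(b_i). -/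
lemma ConfDual.eq_sum_confCoord (f : ConfDual k V) :
    f = ∑ i, Polynomial.aeval (-del k (ConfDual k V)) (f.toLin (b i)) (confCoord b i) := by
  refine ConfDual.ext fun u => ?_
  rw [map_sum, LinearMap.sum_apply]
  simp only [ConfDual.toLin_aeval_neg_del, confCoord_toLin]
  conv_lhs => rw [← b.sum_repr u, map_sum]
  exact Finset.sum_congr rfl fun i _ => by rw [ConfDual.toLin_smul, mul_comm]

lemma Chom.ext_basis {S T : Chom k V P} (h : ∀ i, S.1 (b i) = T.1 (b i)) : S = T := by
  refine Subtype.ext (LinearMap.ext fun u => ?_)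
  rw [← b.sum_repr u, map_sum, map_sum]
  exact Finset.sum_congr rfl fun i _ => by rw [Chom.apply_smul, Chom.apply_smul, h]

/-- The operator on `P ⊗ V^{*c}` which corresponds to `λ` on `Chom(V, P)`. -/
def tensorLam (k P V : Type*) [Field k]
    [AddCommGroup P] [Module k P] [Module k[X] P] [IsScalarTower k k[X] P]
    [AddCommGroup V] [Module k V] [Module k[X] V] [IsScalarTower k k[X] V] :
    Module.End k (P ⊗[k] ConfDual k V) :=
  -LinearMap.lTensor P (del k (ConfDual k V)) - LinearMap.rTensor (ConfDual k V) (del k P)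

/-- On f_{λ+∂}(u)a the operator -(I⊗∂) multiplies by λ+∂ and -(∂⊗I) by -∂; the sum is λ. -/
lemma tensorToChom_tensorLam (t : P ⊗[k] ConfDual k V) (u : V) :
    (tensorToChom (tensorLam k P V t)).1 u = lam k P ((tensorToChom t).1 u) := by
  induction t using TensorProduct.induction_on with
  | zero => simp
  | add s t hs ht =>
    simp only [map_add, Submodule.coe_add, LinearMap.add_apply] at hs ht ⊢
    rw [hs, ht]
  | tmul a f =>
    have h1 : Polynomial.aeval (lam k P + del k (ℕ →₀ P)) (f.toLin u) (Finsupp.single 0 (del k P a)) =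
        del k (ℕ →₀ P) (Polynomial.aeval (lam k P + del k (ℕ →₀ P)) (f.toLin u)
          (Finsupp.single 0 a)) := by
      rw [← del_single, intertwine_aeval (Λ' := lam k P + del k (ℕ →₀ P))]
      intro w
      simp only [LinearMap.add_apply, map_add]
      rw [← Module.End.mul_apply, ← (commute_lam_del (k := k) (V := P)).eq, Module.End.mul_apply]
    have h2 : tensorLam k P V (a ⊗ₜ f) = -(a ⊗ₜ del k _ f) - del k P a ⊗ₜ f := rfl
    rw [h2]
    simp only [map_sub, map_neg, Submodule.coe_sub, Submodule.coe_neg, LinearMap.sub_apply,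
      LinearMap.neg_apply, tensorToChom_tmul, ConfDual.toLin_del_apply, h1, map_mul,
      Polynomial.aeval_X, Module.End.mul_apply, LinearMap.add_apply]
    abel

/-- The inverse of `tensorToChom` in terms of a basis. -/
def chomToTensor (T : Chom k V P) : P ⊗[k] ConfDual k V :=
  ∑ i, subst (tensorLam k P V) ((TensorProduct.mk k P (ConfDual k V)).flip (confCoord b i))
    (T.1 (b i))

/-- Evaluation at b_j turns `tensorLam` into λ and b_i^* into δ_ij, so only T_λ(b_j) survives. -/
lemma tensorToChom_chomToTensor (T : Chom k V P) : tensorToChom (chomToTensor b T) = T := by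
  classical
  refine Chom.ext_basis b fun j => ?_
  let Φ : P ⊗[k] ConfDual k V →ₗ[k] (ℕ →₀ P) :=
    LinearMap.applyₗ (b j) ∘ₗ (Chom k V P).subtype ∘ₗ tensorToChom
  change Φ (chomToTensor b T) = _
  rw [chomToTensor, map_sum]
  have h : ∀ i, Φ (subst (tensorLam k P V)
      ((TensorProduct.mk k P (ConfDual k V)).flip (confCoord b i)) (T.1 (b i))) =
      if i = j then T.1 (b i) else 0 := by
    intro i
    rw [map_subst (φ := Φ) (Λ' := lam k P) (fun t => tensorToChom_tensorLam t (b j))]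
    have h1 : Φ ∘ₗ (TensorProduct.mk k P (ConfDual k V)).flip (confCoord b i) =
        if i = j then const k P else 0 := by
      ext1 a
      change (tensorToChom (a ⊗ₜ confCoord b i)).1 (b j) = _
      rw [tensorToChom_tmul, confCoord_toLin, b.repr_self, Finsupp.single_apply]
      by_cases hij : i = j
      · subst hij; simp [const]
      · rw [if_neg hij, if_neg (Ne.symm hij)]; simp
    rw [h1]
    by_cases hij : i = j
    · rw [if_pos hij, if_pos hij, subst_lam_const]
    · rw [if_neg hij, if_neg hij, subst_zero_right]
  simp only [h, Finset.sum_ite_eq', Finset.mem_univ, if_true]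

lemma chomToTensor_tensorToChom (t : P ⊗[k] ConfDual k V) :
    chomToTensor b (tensorToChom t) = t := by
  induction t using TensorProduct.induction_on with
  | zero => simp [chomToTensor]
  | add s t hs ht =>
    conv_rhs => rw [← hs, ← ht]
    simp only [chomToTensor, map_add, Submodule.coe_add, LinearMap.add_apply,
      Finset.sum_add_distrib]
  | tmul a f =>
    rw [chomToTensor]
    have h : ∀ i, subst (tensorLam k P V)
        ((TensorProduct.mk k P (ConfDual k V)).flip (confCoord b i))
        ((tensorToChom (a ⊗ₜ[k] f)).1 (b i)) =
        a ⊗ₜ Polynomial.aeval (-del k (ConfDual k V)) (f.toLin (b i)) (confCoord b i) := by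
      intro i
      have hc : Commute (tensorLam k P V) (LinearMap.rTensor (ConfDual k V) (del k P)) := by
        refine TensorProduct.ext' fun x g => ?_
        simp [tensorLam]
      -- The substitution sends λ to `tensorLam` and ∂ to ∂⊗I, hence λ+∂ to -(I⊗∂). So f_{λ+∂}(b_i)a
      -- becomes a ⊗ f_{-∂}(b_i)b_i^*, the i-th term of the dual basis expansion.
      rw [tensorToChom_tmul, intertwine_aeval
        (Λ' := -LinearMap.lTensor P (del k (ConfDual k V)))]
      · rw [subst_single, pow_zero]
        exact (intertwine_aeval (φ := TensorProduct.mk k P (ConfDual k V) a)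
          (Λ := -del k (ConfDual k V)) (fun g => by simp [TensorProduct.tmul_neg]) _ _).symm
      · intro w
        rw [LinearMap.add_apply, map_add, subst_lam, subst_del hc (fun v => by simp), tensorLam]
        simp only [LinearMap.sub_apply, LinearMap.neg_apply]
        abel
    simp only [h]
    rw [← TensorProduct.tmul_sum, ← ConfDual.eq_sum_confCoord b f]

theorem tensorToChom_bijective [Module.Finite k[X] V] [Module.Free k[X] V] :
    Function.Bijective (tensorToChom : P ⊗[k] ConfDual k V →ₗ[k] Chom k V P) :=
  let b := Module.Free.chooseBasis k[X] V
  ⟨Function.LeftInverse.injective (g := chomToTensor b) (chomToTensor_tensorToChom b),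
    Function.RightInverse.surjective (g := chomToTensor b) (tensorToChom_chomToTensor b)⟩

end DualBasis

/-! ### Evaluation of a single component of the triple tensor product. -/

section Evaluation

variable {k : Type*} [Field k]
  {P : Type*} [AddCommGroup P] [Module k P] [Module k[X] P] [IsScalarTower k k[X] P]
  {V : Type*} [AddCommGroup V] [Module k V] [Module k[X] V] [IsScalarTower k k[X] V]
  {W : Type*} [AddCommGroup W] [Module k W]
  {br pr : P →ₗ[k] P →ₗ[k] (ℕ →₀ P)} {ρ l m : P →ₗ[k] V →ₗ[k] (ℕ →₀ V)}

/-- The `k[∂]`-module homomorphism `V → P` which corresponds to `t ∈ P ⊗ V^{*c}`. -/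
def homOfTensor (t : P ⊗[k] ConfDual k V) : V →ₗ[k] P :=
  (Chom.evalZero (tensorToChom t)).restrictScalars k

lemma homOfTensor_add (s t : P ⊗[k] ConfDual k V) :
    homOfTensor (s + t) = homOfTensor s + homOfTensor t := by
  ext1 u
  change (tensorToChom (s + t)).1 u 0 = (tensorToChom s).1 u 0 + (tensorToChom t).1 u 0
  rw [map_add]
  rfl

lemma homOfTensor_zero : homOfTensor (0 : P ⊗[k] ConfDual k V) = 0 := by
  ext1 u
  change (tensorToChom (0 : P ⊗[k] ConfDual k V)).1 u 0 = 0
  rw [map_zero tensorToChom]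
  rfl

/-- At λ = 0 the operator λ+∂ reduces to ∂ acting on a. -/
lemma homOfTensor_tmul (a : P) (f : ConfDual k V) (u : V) :
    homOfTensor (a ⊗ₜ[k] f) u = f.toLin u • a := by
  change (tensorToChom (a ⊗ₜ[k] f)).1 u 0 = _
  rw [tensorToChom_tmul]
  have h := intertwine_aeval (φ := (Finsupp.lapply 0 : (ℕ →₀ P) →ₗ[k] P))
    (Λ := lam k P + del k (ℕ →₀ P)) (Λ' := del k P) (fun p => by
      simp only [Finsupp.lapply_apply, LinearMap.add_apply, Finsupp.add_apply, coeff_zero_lam,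
        zero_add]
      rfl) (f.toLin u) (Finsupp.single 0 a)
  rw [aeval_del] at h
  simpa using h

lemma homOfTensor_del (t : P ⊗[k] ConfDual k V) (u : V) :
    homOfTensor t (del k V u) = del k P (homOfTensor t u) :=
  (Chom.evalZero (tensorToChom t)).map_smul Polynomial.X u

section Blocks

variable (Du Dv : Module.End k W) (c : P →ₗ[k] W) (u v : V)

/-- `a ↦ f(u) g(v) c(a)`, with `-Du` and `-Dv` substituted in `f(u)` and `g(v)`. -/
def evalP (f g : ConfDual k V) : P →ₗ[k] W :=
  Polynomial.aeval (-Du) (f.toLin u) ∘ₗ Polynomial.aeval (-Dv) (g.toLin v) ∘ₗ c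

/-- `f ↦ f(u) g(v) c(a)` -/
def evalU (a : P) (g : ConfDual k V) : ConfDual k V →ₗ[k] W :=
  (confPairing (-Du) (Polynomial.aeval (-Dv) (g.toLin v) (c a))).flip u

/-- `g ↦ f(u) g(v) c(a)` -/
def evalV (a : P) (f : ConfDual k V) : ConfDual k V →ₗ[k] W :=
  Polynomial.aeval (-Du) (f.toLin u) ∘ₗ (confPairing (-Dv) (c a)).flip v

variable {Du Dv c u v}

lemma evalP_zero_left (g : ConfDual k V) : evalP Du Dv c u v 0 g = 0 := by simp [evalP]
lemma evalP_zero_right (f : ConfDual k V) : evalP Du Dv c u v f 0 = 0 := by simp [evalP]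
lemma evalU_zero_left (g : ConfDual k V) : evalU Du Dv c u v 0 g = 0 := by
  ext1 f; simp [evalU, confPairing_apply]
lemma evalU_zero_right (a : P) : evalU Du Dv c u v a 0 = 0 := by
  ext1 f; simp [evalU, confPairing_apply]
lemma evalV_zero_left (f : ConfDual k V) : evalV Du Dv c u v 0 f = 0 := by
  ext1 g; simp [evalV, confPairing_apply]
lemma evalV_zero_right (a : P) : evalV Du Dv c u v a 0 = 0 := by
  ext1 g; simp [evalV, confPairing_apply]

lemma commute_aeval {A B : Module.End k W} (h : Commute A B) (q : k[X]) :
    Commute A (Polynomial.aeval B q) := by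
  refine LinearMap.ext fun w => ?_
  exact intertwine_aeval (φ := A) (fun x => congr($(h.eq) x)) q w

variable (hDD : Commute Du Dv) (hc : ∀ a, c (del k P a) = (-(Du + Dv)) (c a))

include hDD

/-- The sign in -Du is chosen for this: ∂ multiplies f by minus its variable, hence acts as Du. -/
lemma evalU_del (a : P) (g f : ConfDual k V) :
    evalU Du Dv c u v a g (del k _ f) = Du (evalU Du Dv c u v a g f) := by
  rw [evalU, LinearMap.flip_apply, confPairing_del_left, LinearMap.neg_apply, neg_neg]
  rfl

lemma evalV_del (a : P) (g f : ConfDual k V) :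
    evalV Du Dv c u v a f (del k _ g) = Dv (evalV Du Dv c u v a f g) := by
  rw [evalV, LinearMap.comp_apply, LinearMap.flip_apply, confPairing_del_left,
    LinearMap.neg_apply, neg_neg]
  exact congr($((commute_aeval hDD.symm.neg_right (f.toLin u)).eq.symm) _)

include hc

lemma evalP_del (f g : ConfDual k V) (a : P) :
    evalP Du Dv c u v f g (del k P a) = (-(Du + Dv)) (evalP Du Dv c u v f g a) := by
  have h1 := commute_aeval (A := -(Du + Dv)) (B := -Du)
    ((Commute.refl Du).add_left hDD.symm).neg_left.neg_right (f.toLin u)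
  have h2 := commute_aeval (A := -(Du + Dv)) (B := -Dv)
    (hDD.add_left (Commute.refl Dv)).neg_left.neg_right (g.toLin v)
  simp only [evalP, LinearMap.comp_apply, hc]
  rw [← Module.End.mul_apply (-(Du + Dv)), h1.eq, Module.End.mul_apply,
    ← Module.End.mul_apply (-(Du + Dv)), h2.eq, Module.End.mul_apply]

lemma map_smul_of_del (q : k[X]) (a : P) :
    c (q • a) = Polynomial.aeval (-(Du + Dv)) q (c a) := by
  rw [← aeval_del (k := k), intertwine_aeval hc]

omit hDD hc in
lemma IsSesquilinear.subst_smul_left {U : Type*} [AddCommGroup U] [Module k U] [Module k[X] U]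
    [IsScalarTower k k[X] U] {m : P →ₗ[k] U →ₗ[k] (ℕ →₀ U)} (hm : IsSesquilinear m)
    {Λ : Module.End k W} (h : U →ₗ[k] W) (q : k[X]) (a : P) (x : U) :
    subst Λ h (m (q • a) x) = Polynomial.aeval (-Λ) q (subst Λ h (m a x)) := by
  rw [← aeval_del (k := k)]
  exact intertwine_aeval (φ := subst Λ h ∘ₗ m.flip x) (fun b => hm.subst_left h b x) q a

omit hDD hc in
lemma IsSesquilinear.subst_smul_right {U : Type*} [AddCommGroup U] [Module k U] [Module k[X] U]
    [IsScalarTower k k[X] U] {m : P →ₗ[k] U →ₗ[k] (ℕ →₀ U)} (hm : IsSesquilinear m)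
    {Λ D : Module.End k W} (hΛ : Commute Λ D) {h : U →ₗ[k] W}
    (hD : ∀ x, h (del k U x) = D (h x)) (q : k[X]) (a : P) (x : U) :
    subst Λ h (m a (q • x)) = Polynomial.aeval (D + Λ) q (subst Λ h (m a x)) := by
  rw [← aeval_del (k := k)]
  exact intertwine_aeval (φ := subst Λ h ∘ₗ m a) (fun y => hm.subst_right hΛ hD a y) q x

/-- Sesquilinearity moves the scalars into the arguments: at λ = Du, the ∂ of the first argument
acts as -Du and that of the second as -(Du+Dv)+Du = -Dv, the values at which f(u) and g(v) are
taken. -/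
lemma subst_evalP_left {n : P →ₗ[k] P →ₗ[k] (ℕ →₀ P)} (hn : IsSesquilinear n)
    (f g : ConfDual k V) (a b : P) :
    subst Du (evalP Du Dv c u v f g) (n a b) =
      subst Du c (n (f.toLin u • a) (g.toLin v • b)) := by
  have h1 : Commute Du (-(Du + Dv)) := ((Commute.refl Du).add_right hDD).neg_right
  rw [hn.subst_smul_left, hn.subst_smul_right h1 hc, evalP,
    subst_comp_of_commute (commute_aeval (Commute.refl Du).neg_right _),
    subst_comp_of_commute (commute_aeval hDD.neg_right _)]
  congr 4
  abel

lemma subst_evalP_right {n : P →ₗ[k] P →ₗ[k] (ℕ →₀ P)} (hn : IsSesquilinear n)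
    (f g : ConfDual k V) (a b : P) :
    subst Dv (evalP Du Dv c u v f g) (n b a) =
      subst Dv c (n (g.toLin v • b) (f.toLin u • a)) := by
  have h1 : Commute Dv (-(Du + Dv)) := (hDD.symm.add_right (Commute.refl Dv)).neg_right
  have h2 : -(Du + Dv) + Dv = -Du := by abel
  rw [hn.subst_smul_left, hn.subst_smul_right h1 hc, evalP,
    subst_comp_of_commute (commute_aeval hDD.symm.neg_right _),
    subst_comp_of_commute (commute_aeval (Commute.refl Dv).neg_right _), h2]
  exact congr($((commute_aeval (commute_aeval hDD.symm.neg_left.neg_right _).symm _).eq) _)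

variable [Module.Finite k[X] V]

/-- The dual action lowers the argument of f from -Du to -(Du+Dv), which is how ∂ acts on c(a);
hence f reassembles with a into the homomorphism attached to a ⊗ f. The scalar g(v) is absorbed by
b. -/
lemma subst_evalU (hm : IsSesquilinear m) (a b : P) (f g : ConfDual k V) :
    subst Dv (evalU Du Dv c u v a g) (dualAction m hm b f) =
      -subst Dv (c ∘ₗ homOfTensor (a ⊗ₜ[k] f)) (m (g.toLin v • b) u) := by
  have h1 : Commute (-Dv) (-(Du + Dv)) := (hDD.symm.add_right (Commute.refl Dv)).neg_left.neg_right
  rw [evalU, subst_dualAction hm hDD.symm.neg_right, hm.subst_smul_left,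
    ← subst_comp_of_commute (commute_aeval (Commute.refl Dv).neg_right _)]
  congr 1
  refine subst_congr (fun x => ?_) _
  rw [confPairing_apply, LinearMap.comp_apply, LinearMap.comp_apply, homOfTensor_tmul,
    map_smul_of_del hDD hc, ← neg_add']
  exact congr($((commute_aeval (commute_aeval h1 _).symm _).eq) _)

lemma subst_evalV (hm : IsSesquilinear m) (a b : P) (f g : ConfDual k V) :
    subst Du (evalV Du Dv c u v a f) (dualAction m hm b g) =
      -subst Du (c ∘ₗ homOfTensor (a ⊗ₜ[k] g)) (m (f.toLin u • b) v) := by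
  rw [evalV, subst_comp_of_commute (commute_aeval (Commute.refl Du).neg_right _),
    subst_dualAction hm hDD.neg_right, hm.subst_smul_left, map_neg]
  congr 2
  refine subst_congr (fun x => ?_) _
  rw [confPairing_apply, LinearMap.comp_apply, homOfTensor_tmul,
    map_smul_of_del hDD hc, ← neg_add', add_comm]

end Blocks

end Evaluation

/-! ### The Yang-Baxter elements evaluated on the three components. -/

section TripleEvaluation

variable {k : Type*} [Field k]
  {P : Type*} [AddCommGroup P] [Module k P] [Module k[X] P] [IsScalarTower k k[X] P]
  {V : Type*} [AddCommGroup V] [Module k V] [Module k[X] V] [IsScalarTower k k[X] V]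
  {W : Type*} [AddCommGroup W] [Module k W]
  {br pr : P →ₗ[k] P →ₗ[k] (ℕ →₀ P)} {ρ l : P →ₗ[k] V →ₗ[k] (ℕ →₀ V)}

/-- Evaluation of `E ⊗ E ⊗ E`, for `E = P ⊕ V^{*c}`, on the component `P ⊗ V^{*c} ⊗ V^{*c}`:
`a ⊗ f ⊗ g ↦ f(u) g(v) c(a)`, with `-Du` and `-Dv` substituted in `f(u)` and `g(v)`. -/
def evalFst (Du Dv : Module.End k W) (c : P →ₗ[k] W) (u v : V) :
    (P × ConfDual k V) ⊗[k] ((P × ConfDual k V) ⊗[k] (P × ConfDual k V)) →ₗ[k] W :=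
  TensorProduct.lift
    ((TensorProduct.lift ((LinearMap.mul k (Module.End k W)).compl₁₂
      ((Polynomial.aeval (R := k) (-Du)).toLinearMap ∘ₗ (ConfDual.toLin (k := k)).flip u ∘ₗ
        LinearMap.snd k P (ConfDual k V))
      ((Polynomial.aeval (R := k) (-Dv)).toLinearMap ∘ₗ (ConfDual.toLin (k := k)).flip v ∘ₗ
        LinearMap.snd k P (ConfDual k V)))).flip ∘ₗ c ∘ₗ LinearMap.fst k P (ConfDual k V))

/-- The analogue of `evalFst` for the component `V^{*c} ⊗ P ⊗ V^{*c}`. -/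
def evalSnd (Du Dv : Module.End k W) (c : P →ₗ[k] W) (u v : V) :
    (P × ConfDual k V) ⊗[k] ((P × ConfDual k V) ⊗[k] (P × ConfDual k V)) →ₗ[k] W :=
  evalFst Du Dv c u v ∘ₗ (TensorProduct.leftComm k _ _ _).toLinearMap

/-- The analogue of `evalFst` for the component `V^{*c} ⊗ V^{*c} ⊗ P`. -/
def evalThd (Du Dv : Module.End k W) (c : P →ₗ[k] W) (u v : V) :
    (P × ConfDual k V) ⊗[k] ((P × ConfDual k V) ⊗[k] (P × ConfDual k V)) →ₗ[k] W :=
  evalFst Du Dv c u v ∘ₗ (TensorProduct.comm k _ _).toLinearMap ∘ₗ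
    (TensorProduct.assoc k _ _ _).symm.toLinearMap

variable {Du Dv : Module.End k W} {c : P →ₗ[k] W} {u v : V} (x y z w : P × ConfDual k V)

lemma evalFst_tmul : evalFst Du Dv c u v (x ⊗ₜ (y ⊗ₜ z)) = evalP Du Dv c u v y.2 z.2 x.1 := rfl
lemma evalSnd_tmul : evalSnd Du Dv c u v (x ⊗ₜ (y ⊗ₜ z)) = evalP Du Dv c u v x.2 z.2 y.1 := rfl
lemma evalThd_tmul : evalThd Du Dv c u v (x ⊗ₜ (y ⊗ₜ z)) = evalP Du Dv c u v x.2 y.2 z.1 := rfl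

lemma evalFst_slot₁ : evalFst Du Dv c u v ∘ₗ slot₁ y z =
    evalP Du Dv c u v y.2 z.2 ∘ₗ LinearMap.fst k P (ConfDual k V) := rfl
lemma evalFst_slot₂ : evalFst Du Dv c u v ∘ₗ slot₂ x z =
    evalU Du Dv c u v x.1 z.2 ∘ₗ LinearMap.snd k P (ConfDual k V) := rfl
lemma evalFst_slot₃ : evalFst Du Dv c u v ∘ₗ slot₃ x y =
    evalV Du Dv c u v x.1 y.2 ∘ₗ LinearMap.snd k P (ConfDual k V) := rfl
lemma evalSnd_slot₁ : evalSnd Du Dv c u v ∘ₗ slot₁ y z =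
    evalU Du Dv c u v y.1 z.2 ∘ₗ LinearMap.snd k P (ConfDual k V) := rfl
lemma evalSnd_slot₂ : evalSnd Du Dv c u v ∘ₗ slot₂ x z =
    evalP Du Dv c u v x.2 z.2 ∘ₗ LinearMap.fst k P (ConfDual k V) := rfl
lemma evalSnd_slot₃ : evalSnd Du Dv c u v ∘ₗ slot₃ x y =
    evalV Du Dv c u v y.1 x.2 ∘ₗ LinearMap.snd k P (ConfDual k V) := rfl
lemma evalThd_slot₁ : evalThd Du Dv c u v ∘ₗ slot₁ y z =
    evalU Du Dv c u v z.1 y.2 ∘ₗ LinearMap.snd k P (ConfDual k V) := rfl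
lemma evalThd_slot₂ : evalThd Du Dv c u v ∘ₗ slot₂ x z =
    evalV Du Dv c u v z.1 x.2 ∘ₗ LinearMap.snd k P (ConfDual k V) := rfl
lemma evalThd_slot₃ : evalThd Du Dv c u v ∘ₗ slot₃ x y =
    evalP Du Dv c u v x.2 y.2 ∘ₗ LinearMap.fst k P (ConfDual k V) := rfl

lemma triple_ext {E : Type*} [AddCommGroup E] [Module k E] {F G : E ⊗[k] (E ⊗[k] E) →ₗ[k] W}
    (h : ∀ x y z, F (x ⊗ₜ (y ⊗ₜ z)) = G (x ⊗ₜ (y ⊗ₜ z))) (t : E ⊗[k] (E ⊗[k] E)) : F t = G t := by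
  have : F = G := by
    refine TensorProduct.ext' fun x s => ?_
    induction s using TensorProduct.induction_on with
    | zero => simp
    | add s t hs ht => rw [TensorProduct.tmul_add, map_add, map_add, hs, ht]
    | tmul y z => exact h x y z
  rw [this]

section del

variable (hDD : Commute Du Dv) (hc : ∀ a, c (del k P a) = (-(Du + Dv)) (c a))
  (t : (P × ConfDual k V) ⊗[k] ((P × ConfDual k V) ⊗[k] (P × ConfDual k V)))

include hDD hc in
lemma evalFst_del₁ : evalFst Du Dv c u v (del₁ k _ t) = (-(Du + Dv)) (evalFst Du Dv c u v t) :=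
  triple_ext (F := evalFst Du Dv c u v ∘ₗ del₁ k _) (G := (-(Du + Dv)) ∘ₗ evalFst Du Dv c u v)
    (fun x y z => evalP_del hDD hc y.2 z.2 x.1) t

include hDD in
lemma evalFst_del₂ : evalFst Du Dv c u v (del₂ k _ t) = Du (evalFst Du Dv c u v t) :=
  triple_ext (F := evalFst Du Dv c u v ∘ₗ del₂ k _) (G := Du ∘ₗ evalFst Du Dv c u v)
    (fun x y z => evalU_del hDD x.1 z.2 y.2) t

include hDD in
lemma evalFst_del₃ : evalFst Du Dv c u v (del₃ k _ t) = Dv (evalFst Du Dv c u v t) :=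
  triple_ext (F := evalFst Du Dv c u v ∘ₗ del₃ k _) (G := Dv ∘ₗ evalFst Du Dv c u v)
    (fun x y z => evalV_del hDD x.1 z.2 y.2) t

include hDD in
lemma evalSnd_del₁ : evalSnd Du Dv c u v (del₁ k _ t) = Du (evalSnd Du Dv c u v t) :=
  triple_ext (F := evalSnd Du Dv c u v ∘ₗ del₁ k _) (G := Du ∘ₗ evalSnd Du Dv c u v)
    (fun x y z => evalU_del hDD y.1 z.2 x.2) t

include hDD hc in
lemma evalSnd_del₂ : evalSnd Du Dv c u v (del₂ k _ t) = (-(Du + Dv)) (evalSnd Du Dv c u v t) :=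
  triple_ext (F := evalSnd Du Dv c u v ∘ₗ del₂ k _) (G := (-(Du + Dv)) ∘ₗ evalSnd Du Dv c u v)
    (fun x y z => evalP_del hDD hc x.2 z.2 y.1) t

include hDD in
lemma evalSnd_del₃ : evalSnd Du Dv c u v (del₃ k _ t) = Dv (evalSnd Du Dv c u v t) :=
  triple_ext (F := evalSnd Du Dv c u v ∘ₗ del₃ k _) (G := Dv ∘ₗ evalSnd Du Dv c u v)
    (fun x y z => evalV_del hDD y.1 z.2 x.2) t

include hDD in
lemma evalThd_del₁ : evalThd Du Dv c u v (del₁ k _ t) = Du (evalThd Du Dv c u v t) :=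
  triple_ext (F := evalThd Du Dv c u v ∘ₗ del₁ k _) (G := Du ∘ₗ evalThd Du Dv c u v)
    (fun x y z => evalU_del hDD z.1 y.2 x.2) t

include hDD in
lemma evalThd_del₂ : evalThd Du Dv c u v (del₂ k _ t) = Dv (evalThd Du Dv c u v t) :=
  triple_ext (F := evalThd Du Dv c u v ∘ₗ del₂ k _) (G := Dv ∘ₗ evalThd Du Dv c u v)
    (fun x y z => evalV_del hDD z.1 y.2 x.2) t

include hDD hc in
lemma evalThd_del₃ : evalThd Du Dv c u v (del₃ k _ t) = (-(Du + Dv)) (evalThd Du Dv c u v t) :=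
  triple_ext (F := evalThd Du Dv c u v ∘ₗ del₃ k _) (G := (-(Du + Dv)) ∘ₗ evalThd Du Dv c u v)
    (fun x y z => evalP_del hDD hc x.2 y.2 z.1) t

include hDD hc in
lemma evalFst_subst_del₁ (h : (P × ConfDual k V) →ₗ[k] _) (p : ℕ →₀ P × ConfDual k V) :
    evalFst Du Dv c u v (subst (del₁ k _) h p) =
      subst (-(Du + Dv)) (evalFst Du Dv c u v ∘ₗ h) p :=
  map_subst (fun t => evalFst_del₁ hDD hc t) h p

include hDD in
lemma evalFst_subst_del₂ (h : (P × ConfDual k V) →ₗ[k] _) (p : ℕ →₀ P × ConfDual k V) :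
    evalFst Du Dv c u v (subst (del₂ k _) h p) =
      subst Du (evalFst Du Dv c u v ∘ₗ h) p :=
  map_subst (fun t => evalFst_del₂ hDD t) h p

include hDD in
lemma evalFst_subst_del₃ (h : (P × ConfDual k V) →ₗ[k] _) (p : ℕ →₀ P × ConfDual k V) :
    evalFst Du Dv c u v (subst (del₃ k _) h p) =
      subst Dv (evalFst Du Dv c u v ∘ₗ h) p :=
  map_subst (fun t => evalFst_del₃ hDD t) h p

include hDD hc in
-- The evaluation makes the sum of the three ∂ vanish, so -(∂⊗I+I⊗∂)⊗I acts like I⊗I⊗∂.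
lemma evalFst_subst_neg_add (h : (P × ConfDual k V) →ₗ[k] _) (p : ℕ →₀ P × ConfDual k V) :
    evalFst Du Dv c u v (subst (-(del₁ k _ + del₂ k _)) h p) =
      subst Dv (evalFst Du Dv c u v ∘ₗ h) p :=
  map_subst (fun t => by
    simp only [LinearMap.neg_apply, LinearMap.add_apply, map_neg, map_add,
      evalFst_del₁ hDD hc, evalFst_del₂ hDD]
    abel) h p

include hDD in
lemma evalSnd_subst_del₁ (h : (P × ConfDual k V) →ₗ[k] _) (p : ℕ →₀ P × ConfDual k V) :
    evalSnd Du Dv c u v (subst (del₁ k _) h p) =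
      subst Du (evalSnd Du Dv c u v ∘ₗ h) p :=
  map_subst (fun t => evalSnd_del₁ hDD t) h p

include hDD hc in
lemma evalSnd_subst_del₂ (h : (P × ConfDual k V) →ₗ[k] _) (p : ℕ →₀ P × ConfDual k V) :
    evalSnd Du Dv c u v (subst (del₂ k _) h p) =
      subst (-(Du + Dv)) (evalSnd Du Dv c u v ∘ₗ h) p :=
  map_subst (fun t => evalSnd_del₂ hDD hc t) h p

include hDD in
lemma evalSnd_subst_del₃ (h : (P × ConfDual k V) →ₗ[k] _) (p : ℕ →₀ P × ConfDual k V) :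
    evalSnd Du Dv c u v (subst (del₃ k _) h p) =
      subst Dv (evalSnd Du Dv c u v ∘ₗ h) p :=
  map_subst (fun t => evalSnd_del₃ hDD t) h p

include hDD hc in
lemma evalSnd_subst_neg_add (h : (P × ConfDual k V) →ₗ[k] _) (p : ℕ →₀ P × ConfDual k V) :
    evalSnd Du Dv c u v (subst (-(del₁ k _ + del₂ k _)) h p) =
      subst Dv (evalSnd Du Dv c u v ∘ₗ h) p :=
  map_subst (fun t => by
    simp only [LinearMap.neg_apply, LinearMap.add_apply, map_neg, map_add,
      evalSnd_del₁ hDD, evalSnd_del₂ hDD hc]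
    abel) h p

include hDD in
lemma evalThd_subst_del₁ (h : (P × ConfDual k V) →ₗ[k] _) (p : ℕ →₀ P × ConfDual k V) :
    evalThd Du Dv c u v (subst (del₁ k _) h p) =
      subst Du (evalThd Du Dv c u v ∘ₗ h) p :=
  map_subst (fun t => evalThd_del₁ hDD t) h p

include hDD in
lemma evalThd_subst_del₂ (h : (P × ConfDual k V) →ₗ[k] _) (p : ℕ →₀ P × ConfDual k V) :
    evalThd Du Dv c u v (subst (del₂ k _) h p) =
      subst Dv (evalThd Du Dv c u v ∘ₗ h) p :=
  map_subst (fun t => evalThd_del₂ hDD t) h p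

include hDD hc in
lemma evalThd_subst_del₃ (h : (P × ConfDual k V) →ₗ[k] _) (p : ℕ →₀ P × ConfDual k V) :
    evalThd Du Dv c u v (subst (del₃ k _) h p) =
      subst (-(Du + Dv)) (evalThd Du Dv c u v ∘ₗ h) p :=
  map_subst (fun t => evalThd_del₃ hDD hc t) h p

include hDD in
lemma evalThd_subst_neg_add (h : (P × ConfDual k V) →ₗ[k] _) (p : ℕ →₀ P × ConfDual k V) :
    evalThd Du Dv c u v (subst (-(del₁ k _ + del₂ k _)) h p) =
      subst (-(Du + Dv)) (evalThd Du Dv c u v ∘ₗ h) p :=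
  map_subst (fun t => by
    simp only [LinearMap.neg_apply, LinearMap.add_apply, map_neg, map_add,
      evalThd_del₁ hDD, evalThd_del₂ hDD]) h p

end del

lemma lieYB_tmul {E : Type*} [AddCommGroup E] [Module k E] [Module k[X] E]
    [IsScalarTower k k[X] E] (br : E →ₗ[k] E →ₗ[k] (ℕ →₀ E)) (x y z w : E) :
    lieYB br (x ⊗ₜ y) (z ⊗ₜ w) = subst (del₂ k E) (slot₁ y w) (br x z) -
      subst (del₃ k E) (slot₂ x w) (br z y) - subst (del₂ k E) (slot₃ x z) (br w y) := rfl

lemma assocYB_tmul {E : Type*} [AddCommGroup E] [Module k E] [Module k[X] E]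
    [IsScalarTower k k[X] E] (pr : E →ₗ[k] E →ₗ[k] (ℕ →₀ E)) (x y z w : E) :
    assocYB pr (x ⊗ₜ y) (z ⊗ₜ w) = subst (del₁ k E) (slot₃ x z) (pr y w) -
      subst (-(del₁ k E + del₂ k E)) (slot₂ x w) (pr z y) +
      subst (del₂ k E) (slot₁ y w) (pr x z) := rfl

lemma skewOf_tmul {Q : Type*} [AddCommGroup Q] [Module k Q] (a : P) (f : Q) :
    skewOf (a ⊗ₜ[k] f) = (a, 0) ⊗ₜ[k] (0, f) - (0, f) ⊗ₜ[k] (a, 0) := rfl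

lemma skewOf_add {Q : Type*} [AddCommGroup Q] [Module k Q] (s t : P ⊗[k] Q) :
    skewOf (s + t) = skewOf s + skewOf t := by
  simp only [skewOf, map_add]; abel

lemma skewOf_zero {Q : Type*} [AddCommGroup Q] [Module k Q] :
    skewOf (0 : P ⊗[k] Q) = 0 := by
  simp only [skewOf, map_zero, sub_zero]

lemma tensor_induction₂ {P Q : Type*} [AddCommGroup P] [Module k P] [AddCommGroup Q] [Module k Q]
    {p : P ⊗[k] Q → P ⊗[k] Q → Prop} (h0 : ∀ t, p 0 t) (h0' : ∀ t, p t 0)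
    (hadd : ∀ s s' t, p s t → p s' t → p (s + s') t)
    (hadd' : ∀ s t t', p s t → p s t' → p s (t + t'))
    (ht : ∀ a f b g, p (a ⊗ₜ f) (b ⊗ₜ g)) (s t : P ⊗[k] Q) : p s t := by
  induction s using TensorProduct.induction_on with
  | zero => exact h0 t
  | add s s' hs hs' => exact hadd _ _ _ hs hs'
  | tmul a f =>
    induction t using TensorProduct.induction_on with
    | zero => exact h0' _
    | add t t' hs hs' => exact hadd' _ _ _ hs hs'
    | tmul b g => exact ht a f b g

variable [Module.Finite k[X] V]

section values

variable (hDD : Commute Du Dv) (hc : ∀ a, c (del k P a) = (-(Du + Dv)) (c a))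

include hDD hc

/-- Two independent tensors s, t make both sides bilinear, which reduces the claim to pure tensors.
There one bracket in P and two dual actions have values in P ⊗ V^{*c} ⊗ V^{*c}. For s = t this is
the Lie half of the O-operator equation. -/
lemma evalFst_lieYB (hbr : IsSesquilinear br) (hρ : IsSesquilinear ρ)
    (s t : P ⊗[k] ConfDual k V) :
    evalFst Du Dv c u v (lieYB (semidirectBracket br (dualAction ρ hρ)) (skewOf s) (skewOf t)) =
      subst Du c (br (homOfTensor s u) (homOfTensor t v)) +
      subst Dv (c ∘ₗ homOfTensor s) (ρ (homOfTensor t v) u) -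
      subst Du (c ∘ₗ homOfTensor s) (ρ (homOfTensor t u) v) := by
  induction s, t using tensor_induction₂ (k := k) with
  | h0 t => simp [skewOf_zero, homOfTensor_zero, subst_zero_right]
  | h0' t => simp [skewOf_zero, homOfTensor_zero, subst_zero_right]
  | hadd s s' t hs hs' =>
    simp only [skewOf_add, homOfTensor_add, map_add, LinearMap.add_apply, LinearMap.comp_add,
      subst_add_right, hs, hs']
    abel
  | hadd' s t t' hs hs' =>
    simp only [skewOf_add, homOfTensor_add, map_add, LinearMap.add_apply, LinearMap.comp_add,
      subst_add_right, hs, hs']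
    abel
  | ht a f b g =>
    simp only [skewOf_tmul, map_sub, LinearMap.sub_apply, lieYB_tmul,
      evalFst_subst_del₂ hDD, evalFst_subst_del₃ hDD,
      evalFst_slot₁, evalFst_slot₂, evalFst_slot₃, subst_fst_semidirectBracket,
      subst_snd_semidirectBracket, map_zero, LinearMap.zero_apply, evalP_zero_left,
      evalP_zero_right, evalU_zero_left, evalU_zero_right, evalV_zero_left, evalV_zero_right,
      subst_zero_right, subst_evalP_left hDD hc hbr, subst_evalU hDD hc,
      subst_evalV hDD hc, homOfTensor_tmul]
    abel

lemma evalSnd_lieYB (hbr : IsLieConformal br) (hρ : IsSesquilinear ρ)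
    (s t : P ⊗[k] ConfDual k V) :
    evalSnd Du Dv c u v (lieYB (semidirectBracket br (dualAction ρ hρ)) (skewOf s) (skewOf t)) =
      -(subst Du c (br (homOfTensor s u) (homOfTensor t v)) +
      subst Dv (c ∘ₗ homOfTensor s) (ρ (homOfTensor t v) u) -
      subst Du (c ∘ₗ homOfTensor t) (ρ (homOfTensor s u) v)) := by
  induction s, t using tensor_induction₂ (k := k) with
  | h0 t => simp [skewOf_zero, homOfTensor_zero, subst_zero_right]
  | h0' t => simp [skewOf_zero, homOfTensor_zero, subst_zero_right]
  | hadd s s' t hs hs' =>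
    simp only [skewOf_add, homOfTensor_add, map_add, LinearMap.add_apply, LinearMap.comp_add,
      subst_add_right, hs, hs']
    abel
  | hadd' s t t' hs hs' =>
    simp only [skewOf_add, homOfTensor_add, map_add, LinearMap.add_apply, LinearMap.comp_add,
      subst_add_right, hs, hs']
    abel
  | ht a f b g =>
    have c1 : Commute (-(Du + Dv)) Du := ((Commute.refl Du).add_left hDD.symm).neg_left
    have c2 : Commute Dv (-(Du + Dv)) := (hDD.symm.add_right (Commute.refl Dv)).neg_right
    have e1 : -(-(Du + Dv)) - Du = Dv := by abel
    have e2 : -(-(Du + Dv)) - Dv = Du := by abel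
    have e3 : -Dv - -(Du + Dv) = Du := by abel
    simp only [skewOf_tmul, map_sub, LinearMap.sub_apply, lieYB_tmul,
      evalSnd_subst_del₂ hDD hc, evalSnd_subst_del₃ hDD,
      evalSnd_slot₁, evalSnd_slot₂, evalSnd_slot₃, subst_fst_semidirectBracket,
      subst_snd_semidirectBracket, map_zero, LinearMap.zero_apply, evalP_zero_left,
      evalP_zero_right, evalU_zero_left, evalU_zero_right, evalV_zero_left, evalV_zero_right,
      subst_zero_right]
    -- The bracket of P occurs here with its arguments reversed and at Dv. Since ∂ acts on c as
    -- -(Du+Dv), skew-symmetry brings it back to Du with a sign; the actions carrying -λ-∂ are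
    -- rewritten similarly.
    rw [subst_skewSubst c1 (evalU_del hDD _ _), e1, subst_evalU hDD hc,
      subst_evalP_right hDD hc hbr.sesq, hbr.skew_subst c2 hc, e3,
      subst_skewSubst (hDD.add_left (Commute.refl Dv)).neg_left (fun g => evalV_del hDD _ g _), e2,
      subst_evalV hDD hc]
    simp only [homOfTensor_tmul]
    abel

lemma evalThd_lieYB (hbr : IsLieConformal br) (hρ : IsSesquilinear ρ)
    (s t : P ⊗[k] ConfDual k V) :
    evalThd Du Dv c u v (lieYB (semidirectBracket br (dualAction ρ hρ)) (skewOf s) (skewOf t)) =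
      subst Du c (br (homOfTensor s u) (homOfTensor t v)) +
      subst Dv (c ∘ₗ homOfTensor t) (ρ (homOfTensor s v) u) -
      subst Du (c ∘ₗ homOfTensor t) (ρ (homOfTensor s u) v) := by
  induction s, t using tensor_induction₂ (k := k) with
  | h0 t => simp [skewOf_zero, homOfTensor_zero, subst_zero_right]
  | h0' t => simp [skewOf_zero, homOfTensor_zero, subst_zero_right]
  | hadd s s' t hs hs' =>
    simp only [skewOf_add, homOfTensor_add, map_add, LinearMap.add_apply, LinearMap.comp_add,
      subst_add_right, hs, hs']
    abel
  | hadd' s t t' hs hs' =>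
    simp only [skewOf_add, homOfTensor_add, map_add, LinearMap.add_apply, LinearMap.comp_add,
      subst_add_right, hs, hs']
    abel
  | ht a f b g =>
    have c2 : Commute Dv (-(Du + Dv)) := (hDD.symm.add_right (Commute.refl Dv)).neg_right
    have c3 : Commute (-(Du + Dv)) Dv := c2.symm
    have e2 : -(-(Du + Dv)) - Dv = Du := by abel
    have e3 : -Dv - -(Du + Dv) = Du := by abel
    simp only [skewOf_tmul, map_sub, LinearMap.sub_apply, lieYB_tmul,
      evalThd_subst_del₂ hDD, evalThd_subst_del₃ hDD hc,
      evalThd_slot₁, evalThd_slot₂, evalThd_slot₃, subst_fst_semidirectBracket,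
      subst_snd_semidirectBracket, map_zero, LinearMap.zero_apply, evalP_zero_left,
      evalP_zero_right, evalU_zero_left, evalU_zero_right, evalV_zero_left, evalV_zero_right,
      subst_zero_right]
    rw [subst_evalU hDD hc, subst_evalP_right hDD hc hbr.sesq, hbr.skew_subst c2 hc, e3,
      subst_skewSubst c3 (fun g => evalV_del hDD _ g _), e2, subst_evalV hDD hc]
    simp only [homOfTensor_tmul]
    abel

/-- As for the bracket. The product at μ = ∂⊗I⊗I contributes the action of a right factor, and its
-λ-∂ at λ = -(Du+Dv) becomes Du. -/
lemma evalFst_assocYB (hpr : IsCommAssocConformal pr) (hl : IsSesquilinear l)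
    (s t : P ⊗[k] ConfDual k V) :
    evalFst Du Dv c u v
        (assocYB (semidirectProduct pr (-dualAction l hl)) (skewOf s) (skewOf t)) =
      subst Du c (pr (homOfTensor s u) (homOfTensor t v)) -
      subst Du (c ∘ₗ homOfTensor s) (l (homOfTensor t u) v) -
      subst Dv (c ∘ₗ homOfTensor s) (l (homOfTensor t v) u) := by
  induction s, t using tensor_induction₂ (k := k) with
  | h0 t => simp [skewOf_zero, homOfTensor_zero, subst_zero_right]
  | h0' t => simp [skewOf_zero, homOfTensor_zero, subst_zero_right]
  | hadd s s' t hs hs' =>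
    simp only [skewOf_add, homOfTensor_add, map_add, LinearMap.add_apply, LinearMap.comp_add,
      subst_add_right, hs, hs']
    abel
  | hadd' s t t' hs hs' =>
    simp only [skewOf_add, homOfTensor_add, map_add, LinearMap.add_apply, LinearMap.comp_add,
      subst_add_right, hs, hs']
    abel
  | ht a f b g =>
    have c1 : Commute (-(Du + Dv)) Du := ((Commute.refl Du).add_left hDD.symm).neg_left
    have c2 : Commute (-(Du + Dv)) Dv := (hDD.add_left (Commute.refl Dv)).neg_left
    have e1 : -(-(Du + Dv)) - Du = Dv := by abel
    have e2 : -(-(Du + Dv)) - Dv = Du := by abel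
    simp only [skewOf_tmul, map_sub, LinearMap.sub_apply, assocYB_tmul, map_add,
      evalFst_subst_del₁ hDD hc, evalFst_subst_del₂ hDD, evalFst_subst_neg_add hDD hc,
      evalFst_slot₁, evalFst_slot₂, evalFst_slot₃, subst_fst_semidirectProduct,
      subst_snd_semidirectProduct, map_zero, LinearMap.zero_apply, LinearMap.neg_apply, map_neg,
      evalP_zero_left, evalP_zero_right, evalU_zero_left, evalU_zero_right, evalV_zero_left,
      evalV_zero_right, subst_zero_right]
    rw [subst_skewSubst c2 (fun g => evalV_del hDD _ g _), e2, subst_evalU hDD hc,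
      subst_evalV hDD hc, subst_evalP_left hDD hc hpr.sesq]
    simp only [homOfTensor_tmul]
    abel

lemma evalSnd_assocYB (hpr : IsCommAssocConformal pr) (hl : IsSesquilinear l)
    (s t : P ⊗[k] ConfDual k V) :
    evalSnd Du Dv c u v
        (assocYB (semidirectProduct pr (-dualAction l hl)) (skewOf s) (skewOf t)) =
      subst Du c (pr (homOfTensor s u) (homOfTensor t v)) -
      subst Du (c ∘ₗ homOfTensor t) (l (homOfTensor s u) v) -
      subst Dv (c ∘ₗ homOfTensor s) (l (homOfTensor t v) u) := by
  induction s, t using tensor_induction₂ (k := k) with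
  | h0 t => simp [skewOf_zero, homOfTensor_zero, subst_zero_right]
  | h0' t => simp [skewOf_zero, homOfTensor_zero, subst_zero_right]
  | hadd s s' t hs hs' =>
    simp only [skewOf_add, homOfTensor_add, map_add, LinearMap.add_apply, LinearMap.comp_add,
      subst_add_right, hs, hs']
    abel
  | hadd' s t t' hs hs' =>
    simp only [skewOf_add, homOfTensor_add, map_add, LinearMap.add_apply, LinearMap.comp_add,
      subst_add_right, hs, hs']
    abel
  | ht a f b g =>
    have c1 : Commute (-(Du + Dv)) Du := ((Commute.refl Du).add_left hDD.symm).neg_left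
    have c2 : Commute (-(Du + Dv)) Dv := (hDD.add_left (Commute.refl Dv)).neg_left
    have e1 : -(-(Du + Dv)) - Du = Dv := by abel
    have e2 : -(-(Du + Dv)) - Dv = Du := by abel
    have e3 : -Dv - -(Du + Dv) = Du := by abel
    simp only [skewOf_tmul, map_sub, LinearMap.sub_apply, assocYB_tmul, map_add,
      evalSnd_subst_del₁ hDD, evalSnd_subst_del₂ hDD hc, evalSnd_subst_neg_add hDD hc,
      evalSnd_slot₁, evalSnd_slot₂, evalSnd_slot₃, subst_fst_semidirectProduct,
      subst_snd_semidirectProduct, map_zero, LinearMap.zero_apply, LinearMap.neg_apply, map_neg,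
      evalP_zero_left, evalP_zero_right, evalU_zero_left, evalU_zero_right, evalV_zero_left,
      evalV_zero_right, subst_zero_right]
    rw [subst_skewSubst c1 (evalU_del hDD _ _), e1, subst_evalU hDD hc,
      subst_evalV hDD hc, subst_evalP_right hDD hc hpr.sesq, hpr.comm_subst c2.symm hc, e3]
    simp only [homOfTensor_tmul]
    abel

lemma evalThd_assocYB (hpr : IsCommAssocConformal pr) (hl : IsSesquilinear l)
    (s t : P ⊗[k] ConfDual k V) :
    evalThd Du Dv c u v
        (assocYB (semidirectProduct pr (-dualAction l hl)) (skewOf s) (skewOf t)) =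
      subst Du c (pr (homOfTensor s u) (homOfTensor t v)) -
      subst Du (c ∘ₗ homOfTensor t) (l (homOfTensor s u) v) -
      subst Dv (c ∘ₗ homOfTensor t) (l (homOfTensor s v) u) := by
  induction s, t using tensor_induction₂ (k := k) with
  | h0 t => simp [skewOf_zero, homOfTensor_zero, subst_zero_right]
  | h0' t => simp [skewOf_zero, homOfTensor_zero, subst_zero_right]
  | hadd s s' t hs hs' =>
    simp only [skewOf_add, homOfTensor_add, map_add, LinearMap.add_apply, LinearMap.comp_add,
      subst_add_right, hs, hs']
    abel
  | hadd' s t t' hs hs' =>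
    simp only [skewOf_add, homOfTensor_add, map_add, LinearMap.add_apply, LinearMap.comp_add,
      subst_add_right, hs, hs']
    abel
  | ht a f b g =>
    have c1 : Commute (-(Du + Dv)) Du := ((Commute.refl Du).add_left hDD.symm).neg_left
    have c2 : Commute (-(Du + Dv)) Dv := (hDD.add_left (Commute.refl Dv)).neg_left
    have e1 : -(-(Du + Dv)) - Du = Dv := by abel
    have e2 : -(-(Du + Dv)) - Dv = Du := by abel
    simp only [skewOf_tmul, map_sub, LinearMap.sub_apply, assocYB_tmul, map_add,
      evalThd_subst_del₁ hDD, evalThd_subst_del₂ hDD, evalThd_subst_neg_add hDD,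
      evalThd_slot₁, evalThd_slot₂, evalThd_slot₃, subst_fst_semidirectProduct,
      subst_snd_semidirectProduct, map_zero, LinearMap.zero_apply, LinearMap.neg_apply, map_neg,
      evalP_zero_left, evalP_zero_right, evalU_zero_left, evalU_zero_right, evalV_zero_left,
      evalV_zero_right, subst_zero_right]
    rw [subst_skewSubst c2 (fun g => evalV_del hDD _ g _), e2, subst_evalU hDD hc,
      subst_evalV hDD hc, subst_evalP_left hDD hc hpr.sesq]
    simp only [homOfTensor_tmul]
    abel

end values

end TripleEvaluation

/-! ### Recovering a tensor modulo the total ∂ from its evaluations. -/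

section Reconstruction

variable {k : Type*} [Field k]
  {P : Type*} [AddCommGroup P] [Module k P] [Module k[X] P] [IsScalarTower k k[X] P]
  {V : Type*} [AddCommGroup V] [Module k V] [Module k[X] V] [IsScalarTower k k[X] V]
  {W : Type*} [AddCommGroup W] [Module k W]
  {br pr : P →ₗ[k] P →ₗ[k] (ℕ →₀ P)} {ρ l : P →ₗ[k] V →ₗ[k] (ℕ →₀ V)}

section commute

variable {E : Type*} [AddCommGroup E] [Module k E] [Module k[X] E] [IsScalarTower k k[X] E]

lemma commute_del₁₂ : Commute (del₁ k E) (del₂ k E) :=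
  LinearMap.ext fun t => triple_ext (F := del₁ k E ∘ₗ del₂ k E) (G := del₂ k E ∘ₗ del₁ k E)
    (fun _ _ _ => rfl) t

lemma commute_del₁₃ : Commute (del₁ k E) (del₃ k E) :=
  LinearMap.ext fun t => triple_ext (F := del₁ k E ∘ₗ del₃ k E) (G := del₃ k E ∘ₗ del₁ k E)
    (fun _ _ _ => rfl) t

lemma commute_del₂₃ : Commute (del₂ k E) (del₃ k E) :=
  LinearMap.ext fun t => triple_ext (F := del₂ k E ∘ₗ del₃ k E) (G := del₃ k E ∘ₗ del₂ k E)
    (fun _ _ _ => rfl) t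

end commute

/-- The operator induced on the cokernel of `S` by an operator which commutes with `S`. -/
def cokerMap (S A : Module.End k W) (h : Commute A S) : Module.End k (W ⧸ LinearMap.range S) :=
  Submodule.mapQ _ _ A (by
    rintro _ ⟨t, rfl⟩
    exact ⟨A t, congr($(h.eq.symm) t)⟩)

lemma cokerMap_commute {S A B : Module.End k W} (hA : Commute A S) (hB : Commute B S)
    (h : Commute A B) : Commute (cokerMap S A hA) (cokerMap S B hB) := by
  refine LinearMap.ext fun q => ?_
  obtain ⟨t, rfl⟩ := Submodule.mkQ_surjective _ q
  exact congr((LinearMap.range S).mkQ ($(h.eq) t))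

lemma subst_mem {G : Submodule k W} {Λ : Module.End k W} (hΛ : ∀ w ∈ G, Λ w ∈ G)
    {h : V →ₗ[k] W} (hh : ∀ v, h v ∈ G) (p : ℕ →₀ V) : subst Λ h p ∈ G := by
  rw [subst_apply]
  have key : ∀ n v, (Λ ^ n) (h v) ∈ G := fun n v => by
    induction n with
    | zero => exact hh v
    | succ n ih => rw [pow_succ']; exact hΛ _ ih
  exact Submodule.sum_mem _ fun n _ => key n _

/-- The dual basis expansion of f, transported along a map that turns ∂ into d. -/
lemma sum_aeval_confCoord {ι : Type*} [Fintype ι] (b : Module.Basis ι k[X] V)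
    {d : Module.End k W} {L : ConfDual k V →ₗ[k] W} (hL : ∀ f, L (del k _ f) = d (L f))
    (f : ConfDual k V) :
    ∑ i, Polynomial.aeval (-d) (f.toLin (b i)) (L (confCoord b i)) = L f := by
  conv_rhs => rw [ConfDual.eq_sum_confCoord b f, map_sum]
  refine Finset.sum_congr rfl fun i _ => ?_
  rw [intertwine_aeval (Λ' := -d)]
  intro g
  simp only [LinearMap.neg_apply, map_neg, hL]

section coker

variable (k P V)

/-- `∂ ⊗ I ⊗ I + I ⊗ ∂ ⊗ I + I ⊗ I ⊗ ∂` on `E ⊗ E ⊗ E`, for `E = P ⊕ V^{*c}`. -/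
abbrev totalDel : Module.End k
    ((P × ConfDual k V) ⊗[k] ((P × ConfDual k V) ⊗[k] (P × ConfDual k V))) :=
  del₁ k (P × ConfDual k V) + del₂ k (P × ConfDual k V) + del₃ k (P × ConfDual k V)

/-- The operator induced by `∂ ⊗ I ⊗ I` on the cokernel of `totalDel`. -/
def cokerDel₁ : Module.End k (_ ⧸ LinearMap.range (totalDel k P V)) :=
  cokerMap _ (del₁ k _) (((Commute.refl _).add_right commute_del₁₂).add_right commute_del₁₃)

/-- The operator induced by `I ⊗ ∂ ⊗ I` on the cokernel of `totalDel`. -/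
def cokerDel₂ : Module.End k (_ ⧸ LinearMap.range (totalDel k P V)) :=
  cokerMap _ (del₂ k _) ((commute_del₁₂.symm.add_right (Commute.refl _)).add_right commute_del₂₃)

/-- The operator induced by `I ⊗ I ⊗ ∂` on the cokernel of `totalDel`. -/
def cokerDel₃ : Module.End k (_ ⧸ LinearMap.range (totalDel k P V)) :=
  cokerMap _ (del₃ k _) ((commute_del₁₃.symm.add_right commute_del₂₃.symm).add_right
    (Commute.refl _))

/-- The relation that makes the cokernel an admissible target: each of the three operators is minus
the sum of the other two. -/
lemma cokerDel_sum : cokerDel₁ k P V + cokerDel₂ k P V + cokerDel₃ k P V = 0 := by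
  refine LinearMap.ext fun q => ?_
  obtain ⟨t, rfl⟩ := Submodule.mkQ_surjective _ q
  change (LinearMap.range (totalDel k P V)).mkQ (totalDel k P V t) = 0
  rw [Submodule.mkQ_apply, Submodule.Quotient.mk_eq_zero]
  exact ⟨t, rfl⟩

lemma commute_cokerDel₁₂ : Commute (cokerDel₁ k P V) (cokerDel₂ k P V) :=
  cokerMap_commute _ _ commute_del₁₂

lemma commute_cokerDel₁₃ : Commute (cokerDel₁ k P V) (cokerDel₃ k P V) :=
  cokerMap_commute _ _ commute_del₁₃

lemma commute_cokerDel₂₃ : Commute (cokerDel₂ k P V) (cokerDel₃ k P V) :=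
  cokerMap_commute _ _ commute_del₂₃

lemma cokerDel₁_eq : cokerDel₁ k P V = -(cokerDel₂ k P V + cokerDel₃ k P V) := by
  rw [eq_neg_iff_add_eq_zero, ← add_assoc, cokerDel_sum]

lemma cokerDel₂_eq : cokerDel₂ k P V = -(cokerDel₁ k P V + cokerDel₃ k P V) := by
  rw [eq_neg_iff_add_eq_zero, ← add_assoc, add_comm (cokerDel₂ k P V), cokerDel_sum]

lemma cokerDel₃_eq : cokerDel₃ k P V = -(cokerDel₁ k P V + cokerDel₂ k P V) := by
  rw [eq_neg_iff_add_eq_zero, add_comm, cokerDel_sum]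

variable {k P V}

/-- `a ↦ a ⊗ f ⊗ g` modulo the image of `totalDel`. -/
def cokerFst (f g : ConfDual k V) : P →ₗ[k] _ ⧸ LinearMap.range (totalDel k P V) :=
  (LinearMap.range (totalDel k P V)).mkQ ∘ₗ slot₁ (0, f) (0, g) ∘ₗ LinearMap.inl k P _

/-- `a ↦ f ⊗ a ⊗ g` modulo the image of `totalDel`. -/
def cokerSnd (f g : ConfDual k V) : P →ₗ[k] _ ⧸ LinearMap.range (totalDel k P V) :=
  (LinearMap.range (totalDel k P V)).mkQ ∘ₗ slot₂ (0, f) (0, g) ∘ₗ LinearMap.inl k P _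

/-- `a ↦ f ⊗ g ⊗ a` modulo the image of `totalDel`. -/
def cokerThd (f g : ConfDual k V) : P →ₗ[k] _ ⧸ LinearMap.range (totalDel k P V) :=
  (LinearMap.range (totalDel k P V)).mkQ ∘ₗ slot₃ (0, f) (0, g) ∘ₗ LinearMap.inl k P _

lemma inl_del {Q : Type*} [AddCommGroup Q] [Module k Q] [Module k[X] Q] [IsScalarTower k k[X] Q]
    (a : P) : LinearMap.inl k P Q (del k P a) = del k (P × Q) (LinearMap.inl k P Q a) := by
  rw [del_prod]; simp

lemma inr_del {Q : Type*} [AddCommGroup Q] [Module k Q] [Module k[X] Q] [IsScalarTower k k[X] Q]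
    (a : Q) : LinearMap.inr k P Q (del k Q a) = del k (P × Q) (LinearMap.inr k P Q a) := by
  rw [del_prod]; simp

lemma cokerFst_del (f g : ConfDual k V) (a : P) : cokerFst f g (del k P a) =
    (-(cokerDel₂ k P V + cokerDel₃ k P V)) (cokerFst f g a) := by
  rw [← cokerDel₁_eq, cokerFst, LinearMap.comp_apply, LinearMap.comp_apply, inl_del]
  rfl

lemma cokerSnd_del (f g : ConfDual k V) (a : P) : cokerSnd f g (del k P a) =
    (-(cokerDel₁ k P V + cokerDel₃ k P V)) (cokerSnd f g a) := by
  rw [← cokerDel₂_eq, cokerSnd, LinearMap.comp_apply, LinearMap.comp_apply, inl_del]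
  rfl

lemma cokerThd_del (f g : ConfDual k V) (a : P) : cokerThd f g (del k P a) =
    (-(cokerDel₁ k P V + cokerDel₂ k P V)) (cokerThd f g a) := by
  rw [← cokerDel₃_eq, cokerThd, LinearMap.comp_apply, LinearMap.comp_apply, inl_del]
  rfl

variable {ι : Type*} [Fintype ι] (b : Module.Basis ι k[X] V)

/-- Reconstruction, modulo the image of `totalDel`, of the components in which `P` occurs once. -/
def reconstruct :
    (P × ConfDual k V) ⊗[k] ((P × ConfDual k V) ⊗[k] (P × ConfDual k V)) →ₗ[k]
      _ ⧸ LinearMap.range (totalDel k P V) :=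
  ∑ i, ∑ j,
    (evalFst (cokerDel₂ k P V) (cokerDel₃ k P V) (cokerFst (confCoord b i) (confCoord b j))
        (b i) (b j) +
      evalSnd (cokerDel₁ k P V) (cokerDel₃ k P V) (cokerSnd (confCoord b i) (confCoord b j))
        (b i) (b j) +
      evalThd (cokerDel₁ k P V) (cokerDel₂ k P V) (cokerThd (confCoord b i) (confCoord b j))
        (b i) (b j))

variable (t : (P × ConfDual k V) ⊗[k] ((P × ConfDual k V) ⊗[k] (P × ConfDual k V)))

lemma reconstruct_apply : reconstruct b t = ∑ i, ∑ j,
    (evalFst (cokerDel₂ k P V) (cokerDel₃ k P V) (cokerFst (confCoord b i) (confCoord b j))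
        (b i) (b j) t +
      evalSnd (cokerDel₁ k P V) (cokerDel₃ k P V) (cokerSnd (confCoord b i) (confCoord b j))
        (b i) (b j) t +
      evalThd (cokerDel₁ k P V) (cokerDel₂ k P V) (cokerThd (confCoord b i) (confCoord b j))
        (b i) (b j) t) := by
  simp only [reconstruct, LinearMap.sum_apply, LinearMap.add_apply]

/-- Each of the three evaluations has its pair of operators chosen so that a given ∂ acts in the
same way on all of them: directly where the slot is in V^{*c}, through the vanishing sum where it
holds P. -/
lemma reconstruct_del₁ : reconstruct b (del₁ k _ t) = cokerDel₁ k P V (reconstruct b t) := by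
  simp only [reconstruct_apply, map_sum, map_add,
    evalFst_del₁ (commute_cokerDel₂₃ k P V) (cokerFst_del _ _),
    evalSnd_del₁ (commute_cokerDel₁₃ k P V), evalThd_del₁ (commute_cokerDel₁₂ k P V),
    ← cokerDel₁_eq]

lemma reconstruct_del₂ : reconstruct b (del₂ k _ t) = cokerDel₂ k P V (reconstruct b t) := by
  simp only [reconstruct_apply, map_sum, map_add,
    evalFst_del₂ (commute_cokerDel₂₃ k P V),
    evalSnd_del₂ (commute_cokerDel₁₃ k P V) (cokerSnd_del _ _),
    evalThd_del₂ (commute_cokerDel₁₂ k P V), ← cokerDel₂_eq]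

lemma reconstruct_del₃ : reconstruct b (del₃ k _ t) = cokerDel₃ k P V (reconstruct b t) := by
  simp only [reconstruct_apply, map_sum, map_add,
    evalFst_del₃ (commute_cokerDel₂₃ k P V),
    evalSnd_del₃ (commute_cokerDel₁₃ k P V),
    evalThd_del₃ (commute_cokerDel₁₂ k P V) (cokerThd_del _ _), ← cokerDel₃_eq]

/-- The tensors which `reconstruct` maps to their class. -/
def reconstructible : Submodule k
    ((P × ConfDual k V) ⊗[k] ((P × ConfDual k V) ⊗[k] (P × ConfDual k V))) :=
  LinearMap.eqLocus (reconstruct b) (LinearMap.range (totalDel k P V)).mkQ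

variable {t} {b}

lemma mem_reconstructible : t ∈ reconstructible b ↔
    reconstruct b t = (LinearMap.range (totalDel k P V)).mkQ t := Iff.rfl

/-- Stability under the ∂ operators lets membership of a substituted polynomial be tested on its
coefficients. -/
lemma del₁_mem_reconstructible (ht : t ∈ reconstructible b) :
    del₁ k _ t ∈ reconstructible b := by
  rw [mem_reconstructible] at ht ⊢
  rw [reconstruct_del₁, ht]
  rfl

lemma del₂_mem_reconstructible (ht : t ∈ reconstructible b) :
    del₂ k _ t ∈ reconstructible b := by
  rw [mem_reconstructible] at ht ⊢
  rw [reconstruct_del₂, ht]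
  rfl

lemma del₃_mem_reconstructible (ht : t ∈ reconstructible b) :
    del₃ k _ t ∈ reconstructible b := by
  rw [mem_reconstructible] at ht ⊢
  rw [reconstruct_del₃, ht]
  rfl

lemma neg_add_mem_reconstructible (ht : t ∈ reconstructible b) :
    (-(del₁ k (P × ConfDual k V) + del₂ k (P × ConfDual k V))) t ∈ reconstructible b := by
  rw [LinearMap.neg_apply, LinearMap.add_apply]
  exact Submodule.neg_mem _
    (Submodule.add_mem _ (del₁_mem_reconstructible ht) (del₂_mem_reconstructible ht))

variable (a : P) (f g : ConfDual k V)

lemma reconstructible_fst :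
    ((a, 0) ⊗ₜ[k] ((0, f) ⊗ₜ[k] (0, g)) :
      (P × ConfDual k V) ⊗[k] ((P × ConfDual k V) ⊗[k] (P × ConfDual k V))) ∈
      reconstructible b := by
  rw [mem_reconstructible, reconstruct_apply]
  simp only [evalFst_tmul, evalSnd_tmul, evalThd_tmul, evalP_zero_left, LinearMap.zero_apply,
    add_zero]
  -- The other two evaluations vanish on this component. The sum over j recovers g with the second
  -- slot fixed, and then the sum over i recovers f.
  have h3 : ∀ x, ∑ j, Polynomial.aeval (-cokerDel₃ k P V) (g.toLin (b j))
      (cokerFst x (confCoord b j) a) = cokerFst x g a := fun x =>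
    sum_aeval_confCoord b (L := (LinearMap.range (totalDel k P V)).mkQ ∘ₗ
      slot₃ (a, 0) (0, x) ∘ₗ LinearMap.inr k P _) (fun y => by
        simp only [LinearMap.comp_apply, inr_del]; rfl) g
  have h2 := sum_aeval_confCoord b (d := cokerDel₂ k P V)
    (L := (LinearMap.range (totalDel k P V)).mkQ ∘ₗ slot₂ (a, 0) (0, g) ∘ₗ LinearMap.inr k P _)
    (fun y => by simp only [LinearMap.comp_apply, inr_del]; rfl) f
  refine Eq.trans (Finset.sum_congr rfl fun i _ => ?_) h2
  simp only [evalP, LinearMap.comp_apply]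
  rw [← map_sum, h3]
  rfl

lemma reconstructible_snd :
    ((0, f) ⊗ₜ[k] ((a, 0) ⊗ₜ[k] (0, g)) :
      (P × ConfDual k V) ⊗[k] ((P × ConfDual k V) ⊗[k] (P × ConfDual k V))) ∈
      reconstructible b := by
  rw [mem_reconstructible, reconstruct_apply]
  simp only [evalFst_tmul, evalSnd_tmul, evalThd_tmul, evalP_zero_left, evalP_zero_right,
    LinearMap.zero_apply, add_zero, zero_add]
  have h3 : ∀ x, ∑ j, Polynomial.aeval (-cokerDel₃ k P V) (g.toLin (b j))
      (cokerSnd x (confCoord b j) a) = cokerSnd x g a := fun x =>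
    sum_aeval_confCoord b (L := (LinearMap.range (totalDel k P V)).mkQ ∘ₗ
      slot₃ (0, x) (a, 0) ∘ₗ LinearMap.inr k P _) (fun y => by
        simp only [LinearMap.comp_apply, inr_del]; rfl) g
  have h2 := sum_aeval_confCoord b (d := cokerDel₁ k P V)
    (L := (LinearMap.range (totalDel k P V)).mkQ ∘ₗ slot₁ (a, 0) (0, g) ∘ₗ LinearMap.inr k P _)
    (fun y => by simp only [LinearMap.comp_apply, inr_del]; rfl) f
  refine Eq.trans (Finset.sum_congr rfl fun i _ => ?_) h2
  simp only [evalP, LinearMap.comp_apply]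
  rw [← map_sum, h3]
  rfl

lemma reconstructible_thd :
    ((0, f) ⊗ₜ[k] ((0, g) ⊗ₜ[k] (a, 0)) :
      (P × ConfDual k V) ⊗[k] ((P × ConfDual k V) ⊗[k] (P × ConfDual k V))) ∈
      reconstructible b := by
  rw [mem_reconstructible, reconstruct_apply]
  simp only [evalFst_tmul, evalSnd_tmul, evalThd_tmul, evalP_zero_left, evalP_zero_right,
    LinearMap.zero_apply, add_zero, zero_add]
  have h3 : ∀ x, ∑ j, Polynomial.aeval (-cokerDel₂ k P V) (g.toLin (b j))
      (cokerThd x (confCoord b j) a) = cokerThd x g a := fun x =>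
    sum_aeval_confCoord b (L := (LinearMap.range (totalDel k P V)).mkQ ∘ₗ
      slot₂ (0, x) (a, 0) ∘ₗ LinearMap.inr k P _) (fun y => by
        simp only [LinearMap.comp_apply, inr_del]; rfl) g
  have h2 := sum_aeval_confCoord b (d := cokerDel₁ k P V)
    (L := (LinearMap.range (totalDel k P V)).mkQ ∘ₗ slot₁ (0, g) (a, 0) ∘ₗ LinearMap.inr k P _)
    (fun y => by simp only [LinearMap.comp_apply, inr_del]; rfl) f
  refine Eq.trans (Finset.sum_congr rfl fun i _ => ?_) h2
  simp only [evalP, LinearMap.comp_apply]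
  rw [← map_sum, h3]
  rfl

end coker

end Reconstruction

/-! ### The Yang-Baxter elements involve P exactly once. -/

section Membership

variable {k : Type*} [Field k]
  {P : Type*} [AddCommGroup P] [Module k P] [Module k[X] P] [IsScalarTower k k[X] P]
  {V : Type*} [AddCommGroup V] [Module k V] [Module k[X] V] [IsScalarTower k k[X] V]
  {Q : Type*} [AddCommGroup Q] [Module k Q] [Module k[X] Q] [IsScalarTower k k[X] Q]
  {W : Type*} [AddCommGroup W] [Module k W]
  {br pr : P →ₗ[k] P →ₗ[k] (ℕ →₀ P)} {ρ l : P →ₗ[k] V →ₗ[k] (ℕ →₀ V)}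

lemma subst_mem_of_fst {G : Submodule k W} {Λ : Module.End k W} (hΛ : ∀ w ∈ G, Λ w ∈ G)
    {h : (P × Q) →ₗ[k] W} (hh : ∀ a, h (a, 0) ∈ G) {p : ℕ →₀ P × Q}
    (hp : mapCoeff (LinearMap.snd k P Q) p = 0) : subst Λ h p ∈ G := by
  have : p = mapCoeff (LinearMap.inl k P Q) (mapCoeff (LinearMap.fst k P Q) p) := by
    ext1 n
    exact Prod.ext rfl (DFunLike.congr_fun hp n)
  rw [this, subst_mapCoeff]
  exact subst_mem hΛ hh _

lemma subst_mem_of_snd {G : Submodule k W} {Λ : Module.End k W} (hΛ : ∀ w ∈ G, Λ w ∈ G)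
    {h : (P × Q) →ₗ[k] W} (hh : ∀ f, h (0, f) ∈ G) {p : ℕ →₀ P × Q}
    (hp : mapCoeff (LinearMap.fst k P Q) p = 0) : subst Λ h p ∈ G := by
  have : p = mapCoeff (LinearMap.inr k P Q) (mapCoeff (LinearMap.snd k P Q) p) := by
    ext1 n
    exact Prod.ext (DFunLike.congr_fun hp n) rfl
  rw [this, subst_mapCoeff]
  exact subst_mem hΛ hh _

lemma subst_mem_of_eq_zero {G : Submodule k W} {Λ : Module.End k W}
    {h : (P × Q) →ₗ[k] W} {p : ℕ →₀ P × Q} (hp : p = 0) : subst Λ h p ∈ G := by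
  rw [hp, map_zero]; exact G.zero_mem

/-- A product on `P ⊕ Q` for which `Q` is an ideal with zero product. -/
structure IsAbelianExtension (m : (P × Q) →ₗ[k] (P × Q) →ₗ[k] (ℕ →₀ P × Q)) : Prop where
  fst_fst : ∀ a b, mapCoeff (LinearMap.snd k P Q) (m (a, 0) (b, 0)) = 0
  fst_snd : ∀ a g, mapCoeff (LinearMap.fst k P Q) (m (a, 0) (0, g)) = 0
  snd_fst : ∀ f b, mapCoeff (LinearMap.fst k P Q) (m (0, f) (b, 0)) = 0
  snd_snd : ∀ f g, m (0, f) (0, g) = 0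

lemma semidirectBracket_isAbelianExtension (n : P →ₗ[k] Q →ₗ[k] (ℕ →₀ Q)) :
    IsAbelianExtension (semidirectBracket br n) where
  fst_fst a b := by simp [mapCoeff_snd_semidirectBracket]
  fst_snd a g := by simp [mapCoeff_fst_semidirectBracket]
  snd_fst f b := by simp [mapCoeff_fst_semidirectBracket]
  snd_snd f g := by simp [semidirectBracket]

lemma semidirectProduct_isAbelianExtension (n : P →ₗ[k] Q →ₗ[k] (ℕ →₀ Q)) :
    IsAbelianExtension (semidirectProduct pr n) where
  fst_fst a b := by simp [mapCoeff_snd_semidirectProduct]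
  fst_snd a g := by simp [mapCoeff_fst_semidirectProduct]
  snd_fst f b := by simp [mapCoeff_fst_semidirectProduct]
  snd_snd f g := by simp [semidirectProduct]

variable {ι : Type*} [Fintype ι] (b : Module.Basis ι k[X] V)
  {m : (P × ConfDual k V) →ₗ[k] (P × ConfDual k V) →ₗ[k] (ℕ →₀ P × ConfDual k V)}

lemma lieYB_mem_reconstructible (hm : IsAbelianExtension m) (s t : P ⊗[k] ConfDual k V) :
    lieYB m (skewOf s) (skewOf t) ∈ reconstructible b := by
  induction s, t using tensor_induction₂ (k := k) with
  | h0 t => simp [skewOf_zero]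
  | h0' t => simp [skewOf_zero]
  | hadd s s' t hs hs' =>
    rw [skewOf_add, map_add, LinearMap.add_apply]
    exact Submodule.add_mem _ hs hs'
  | hadd' s t t' hs hs' =>
    rw [skewOf_add, map_add]
    exact Submodule.add_mem _ hs hs'
  | ht a f c g =>
    simp only [skewOf_tmul, map_sub, LinearMap.sub_apply, lieYB_tmul]
    have d2 := fun w (hw : w ∈ reconstructible (P := P) b) => del₂_mem_reconstructible hw
    have d3 := fun w (hw : w ∈ reconstructible (P := P) b) => del₃_mem_reconstructible hw
    -- Twelve terms. In three the product is taken in P and the other two slots are in V^{*c}; in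
    -- six it is mixed, so lies in V^{*c}, and one other slot is in P; in three it is a product of
    -- elements of V^{*c} and vanishes.
    refine Submodule.sub_mem _ (Submodule.sub_mem _
      (Submodule.sub_mem _ (Submodule.sub_mem _ ?_ ?_) ?_)
      (Submodule.sub_mem _ (Submodule.sub_mem _ ?_ ?_) ?_)) (Submodule.sub_mem _
      (Submodule.sub_mem _ (Submodule.sub_mem _ ?_ ?_) ?_)
      (Submodule.sub_mem _ (Submodule.sub_mem _ ?_ ?_) ?_))
    · exact subst_mem_of_fst d2 (fun x => reconstructible_fst x f g) (hm.fst_fst a c)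
    · exact subst_mem_of_snd d3 (fun x => reconstructible_fst a x g) (hm.fst_snd c f)
    · exact subst_mem_of_eq_zero (hm.snd_snd g f)
    · exact subst_mem_of_snd d2 (fun x => reconstructible_snd a x g) (hm.snd_fst f c)
    · exact subst_mem_of_fst d3 (fun x => reconstructible_snd x f g) (hm.fst_fst c a)
    · exact subst_mem_of_snd d2 (fun x => reconstructible_snd c f x) (hm.snd_fst g a)
    · exact subst_mem_of_snd d2 (fun x => reconstructible_thd c x f) (hm.fst_snd a g)
    · exact subst_mem_of_eq_zero (hm.snd_snd g f)
    · exact subst_mem_of_snd d2 (fun x => reconstructible_fst a g x) (hm.fst_snd c f)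
    · exact subst_mem_of_eq_zero (hm.snd_snd f g)
    · exact subst_mem_of_snd d3 (fun x => reconstructible_thd c f x) (hm.snd_fst g a)
    · exact subst_mem_of_fst d2 (fun x => reconstructible_thd x f g) (hm.fst_fst c a)

lemma assocYB_mem_reconstructible (hm : IsAbelianExtension m) (s t : P ⊗[k] ConfDual k V) :
    assocYB m (skewOf s) (skewOf t) ∈ reconstructible b := by
  induction s, t using tensor_induction₂ (k := k) with
  | h0 t => simp [skewOf_zero]
  | h0' t => simp [skewOf_zero]
  | hadd s s' t hs hs' =>
    rw [skewOf_add, map_add, LinearMap.add_apply]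
    exact Submodule.add_mem _ hs hs'
  | hadd' s t t' hs hs' =>
    rw [skewOf_add, map_add]
    exact Submodule.add_mem _ hs hs'
  | ht a f c g =>
    simp only [skewOf_tmul, map_sub, LinearMap.sub_apply, assocYB_tmul]
    have d1 := fun w (hw : w ∈ reconstructible (P := P) b) => del₁_mem_reconstructible hw
    have d2 := fun w (hw : w ∈ reconstructible (P := P) b) => del₂_mem_reconstructible hw
    have d3 := fun w (hw : w ∈ reconstructible (P := P) b) => neg_add_mem_reconstructible hw
    refine Submodule.sub_mem _ (Submodule.sub_mem _
      (Submodule.add_mem _ (Submodule.sub_mem _ ?_ ?_) ?_)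
      (Submodule.add_mem _ (Submodule.sub_mem _ ?_ ?_) ?_)) (Submodule.sub_mem _
      (Submodule.add_mem _ (Submodule.sub_mem _ ?_ ?_) ?_)
      (Submodule.add_mem _ (Submodule.sub_mem _ ?_ ?_) ?_))
    · exact subst_mem_of_eq_zero (hm.snd_snd f g)
    · exact subst_mem_of_snd d3 (fun x => reconstructible_fst a x g) (hm.fst_snd c f)
    · exact subst_mem_of_fst d2 (fun x => reconstructible_fst x f g) (hm.fst_fst a c)
    · exact subst_mem_of_snd d1 (fun x => reconstructible_snd c f x) (hm.fst_snd a g)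
    · exact subst_mem_of_fst d3 (fun x => reconstructible_snd x f g) (hm.fst_fst c a)
    · exact subst_mem_of_snd d2 (fun x => reconstructible_snd a x g) (hm.snd_fst f c)
    · exact subst_mem_of_snd d1 (fun x => reconstructible_fst a g x) (hm.snd_fst f c)
    · exact subst_mem_of_eq_zero (hm.snd_snd g f)
    · exact subst_mem_of_snd d2 (fun x => reconstructible_thd c x f) (hm.fst_snd a g)
    · exact subst_mem_of_fst d1 (fun x => reconstructible_thd x f g) (hm.fst_fst a c)
    · exact subst_mem_of_snd d3 (fun x => reconstructible_thd c f x) (hm.snd_fst g a)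
    · exact subst_mem_of_eq_zero (hm.snd_snd f g)

end Membership

/-! ### The Yang-Baxter equation and O-operators. -/

section YangBaxterOOperator

variable {k : Type*} [Field k]
  {P : Type*} [AddCommGroup P] [Module k P] [Module k[X] P] [IsScalarTower k k[X] P]
  {V : Type*} [AddCommGroup V] [Module k V] [Module k[X] V] [IsScalarTower k k[X] V]
  {W : Type*} [AddCommGroup W] [Module k W] {Du Dv : Module.End k W} {c : P →ₗ[k] W} {u v : V}
  {br pr : P →ₗ[k] P →ₗ[k] (ℕ →₀ P)} {ρ l : P →ₗ[k] V →ₗ[k] (ℕ →₀ V)}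

lemma skewOf_skew {Q : Type*} [AddCommGroup Q] [Module k Q] (r : P ⊗[k] Q) :
    TensorProduct.comm k (P × Q) (P × Q) (skewOf r) = -skewOf r := by
  simp [skewOf]

/-- S commutes with ∂, so on c ∘ S it acts as -(Du+Dv), and -λ-∂ at λ = Du is Dv. This matches the
second action term of the O-operator equation with the term at Dv in the evaluations. -/
lemma subst_mapCoeff_skewSubst (hDD : Commute Du Dv)
    (hc : ∀ a, c (del k P a) = (-(Du + Dv)) (c a)) (t : P ⊗[k] ConfDual k V) (p : ℕ →₀ V) :
    subst Du c (mapCoeff (homOfTensor t) (skewSubst k V p)) =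
      subst Dv (c ∘ₗ homOfTensor t) p := by
  have h1 : Commute Du (-(Du + Dv)) := ((Commute.refl Du).add_right hDD).neg_right
  have h2 : -Du - -(Du + Dv) = Dv := by abel
  rw [subst_mapCoeff, subst_skewSubst h1, h2]
  intro x
  rw [LinearMap.comp_apply, homOfTensor_del, hc, LinearMap.comp_apply]

/-- The defect of the equation `[S(u)_λ S(v)] = S(ρ(S u)_λ v) - S(ρ(S v)_{-λ-∂} u)`. -/
def lieDefect (br : P →ₗ[k] P →ₗ[k] (ℕ →₀ P)) (ρ : P →ₗ[k] V →ₗ[k] (ℕ →₀ V)) (S : V →ₗ[k] P)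
    (u v : V) : ℕ →₀ P :=
  br (S u) (S v) - (mapCoeff S (ρ (S u) v) - mapCoeff S (skewSubst k V (ρ (S v) u)))

/-- The defect of the equation `S(u)_λ S(v) = S(l(S u)_λ v) + S(l(S v)_{-λ-∂} u)`. -/
def mulDefect (pr : P →ₗ[k] P →ₗ[k] (ℕ →₀ P)) (l : P →ₗ[k] V →ₗ[k] (ℕ →₀ V)) (S : V →ₗ[k] P)
    (u v : V) : ℕ →₀ P :=
  pr (S u) (S v) - (mapCoeff S (l (S u) v) + mapCoeff S (skewSubst k V (l (S v) u)))

variable [Module.Finite k[X] V] (hDD : Commute Du Dv)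
  (hc : ∀ a, c (del k P a) = (-(Du + Dv)) (c a)) (t : P ⊗[k] ConfDual k V)

include hDD hc

lemma subst_lieDefect : subst Du c (lieDefect br ρ (homOfTensor t) u v) =
    subst Du c (br (homOfTensor t u) (homOfTensor t v)) +
      subst Dv (c ∘ₗ homOfTensor t) (ρ (homOfTensor t v) u) -
      subst Du (c ∘ₗ homOfTensor t) (ρ (homOfTensor t u) v) := by
  rw [lieDefect, map_sub, map_sub, subst_mapCoeff_skewSubst hDD hc, subst_mapCoeff]
  abel

lemma subst_mulDefect : subst Du c (mulDefect pr l (homOfTensor t) u v) =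
    subst Du c (pr (homOfTensor t u) (homOfTensor t v)) -
      subst Du (c ∘ₗ homOfTensor t) (l (homOfTensor t u) v) -
      subst Dv (c ∘ₗ homOfTensor t) (l (homOfTensor t v) u) := by
  rw [mulDefect, map_sub, map_add, subst_mapCoeff_skewSubst hDD hc, subst_mapCoeff]
  abel

omit hDD hc

/-- The substitution λ ↦ -λ is an involution. -/
lemma subst_neg_lam_injective {p : ℕ →₀ P} (h : subst (-lam k P) (const k P) p = 0) : p = 0 := by
  have h1 : subst (-lam k P) (const k P) (subst (-lam k P) (const k P) p) = p := by
    rw [map_subst (φ := subst (-lam k P) (const k P)) (Λ' := lam k P)]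
    · rw [subst_congr (fun v => subst_const _ _ v), subst_lam_const]
    · intro w
      rw [LinearMap.neg_apply, map_neg, subst_lam, LinearMap.neg_apply, neg_neg]
  rw [← h1, h, map_zero]

lemma commute_neg_lam_lam_sub_del :
    Commute (-lam k P) (lam k P - del k (ℕ →₀ P)) :=
  ((Commute.refl (lam k P)).sub_right commute_lam_del).neg_left

/-- The choice Du = -λ, Dv = λ-∂ on P[λ] is made so that -(Du+Dv) = ∂, as required of c for the
inclusion of constants, while the variable can still be read off from Du. -/
lemma const_del_eq_neg_add (a : P) : const k P (del k P a) =
    (-(-lam k P + (lam k P - del k (ℕ →₀ P)))) (const k P a) := by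
  rw [show -(-lam k P + (lam k P - del k (ℕ →₀ P))) = del k (ℕ →₀ P) by abel, const_del]

lemma evalFst_eq_zero_of_mem
    {t : (P × ConfDual k V) ⊗[k] ((P × ConfDual k V) ⊗[k] (P × ConfDual k V))}
    (ht : t ∈ LinearMap.range (totalDel k P V)) (hDD : Commute Du Dv)
    (hc : ∀ a, c (del k P a) = (-(Du + Dv)) (c a)) : evalFst Du Dv c u v t = 0 := by
  obtain ⟨s, rfl⟩ := ht
  simp only [totalDel, LinearMap.add_apply, map_add, evalFst_del₁ hDD hc, evalFst_del₂ hDD,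
    evalFst_del₃ hDD, LinearMap.neg_apply]
  abel

/-- One evaluation, with values in P[λ], suffices to detect the defect. The converse uses all three,
with values in the cokernel, because the class has to be rebuilt from all its components. -/
lemma lieYB_mem_range_iff (hbr : IsLieConformal br) (hρ : IsSesquilinear ρ)
    [Module.Free k[X] V] :
    lieYB (semidirectBracket br (dualAction ρ hρ)) (skewOf t) (skewOf t) ∈
      LinearMap.range (totalDel k P V) ↔ ∀ u v, lieDefect br ρ (homOfTensor t) u v = 0 := by
  constructor
  · intro ht u v
    apply subst_neg_lam_injective (k := k)
    rw [subst_lieDefect commute_neg_lam_lam_sub_del const_del_eq_neg_add,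
      ← evalFst_lieYB commute_neg_lam_lam_sub_del const_del_eq_neg_add hbr.sesq hρ,
      evalFst_eq_zero_of_mem ht commute_neg_lam_lam_sub_del const_del_eq_neg_add]
  · intro h
    -- The class of the element is the sum of its three evaluations at pairs of basis vectors, and
    -- each of these is, up to sign, the image of a defect that is zero.
    have hr := lieYB_mem_reconstructible (Module.Free.chooseBasis k[X] V)
      (semidirectBracket_isAbelianExtension (br := br) (dualAction ρ hρ)) t t
    rw [mem_reconstructible, reconstruct_apply] at hr
    rw [← Submodule.Quotient.mk_eq_zero, ← Submodule.mkQ_apply, ← hr]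
    refine Finset.sum_eq_zero fun i _ => Finset.sum_eq_zero fun j _ => ?_
    rw [evalFst_lieYB (commute_cokerDel₂₃ k P V) (cokerFst_del _ _) hbr.sesq,
      ← subst_lieDefect (commute_cokerDel₂₃ k P V) (cokerFst_del _ _),
      evalSnd_lieYB (commute_cokerDel₁₃ k P V) (cokerSnd_del _ _) hbr,
      ← subst_lieDefect (commute_cokerDel₁₃ k P V) (cokerSnd_del _ _),
      evalThd_lieYB (commute_cokerDel₁₂ k P V) (cokerThd_del _ _) hbr,
      ← subst_lieDefect (commute_cokerDel₁₂ k P V) (cokerThd_del _ _), h]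
    simp only [map_zero, neg_zero, add_zero]

lemma assocYB_mem_range_iff (hpr : IsCommAssocConformal pr) (hl : IsSesquilinear l)
    [Module.Free k[X] V] :
    assocYB (semidirectProduct pr (-dualAction l hl)) (skewOf t) (skewOf t) ∈
      LinearMap.range (totalDel k P V) ↔ ∀ u v, mulDefect pr l (homOfTensor t) u v = 0 := by
  constructor
  · intro ht u v
    apply subst_neg_lam_injective (k := k)
    rw [subst_mulDefect commute_neg_lam_lam_sub_del const_del_eq_neg_add,
      ← evalFst_assocYB commute_neg_lam_lam_sub_del const_del_eq_neg_add hpr hl,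
      evalFst_eq_zero_of_mem ht commute_neg_lam_lam_sub_del const_del_eq_neg_add]
  · intro h
    have hr := assocYB_mem_reconstructible (Module.Free.chooseBasis k[X] V)
      (semidirectProduct_isAbelianExtension (pr := pr) (-dualAction l hl)) t t
    rw [mem_reconstructible, reconstruct_apply] at hr
    rw [← Submodule.Quotient.mk_eq_zero, ← Submodule.mkQ_apply, ← hr]
    refine Finset.sum_eq_zero fun i _ => Finset.sum_eq_zero fun j _ => ?_
    rw [evalFst_assocYB (commute_cokerDel₂₃ k P V) (cokerFst_del _ _) hpr,
      ← subst_mulDefect (commute_cokerDel₂₃ k P V) (cokerFst_del _ _),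
      evalSnd_assocYB (commute_cokerDel₁₃ k P V) (cokerSnd_del _ _) hpr,
      ← subst_mulDefect (commute_cokerDel₁₃ k P V) (cokerSnd_del _ _),
      evalThd_assocYB (commute_cokerDel₁₂ k P V) (cokerThd_del _ _) hpr,
      ← subst_mulDefect (commute_cokerDel₁₂ k P V) (cokerThd_del _ _), h]
    simp only [map_zero, add_zero]

/-- `r - τ r` solves the Poisson conformal Yang-Baxter equation if and only if the homomorphism
corresponding to `r` is an `O`-operator. -/
theorem isSkewPCYBESolution_iff [Module.Free k[X] V] (hP : IsPoissonConformal br pr)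
    (hρ : IsSesquilinear ρ) (hl : IsSesquilinear l) :
    IsSkewPCYBESolution (semidirectBracket br (dualAction ρ hρ))
        (semidirectProduct pr (-dualAction l hl)) (skewOf t) ↔
      IsOOperator br pr ρ l (Chom.evalZero (tensorToChom t)) := by
  constructor
  · intro h
    exact
      { mul := fun u v =>
          sub_eq_zero.mp ((assocYB_mem_range_iff t hP.commAssoc hl).mp h.assoc u v)
        lie := fun u v => sub_eq_zero.mp ((lieYB_mem_range_iff t hP.lie hρ).mp h.lie u v) }
  · intro h
    exact
      { skew := skewOf_skew t
        lie := (lieYB_mem_range_iff t hP.lie hρ).mpr fun u v => sub_eq_zero.mpr (h.lie u v)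
        assoc := (assocYB_mem_range_iff t hP.commAssoc hl).mpr fun u v =>
          sub_eq_zero.mpr (h.mul u v) }

end YangBaxterOOperator

end PoissonConformal

end

/-! ### The theorem. -/

theorem theorem3p16
    {k : Type*} [Field k] [CharZero k]
    {P : Type*} [AddCommGroup P] [Module k P] [Module k[X] P] [IsScalarTower k k[X] P]
    [Module.Finite k[X] P] [Module.Free k[X] P]
    {V : Type*} [AddCommGroup V] [Module k V] [Module k[X] V] [IsScalarTower k k[X] V]
    [Module.Finite k[X] V] [Module.Free k[X] V]
    (br pr : P →ₗ[k] P →ₗ[k] (ℕ →₀ P)) (hP : IsPoissonConformal br pr)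
    (ρ l : P →ₗ[k] V →ₗ[k] (ℕ →₀ V)) (hV : IsPoissonRep br pr ρ l) :
    -- the semidirect product `P ⋉ V^{*c}` along `(ρ^*, -l^*)` is a Poisson conformal algebra
    IsPoissonConformal
      (semidirectBracket br (dualAction ρ hV.lie.sesq))
      (semidirectProduct pr (-dualAction l hV.commAssoc.sesq)) ∧
    -- every `T` in `Chom(V, P)` corresponds to exactly one element of `P ⊗ V^{*c}`
    Function.Bijective (tensorToChom : P ⊗[k] ConfDual k V →ₗ[k] Chom k V P) ∧
    ∀ (T : Chom k V P) (rT : P ⊗[k] ConfDual k V), tensorToChom rT = T →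
      (IsSkewPCYBESolution
          (semidirectBracket br (dualAction ρ hV.lie.sesq))
          (semidirectProduct pr (-dualAction l hV.commAssoc.sesq))
          (skewOf rT) ↔
        IsOOperator br pr ρ l (Chom.evalZero T)) := by
  refine ⟨(hV.dual hP).semidirect hP, tensorToChom_bijective, ?_⟩
  rintro _ rT rfl
  exact isSkewPCYBESolution_iff rT hP hV.lie.sesq hV.commAssoc.sesq
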